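/- A degree sequence of length $n$ is a sequence $D=(d_1,\dots,d_n)$ of integers with $1\le d_i\le n-1$ and $\sum_i d_i$ even. Let $\mathcal G(D)$ be the set of its realizations, i.e. of the simple graphs on $\{1,\dots,n\}$ in which vertex $i$ has degree $d_i$ for every $i$; $D$ is graphic if $\mathcal G(D)\neq\emptyset$. For positive integers $n>c_1\ge c_2$ and $\Sigma$, let $\mathbb D(n,\Sigma,c_1,c_2)$ be the set of all degree sequences of length $n$ with sum $\Sigma$ and $c_1\ge d_i\ge c_2$ for all $i$; it is fully graphic if all its members are graphic. For a graphic $D$ of length $n$ put $$\partial^{++}(D)=\sum_{1\le i\le j\le n}\frac{|\mathcal G(D+e_i+e_j)|}{|\mathcal G(D)|},$$ where $e_i$ is the $i$-th unit vector. A set of degree sequences is $p$-stable, for a polynomial $p$, if $\partial^{++}(D)\le p(n)$ for each of its graphic members $D$, where $n$ is the length of $D$; an infinite set of degree sequences is P-stable if it is $p$-stable for some polynomial $p$. The switch Markov chain on $\mathcal G(D)$ does nothing with probability $1/2$; otherwise it chooses uniformly four vertices and one of the three 4-cycles on them, and, if the edges of this cycle are alternately edges and non-edges of the current graph, it exchanges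 these edges and non-edges. (Thus a graph moves to each graph obtained by replacing two edges $v_1w_1,v_2w_2$ with two non-edges $v_1w_2,v_2w_1$ with probability $\frac{1}{6}\binom n4^{-1}$.) Its mixing time $\tau_D(\varepsilon)$ is the least $t$ such that after every number $s\ge t$ of steps, from every initial state, the total variation distance to the uniform distribution on $\mathcal G(D)$ is at most $\varepsilon$. **Corollary 1.4.** Let $$\mathbb D:=\bigcup\{\mathbb D(n,\Sigma,c_1,c_2): n>c_1\ge c_2\ge 1,\ \mathbb D(n,\Sigma,c_1,c_2)\text{ is fully graphic}\}.$$ Then $\mathbb D$ is $3n^{13}$-stable; in particular, $\mathbb D$ (which is infinite) is P-stable. Moreover, the switch Markov chain is rapidly mixing on $\mathbb D$: there is a polynomial $q$ in two variables such that $\tau_D(\varepsilon)\le q(n,\log(1/\varepsilon))$ for every $D\in\mathbb D$, where $n$ is the length of $D$, and every $0<\varepsilon<1$. -/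

import Mathlib

namespace FullyGraphic

open scoped Classical

noncomputable section

/-- Finite sequences of natural numbers, of arbitrary length `d.1`. -/
abbrev Seq : Type := Σ n : ℕ, (Fin n → ℕ)

/-- A degree sequence of length `n`: positive integers, none exceeding `n - 1`, with even sum. -/
def IsDegreeSequence (d : Seq) : Prop :=
  (∀ i, 0 < d.2 i ∧ d.2 i < d.1) ∧ Even (∑ i, d.2 i)

/-- The realizations of `d`: simple graphs on `n` labelled vertices in which vertex `i` has
degree `d i`. -/
abbrev Realization {n : ℕ} (d : Fin n → ℕ) : Type :=
  {G : SimpleGraph (Fin n) // ∀ i, G.degree i = d i}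

/-- A sequence is graphic if it has a realization. -/
def IsGraphic (d : Seq) : Prop := Nonempty (Realization d.2)

/-- The simple region `𝔻(n, S, a, b)`: degree sequences of length `n` with sum `S` and all entries
between `b` and `a`. -/
def simpleRegion (n S a b : ℕ) : Set Seq :=
  {d | IsDegreeSequence d ∧ d.1 = n ∧ (∀ i, b ≤ d.2 i ∧ d.2 i ≤ a) ∧ ∑ i, d.2 i = S}

/-- A region is fully graphic if each of its members is graphic. -/
def IsFullyGraphic (R : Set Seq) : Prop := ∀ d ∈ R, IsGraphic d

/-- The union of all fully graphic regions `𝔻(n, S, c₁, c₂)`, over all positive integers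
`n > c₁ ≥ c₂` and all `S`. -/
def maxFullyGraphicRegion : Set Seq :=
  ⋃₀ {R | ∃ n S c₁ c₂ : ℕ, 0 < c₂ ∧ c₂ ≤ c₁ ∧ c₁ < n ∧
    R = simpleRegion n S c₁ c₂ ∧ IsFullyGraphic R}

/-- The number of realizations of `d`. -/
def numRealizations {n : ℕ} (d : Fin n → ℕ) : ℕ := Fintype.card (Realization d)

/-- `∂⁺⁺(d)`: the sum over `i ≤ j` of the number of realizations of the sequence obtained from `d`
by adding one to the `i`-th and one to the `j`-th entry (two to the `i`-th entry if `i = j`),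
divided by the number of realizations of `d`. -/
def perturbationRatio (d : Seq) : ℝ :=
  ∑ i : Fin d.1, ∑ j ∈ Finset.Ici i,
    (numRealizations (d.2 + Pi.single i 1 + Pi.single j 1) : ℝ) / (numRealizations d.2 : ℝ)

/-- A region is `p`-stable if `∂⁺⁺(d) ≤ p(n)` for each graphic member `d`, of length `n`. -/
def IsStable (p : Polynomial ℝ) (R : Set Seq) : Prop :=
  ∀ d ∈ R, IsGraphic d → perturbationRatio d ≤ p.eval (d.1 : ℝ)

/-- An infinite region is P-stable if it is `p`-stable for some polynomial `p`. -/
def IsPStable (R : Set Seq) : Prop := R.Infinite ∧ ∃ p : Polynomial ℝ, IsStable p R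

/-- `H` arises from `G` by a switch: two edges `v₁w₁`, `v₂w₂` of `G` are replaced with the two
non-edges `v₁w₂`, `v₂w₁` of `G`. (The four vertices are then automatically distinct.) -/
def IsSwitch {n : ℕ} (G H : SimpleGraph (Fin n)) : Prop :=
  ∃ v₁ w₁ v₂ w₂ : Fin n, G.Adj v₁ w₁ ∧ G.Adj v₂ w₂ ∧
    v₁ ≠ w₂ ∧ v₂ ≠ w₁ ∧ ¬ G.Adj v₁ w₂ ∧ ¬ G.Adj v₂ w₁ ∧
    H.edgeSet = (G.edgeSet \ {s(v₁, w₁), s(v₂, w₂)}) ∪ {s(v₁, w₂), s(v₂, w₁)}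

/-- The probability that one step of the switch chain leads from `G` to a *different* graph `H`.
With probability `1/2` nothing is done; otherwise four vertices and one of the three 4-cycles on
them are chosen uniformly, and the corresponding switch is performed if it is possible. -/
def switchProb {n : ℕ} (G H : SimpleGraph (Fin n)) : ℝ :=
  if IsSwitch G H then 1 / (6 * (n.choose 4 : ℝ)) else 0

/-- The transition matrix of the (lazy) switch Markov chain on the realizations of `d`. -/
def switchMatrix {n : ℕ} (d : Fin n → ℕ) : Matrix (Realization d) (Realization d) ℝ :=
  fun G H =>
    if G = H then 1 - ∑ K ∈ Finset.univ.erase G, switchProb G.1 K.1 else switchProb G.1 H.1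

/-- Total variation distance between the uniform distribution on the realizations of `d` and the
distribution of the switch chain after `t` steps, started from `G`. -/
def distToUniform {n : ℕ} (d : Fin n → ℕ) (t : ℕ) (G : Realization d) : ℝ :=
  (1 / 2) * ∑ H, |(switchMatrix d ^ t) G H - 1 / (numRealizations d : ℝ)|

/-- The mixing time `τ(ε)` of the switch chain on the realizations of `d` is at most `t`: from time
`t` on, from each starting state, the distance to the uniform distribution is at most `ε`. -/
def MixesWithin {n : ℕ} (d : Fin n → ℕ) (ε : ℝ) (t : ℕ) : Prop :=
  ∀ s, t ≤ s → ∀ G : Realization d, distToUniform d s G ≤ ε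

/-- The switch chain is rapidly mixing on a region: its mixing time `τ(ε)` on the realizations of
each graphic member of length `n` is at most a fixed polynomial in `n` and `log (1/ε)`. -/
def IsRapidlyMixing (R : Set Seq) : Prop :=
  ∃ q : MvPolynomial (Fin 2) ℝ, ∀ d ∈ R, IsGraphic d → ∀ ε : ℝ, 0 < ε → ε < 1 →
    ∃ t : ℕ, (t : ℝ) ≤ MvPolynomial.eval ![(d.1 : ℝ), Real.log (1 / ε)] q ∧ MixesWithin d.2 ε t

end

end FullyGraphic

/-!
A fully graphic region contains an extremal sequence: as many entries `c₁` as the sum allows, one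
entry in between, and then only `c₂`. It majorizes every member `d` of the region, so counting the
edges of one of its realizations gives inequalities of Erdős–Gallai type for `d` (`CornerBound`).

*Stability.* Suppose that the degrees of `G` exceed `d` by one at `u` and at `v`. Were the sets of
vertices reached from `u` by short alternating walks of even and of odd length disjoint, counting
the pairs between them would contradict `CornerBound`. From a vertex that is reached with both
parities one builds an alternating walk of length `11` from `v` to `u` along which edges and
non-edges can be exchanged; this lowers both degrees by one. The resulting realization of `d` and
the `12` vertices of the walk determine `G`, `u` and `v`, whence the bound `n ^ 12`.

*Mixing.* Attach to each vertex `v` a stub for each vertex and `n - d v` cores that absorb the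
stubs not used by edges. The realizations of `d` are then the perfect matchings of a
gadget, each counted equally often. Exchanging two perfect matchings component by component, and
each component edge by edge, leads through near-perfect matchings only, and a step has few
preimages because it is encoded by the complementary near-perfect matching (Jerrum and Sinclair).
By the exchanges along alternating walks a near-perfect matching has a perfect one within distance
`54`, so the walk can be projected to realizations that differ in boundedly many edges, and such
realizations are joined by few switches. This is a Poincaré inequality with a polynomial constant;
since the chain is lazy and symmetric, its `ℓ²` distance to uniformity decays exponentially at a
rate that is polynomial in `n`.
-/

namespace FullyGraphic

open scoped Classical symmDiff

noncomputable section

/-! ### Edge counts between two vertex sets -/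

/-- The entry of the adjacency matrix, as an integer. -/
def adjIndicator {V : Type*} (G : SimpleGraph V) (x y : V) : ℤ := if G.Adj x y then 1 else 0

/-- The degree, as an integer, so that degree identities may involve subtraction. -/
def intDegree {V : Type*} [Fintype V] (G : SimpleGraph V) (x : V) : ℤ := ∑ y, adjIndicator G x y

section Counting

variable {V : Type*} (G : SimpleGraph V)

lemma adjIndicator_nonneg (x y : V) : 0 ≤ adjIndicator G x y := by
  unfold adjIndicator; split_ifs <;> norm_num

lemma adjIndicator_le_one (x y : V) : adjIndicator G x y ≤ 1 := by
  unfold adjIndicator; split_ifs <;> norm_num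

lemma adjIndicator_comm (x y : V) : adjIndicator G x y = adjIndicator G y x := by
  unfold adjIndicator; rw [G.adj_comm]

variable {G} in
lemma adjIndicator_of_adj {x y : V} (h : G.Adj x y) : adjIndicator G x y = 1 := if_pos h

variable {G} in
lemma adjIndicator_of_not_adj {x y : V} (h : ¬ G.Adj x y) : adjIndicator G x y = 0 := if_neg h

lemma adjIndicator_self (x : V) : adjIndicator G x x = 0 := by simp [adjIndicator]

lemma card_mul_card_eq (A B : Finset V) :
    (A.card : ℤ) * B.card =
      ∑ x ∈ A, ∑ y ∈ B, (1 - adjIndicator G x y) + ∑ y ∈ B, ∑ x ∈ A, adjIndicator G y x := by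
  simp_rw [Finset.sum_comm (s := B), ← Finset.sum_add_distrib, adjIndicator_comm G _ _]
  simp

variable [Fintype V]

lemma intDegree_eq_degree (x : V) [Fintype (G.neighborSet x)] :
    intDegree G x = (G.degree x : ℤ) := by
  unfold intDegree adjIndicator
  rw [← SimpleGraph.card_neighborFinset_eq_degree, Finset.sum_boole]
  congr 2
  ext y
  simp

lemma sum_adjIndicator_le_intDegree (A : Finset V) (x : V) :
    ∑ y ∈ A, adjIndicator G x y ≤ intDegree G x :=
  Finset.sum_le_sum_of_subset_of_nonneg (Finset.subset_univ _)
    fun _ _ _ => adjIndicator_nonneg G _ _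

lemma sum_adjIndicator_eq_intDegree {A : Finset V} {x : V} (h : ∀ y, G.Adj x y → y ∈ A) :
    ∑ y ∈ A, adjIndicator G x y = intDegree G x :=
  Finset.sum_subset (Finset.subset_univ _) fun y _ hy => adjIndicator_of_not_adj (mt (h y) hy)

lemma sum_erase_one_sub_adjIndicator (x : V) :
    ∑ y ∈ Finset.univ.erase x, (1 - adjIndicator G x y) = Fintype.card V - 1 - intDegree G x := by
  have hx := Finset.add_sum_erase Finset.univ (fun y => 1 - adjIndicator G x y) (Finset.mem_univ x)
  have huniv : ∑ y, (1 - adjIndicator G x y) = Fintype.card V - intDegree G x := by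
    simp [intDegree, Finset.sum_sub_distrib]
  rw [huniv, adjIndicator_self] at hx
  linarith

lemma sum_one_sub_adjIndicator_le {B : Finset V} {x : V} (hx : x ∉ B) :
    ∑ y ∈ B, (1 - adjIndicator G x y) ≤ Fintype.card V - 1 - intDegree G x := by
  rw [← sum_erase_one_sub_adjIndicator]
  exact Finset.sum_le_sum_of_subset_of_nonneg
    (Finset.subset_erase.2 ⟨Finset.subset_univ _, hx⟩)
    fun y _ _ => sub_nonneg.2 (adjIndicator_le_one G x y)

lemma sum_one_sub_adjIndicator_eq {B : Finset V} {x : V} (hx : x ∉ B)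
    (h : ∀ y, y ≠ x → ¬ G.Adj x y → y ∈ B) :
    ∑ y ∈ B, (1 - adjIndicator G x y) = Fintype.card V - 1 - intDegree G x := by
  rw [← sum_erase_one_sub_adjIndicator]
  refine Finset.sum_subset (Finset.subset_erase.2 ⟨Finset.subset_univ _, hx⟩) fun y hy hyB => ?_
  have hadj : G.Adj x y := of_not_not (mt (h y (Finset.ne_of_mem_erase hy)) hyB)
  rw [adjIndicator_of_adj hadj, sub_self]

lemma sum_intDegree_le (A B : Finset V) (h : Disjoint A B) :
    ∑ x ∈ A, intDegree G x ≤
      ∑ y ∈ B, intDegree G y + A.card * (Fintype.card V - 1 - B.card) := by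
  have hcount := card_mul_card_eq G A B
  have hedges : ∑ y ∈ B, ∑ x ∈ A, adjIndicator G y x ≤ ∑ y ∈ B, intDegree G y :=
    Finset.sum_le_sum fun y _ => sum_adjIndicator_le_intDegree G A y
  have hnonedges : ∑ x ∈ A, ∑ y ∈ B, (1 - adjIndicator G x y) ≤
      ∑ x ∈ A, ((Fintype.card V : ℤ) - 1 - intDegree G x) :=
    Finset.sum_le_sum fun x hx =>
      sum_one_sub_adjIndicator_le G (Finset.disjoint_left.1 h hx)
  rw [Finset.sum_sub_distrib, Finset.sum_const, nsmul_eq_mul] at hnonedges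
  linarith

end Counting

/-! ### The extremal sequence of a region -/

/-- The sequence with entries `c₁` (`m` times), `a`, and `c₂` from then on. When `c₂ ≤ a ≤ c₁`, it
majorizes the sequences of the same length and sum with entries between `c₂` and `c₁`. -/
def extremal (c₁ c₂ m a i : ℕ) : ℕ := if i < m then c₁ else if i = m then a else c₂

lemma exists_extremal_parameters (c₁ c₂ n S : ℕ) (hlo : (n + 1) * c₂ ≤ S)
    (hhi : S ≤ (n + 1) * c₁) :
    ∃ m a, m ≤ n ∧ c₂ ≤ a ∧ a ≤ c₁ ∧ S = m * c₁ + a + (n - m) * c₂ := by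
  induction n generalizing S with
  | zero => exact ⟨0, S, le_rfl, by simpa using hlo, by simpa using hhi, by simp⟩
  | succ n ih =>
    rw [add_mul (n + 1)] at hlo hhi
    by_cases h : S ≤ (n + 1) * c₁ + c₂
    · obtain ⟨m, a, hm, ha, ha', hS⟩ := ih (S - c₂) (by omega) (by omega)
      refine ⟨m, a, by omega, ha, ha', ?_⟩
      rw [Nat.succ_sub hm, Nat.succ_mul]
      omega
    · exact ⟨n + 1, S - (n + 1) * c₁, le_rfl, by omega, by omega, by simp; omega⟩

lemma sum_extremal_of_le {c₁ c₂ m a s : ℕ} (h : s ≤ m) :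
    ∑ i ∈ Finset.range s, extremal c₁ c₂ m a i = s * c₁ := by
  calc ∑ i ∈ Finset.range s, extremal c₁ c₂ m a i
      = ∑ _i ∈ Finset.range s, c₁ :=
        Finset.sum_congr rfl fun i hi => if_pos ((Finset.mem_range.1 hi).trans_le h)
    _ = s * c₁ := by simp

lemma sum_extremal_of_lt {c₁ c₂ m a s : ℕ} (h : m < s) :
    ∑ i ∈ Finset.range s, extremal c₁ c₂ m a i = m * c₁ + a + (s - 1 - m) * c₂ := by
  induction s, h using Nat.le_induction with
  | base => rw [Finset.sum_range_succ, sum_extremal_of_le le_rfl]; simp [extremal]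
  | succ s hs ih =>
    rw [Finset.sum_range_succ, ih, extremal, if_neg (by omega), if_neg (by omega),
      show s + 1 - 1 - m = s - 1 - m + 1 by omega]
    ring

lemma extremal_bounds {c₁ c₂ m a : ℕ} (ha : c₂ ≤ a) (ha' : a ≤ c₁) (i : ℕ) :
    c₂ ≤ extremal c₁ c₂ m a i ∧ extremal c₁ c₂ m a i ≤ c₁ := by
  unfold extremal
  split_ifs <;> omega

lemma sum_le_sum_extremal {V : Type*} [Fintype V] {d : V → ℕ} {c₁ c₂ m a : ℕ}
    (hlo : ∀ i, c₂ ≤ d i) (hhi : ∀ i, d i ≤ c₁)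
    (hsum : ∑ i, d i = ∑ i ∈ Finset.range (Fintype.card V), extremal c₁ c₂ m a i) (A : Finset V) :
    ∑ x ∈ A, d x ≤ ∑ i ∈ Finset.range A.card, extremal c₁ c₂ m a i := by
  rcases le_or_gt A.card m with hA | hA
  · rw [sum_extremal_of_le hA]
    exact Finset.sum_le_card_nsmul A d c₁ fun i _ => hhi i
  · have hcard := Finset.card_add_card_compl A
    rw [sum_extremal_of_lt (by omega), ← Finset.sum_add_sum_compl A] at hsum
    rw [sum_extremal_of_lt hA]
    have hcompl : Aᶜ.card * c₂ ≤ ∑ x ∈ Aᶜ, d x :=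
      Finset.card_nsmul_le_sum Aᶜ d c₂ fun i _ => hlo i
    have hsplit : Fintype.card V - 1 - m = A.card - 1 - m + Aᶜ.card := by omega
    rw [hsplit, add_mul] at hsum
    omega

lemma sum_attachFin {n : ℕ} {s : Finset ℕ} (hs : ∀ i ∈ s, i < n) {M : Type*} [AddCommMonoid M]
    (f : ℕ → M) : ∑ i ∈ s.attachFin hs, f i = ∑ i ∈ s, f i := by
  conv_rhs => rw [← Finset.map_valEmbedding_attachFin hs, Finset.sum_map]
  rfl

lemma sum_range_add_sum_range_le {n s t : ℕ} {D : ℕ → ℕ} {G : SimpleGraph (Fin n)}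
    (hG : ∀ i, intDegree G i = D i) (hst : s + t ≤ n) :
    ∑ i ∈ Finset.range s, (D i : ℤ) + ∑ i ∈ Finset.range (n - t), (D i : ℤ) ≤
      ∑ i ∈ Finset.range n, (D i : ℤ) + s * ((n : ℤ) - 1 - t) := by
  have hleft : ∀ i ∈ Finset.range s, i < n := fun i hi => by
    have := Finset.mem_range.1 hi; omega
  have hright : ∀ i ∈ Finset.Ico (n - t) n, i < n := fun i hi => (Finset.mem_Ico.1 hi).2
  have hcut := sum_intDegree_le G ((Finset.range s).attachFin hleft)
    ((Finset.Ico (n - t) n).attachFin hright) <| Finset.disjoint_left.2 fun i hi hi' => by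
      simp only [Finset.mem_attachFin, Finset.mem_range, Finset.mem_Ico] at hi hi'
      omega
  have ht : n - (n - t) = t := by omega
  simp only [hG, sum_attachFin _ fun i => (D i : ℤ), Finset.card_attachFin, Finset.card_range,
    Nat.card_Ico, Fintype.card_fin, ht] at hcut
  have hsplit := Finset.sum_range_add_sum_Ico (fun i => (D i : ℤ)) (Nat.sub_le n t)
  linarith

/-- The inequalities that `d` inherits, by majorization, from a graphic extremal sequence with
entries `c₁` (`m` times), one entry in between, and `c₂`: in a realization of the latter, `left`
counts the pairs between any vertices and the last `t` ones, and `right` those between the first `s`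
vertices and any others. -/
structure CornerBound {V : Type*} [Fintype V] (d : V → ℕ) (c₁ c₂ m : ℕ) : Prop where
  lt : c₁ < Fintype.card V
  lower : ∀ i, c₂ ≤ d i
  upper : ∀ i, d i ≤ c₁
  left : ∀ (A : Finset V) (t : ℕ), t + m + 1 ≤ Fintype.card V → A.card + t ≤ Fintype.card V →
    (A.card : ℤ) * t ≤ ∑ x ∈ A, ((Fintype.card V : ℤ) - 1 - d x) + t * c₂
  right : ∀ (B : Finset V) (s : ℕ), s ≤ m → s + B.card ≤ Fintype.card V →
    (s : ℤ) * B.card ≤ s * ((Fintype.card V : ℤ) - 1 - c₁) + ∑ x ∈ B, (d x : ℤ)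

lemma cornerBound_of_extremal {n c₁ c₂ m a : ℕ} {d : Fin n → ℕ} {G : SimpleGraph (Fin n)}
    (hm : m < n) (hlt : c₁ < n) (hlo : ∀ i, c₂ ≤ d i) (hhi : ∀ i, d i ≤ c₁)
    (hsum : ∑ i, d i = ∑ i ∈ Finset.range n, extremal c₁ c₂ m a i)
    (hG : ∀ i, intDegree G i = extremal c₁ c₂ m a i) : CornerBound d c₁ c₂ m := by
  have hmajor : ∀ A : Finset (Fin n),
      ∑ x ∈ A, (d x : ℤ) ≤ ∑ i ∈ Finset.range A.card, (extremal c₁ c₂ m a i : ℤ) := fun A => by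
    exact_mod_cast sum_le_sum_extremal hlo hhi (by simpa using hsum) A
  have hle : ∀ s ≤ m, ∑ i ∈ Finset.range s, (extremal c₁ c₂ m a i : ℤ) = s * c₁ := fun s hs => by
    exact_mod_cast sum_extremal_of_le hs
  refine ⟨by simpa using hlt, hlo, hhi, fun A t ht hAt => ?_, fun B s hs hsB => ?_⟩ <;>
    rw [Fintype.card_fin] at *
  · have hcut := sum_range_add_sum_range_le hG hAt
    have htail : ∑ i ∈ Finset.range n, (extremal c₁ c₂ m a i : ℤ) =
        ∑ i ∈ Finset.range (n - t), (extremal c₁ c₂ m a i : ℤ) + t * c₂ := by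
      have hlen : n - 1 - m = n - t - 1 - m + t := by omega
      norm_cast
      rw [sum_extremal_of_lt hm, sum_extremal_of_lt (by omega), hlen]
      ring
    rw [Finset.sum_sub_distrib, Finset.sum_const, nsmul_eq_mul]
    linarith [hmajor A]
  · have hcut := sum_range_add_sum_range_le hG hsB
    have hcompl : ∑ i ∈ Finset.range n, (extremal c₁ c₂ m a i : ℤ) ≤
        ∑ i ∈ Finset.range (n - B.card), (extremal c₁ c₂ m a i : ℤ) + ∑ x ∈ B, (d x : ℤ) := by
      have hBc := hmajor Bᶜ
      rw [Finset.card_compl, Fintype.card_fin] at hBc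
      have htotal : ∑ x ∈ B, (d x : ℤ) + ∑ x ∈ Bᶜ, (d x : ℤ) =
          ∑ i ∈ Finset.range n, (extremal c₁ c₂ m a i : ℤ) := by
        rw [Finset.sum_add_sum_compl]
        exact_mod_cast hsum
      linarith
    rw [hle s hs] at hcut
    linarith

lemma exists_cornerBound {n S c₁ c₂ : ℕ} {d : Fin n → ℕ} (hpos : 0 < c₂) (hlt : c₁ < n)
    (hfull : IsFullyGraphic (simpleRegion n S c₁ c₂))
    (hd : (⟨n, d⟩ : Seq) ∈ simpleRegion n S c₁ c₂) : ∃ m, CornerBound d c₁ c₂ m := by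
  obtain ⟨⟨-, heven⟩, -, hb, hS⟩ := hd
  simp only at heven hb hS
  obtain ⟨N, rfl⟩ : ∃ N, n = N + 1 := ⟨n - 1, by omega⟩
  have hlo : (N + 1) * c₂ ≤ S := by
    simpa [← hS] using Finset.card_nsmul_le_sum Finset.univ d c₂ fun i _ => (hb i).1
  have hhi : S ≤ (N + 1) * c₁ := by
    simpa [← hS] using Finset.sum_le_card_nsmul Finset.univ d c₁ fun i _ => (hb i).2
  obtain ⟨m, a, hm, ha, ha', hSm⟩ := exists_extremal_parameters c₁ c₂ N S hlo hhi
  have hsum : ∑ i ∈ Finset.range (N + 1), extremal c₁ c₂ m a i = S := by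
    rw [sum_extremal_of_lt (by omega), hSm, Nat.add_sub_cancel]
  have hmem : (⟨N + 1, fun i => extremal c₁ c₂ m a i⟩ : Seq) ∈
      simpleRegion (N + 1) S c₁ c₂ := by
    have hbounds := extremal_bounds (m := m) ha ha'
    have htotal : ∑ i : Fin (N + 1), extremal c₁ c₂ m a i = S := by
      rw [Fin.sum_univ_eq_sum_range fun i => extremal c₁ c₂ m a i, hsum]
    refine ⟨⟨fun i => ⟨hpos.trans_le (hbounds i).1, (hbounds i).2.trans_lt hlt⟩, ?_⟩, rfl,
      fun i => hbounds i, htotal⟩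
    simpa only [htotal, ← hS] using heven
  obtain ⟨⟨G, hG⟩⟩ : Nonempty (Realization fun i : Fin (N + 1) => extremal c₁ c₂ m a i) :=
    hfull _ hmem
  exact ⟨m, cornerBound_of_extremal (Nat.lt_succ_of_le hm) hlt (fun i => (hb i).1)
    (fun i => (hb i).2) (hS.trans hsum.symm) fun i => by rw [intDegree_eq_degree G, hG]⟩

lemma exists_cornerBound_of_mem {s : Seq} (hs : s ∈ maxFullyGraphicRegion) :
    ∃ c₁ c₂ m, CornerBound s.2 c₁ c₂ m := by
  obtain ⟨_, ⟨n, S, c₁, c₂, hpos, -, hlt, rfl, hfull⟩, hmem⟩ := hs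
  obtain ⟨k, d⟩ := s
  obtain rfl : k = n := hmem.2.1
  exact ⟨c₁, c₂, exists_cornerBound hpos hlt hfull hmem⟩

/-! ### Short alternating walks -/

section AlternatingWalks

variable {V : Type*} {G : SimpleGraph V}

/-- The pair `xy` may be step number `k` of an alternating walk: an edge if `k` is even, a non-edge
if `k` is odd. -/
def AltStep (G : SimpleGraph V) (k : ℕ) (x y : V) : Prop := x ≠ y ∧ (G.Adj x y ↔ Even k)

/-- `w 0, …, w L` is an alternating walk whose first step has the parity of `o`. Walks are
functions on `ℕ` of which only the first `L + 1` values matter. -/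
def AltWalk (G : SimpleGraph V) (o : ℕ) (w : ℕ → V) (L : ℕ) : Prop :=
  ∀ t < L, AltStep G (o + t) (w t) (w (t + 1))

/-- There is an alternating walk of length `k` from `v` to `x`, starting with an edge, that
avoids `X` except possibly at its last vertex `x`. -/
def AltReach (G : SimpleGraph V) (X : Set V) (v : V) (k : ℕ) (x : V) : Prop :=
  ∃ w : ℕ → V, w 0 = v ∧ w k = x ∧ AltWalk G 0 w k ∧ ∀ t < k, w t ∉ X

lemma AltStep.symm {k : ℕ} {x y : V} (h : AltStep G k x y) : AltStep G k y x :=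
  ⟨h.1.symm, by rw [G.adj_comm]; exact h.2⟩

lemma AltStep.of_even_iff {k l : ℕ} {x y : V} (h : AltStep G k x y) (hkl : Even k ↔ Even l) :
    AltStep G l x y := ⟨h.1, h.2.trans hkl⟩

lemma altStep_of_adj {k : ℕ} {x y : V} (h : G.Adj x y) (hk : Even k) : AltStep G k x y :=
  ⟨h.ne, by simp [h, hk]⟩

lemma altStep_of_not_adj {k : ℕ} {x y : V} (hxy : x ≠ y) (h : ¬ G.Adj x y) (hk : ¬ Even k) :
    AltStep G k x y := ⟨hxy, by simp [h, hk]⟩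

lemma altStep_or_altStep {a b : ℕ} {x y : V} (hxy : x ≠ y) (hab : ¬ (Even a ↔ Even b)) :
    AltStep G a x y ∨ AltStep G b x y := by
  unfold AltStep
  tauto

lemma altReach_zero (X : Set V) (v : V) : AltReach G X v 0 v :=
  ⟨fun _ => v, rfl, rfl, fun t ht => absurd ht t.not_lt_zero, fun t ht => absurd ht t.not_lt_zero⟩

lemma altReach_zero_iff {X : Set V} {v x : V} : AltReach G X v 0 x ↔ x = v := by
  constructor
  · rintro ⟨w, hv, hx, -⟩
    rw [← hx, hv]
  · rintro rfl
    exact altReach_zero X x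

lemma AltReach.succ {X : Set V} {v x y : V} {k : ℕ} (h : AltReach G X v k x) (hx : x ∉ X)
    (hxy : AltStep G k x y) : AltReach G X v (k + 1) y := by
  obtain ⟨w, hv, hk, hw, hX⟩ := h
  refine ⟨fun t => if t ≤ k then w t else y, by simp [hv], by simp, ?_, ?_⟩
  · intro t ht
    rcases Nat.lt_succ_iff_lt_or_eq.1 ht with h | rfl
    · simpa [h.le, Nat.succ_le_of_lt h] using hw t h
    · simpa [hk] using hxy
  · intro t ht
    rcases Nat.lt_succ_iff_lt_or_eq.1 ht with h | rfl
    · simpa [h.le] using hX t h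
    · simpa [hk] using hx

lemma AltReach.exists_pred {X : Set V} {v y : V} {k : ℕ} (h : AltReach G X v (k + 1) y) :
    ∃ x, AltReach G X v k x ∧ x ∉ X ∧ AltStep G k x y := by
  obtain ⟨w, hv, hk, hw, hX⟩ := h
  refine ⟨w k, ⟨w, hv, rfl, fun t ht => hw t (by omega), fun t ht => hX t (by omega)⟩,
    hX k (by omega), ?_⟩
  simpa [hk] using hw k (by omega)

lemma AltReach.close {v x : V} {a b : ℕ} (ha : AltReach G ∅ v a x) (hb : AltReach G ∅ v b x)
    (hab : Odd (a + b)) : AltReach G ∅ v (a + b) v := by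
  induction b generalizing a x with
  | zero =>
    rw [altReach_zero_iff] at hb
    subst hb
    exact ha
  | succ b ih =>
    obtain ⟨y, hy, -, hyx⟩ := hb.exists_pred
    have hay : AltReach G ∅ v (a + 1) y := by
      refine ha.succ (Set.notMem_empty x) (hyx.symm.of_even_iff ?_)
      rw [← add_assoc, Nat.odd_add_one, Nat.not_odd_iff_even, Nat.even_add] at hab
      exact hab.symm
    rw [← add_assoc, add_right_comm] at hab ⊢
    exact ih hay hy hab

lemma AltReach.hit_or_avoid (X : Set V) {v x : V} {k : ℕ} (h : AltReach G ∅ v k x) :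
    (∃ t < k, ∃ c ∈ X, AltReach G X v t c) ∨ AltReach G X v k x := by
  induction k generalizing x with
  | zero =>
    rw [altReach_zero_iff] at h ⊢
    exact Or.inr h
  | succ k ih =>
    obtain ⟨y, hy, -, hyx⟩ := h.exists_pred
    rcases ih hy with ⟨t, ht, c, hc, htc⟩ | hy
    · exact Or.inl ⟨t, by omega, c, hc, htc⟩
    · by_cases hyX : y ∈ X
      · exact Or.inl ⟨k, by omega, y, hyX, hy⟩
      · exact Or.inr (hy.succ hyX hyx)

end AlternatingWalks

section Layers

variable {V : Type*} {G : SimpleGraph V} {v : V}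

/-- Growing layers of vertices around `v`: the `Sᵢ` play the role of the vertices reached by
alternating walks of odd length at most `2i - 1`, the `Tᵢ` of those reached by walks of even length
at most `2i`; no vertex is reached with both parities. -/
structure AltLayers (G : SimpleGraph V) (v : V) (S₁ S₂ S₃ T₁ T₂ : Finset V) : Prop where
  mem_left₁ : ∀ x, x ∈ S₁ ↔ G.Adj v x
  left₁_subset : S₁ ⊆ S₂
  left₂_subset : S₂ ⊆ S₃
  mem_right₁ : v ∈ T₁
  right₁_subset : T₁ ⊆ T₂
  disjoint : Disjoint S₃ T₂
  mem_left₂ : ∀ y ∈ T₁, ∀ x, G.Adj y x → x ∈ S₂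
  mem_left₃ : ∀ y ∈ T₂, ∀ x, G.Adj y x → x ∈ S₃
  mem_right₁_of_not_adj : ∀ x ∈ S₁, ∀ y, y ≠ x → ¬ G.Adj x y → y ∈ T₁
  mem_right₂_of_not_adj : ∀ x ∈ S₂, ∀ y, y ≠ x → ¬ G.Adj x y → y ∈ T₂

variable {S₁ S₂ S₃ T₁ T₂ : Finset V}

lemma AltLayers.adj_of_notMem (L : AltLayers G v S₁ S₂ S₃ T₁ T₂) {x y : V} (hx : x ∈ S₁)
    (hy : y ∈ T₂) (hy₁ : y ∉ T₁) : G.Adj y x := by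
  have hne : y ≠ x := by
    rintro rfl
    exact Finset.disjoint_left.1 L.disjoint (L.left₂_subset (L.left₁_subset hx)) hy
  exact SimpleGraph.Adj.symm (of_not_not (mt (L.mem_right₁_of_not_adj x hx y hne) hy₁))

lemma AltLayers.not_adj_of_notMem (L : AltLayers G v S₁ S₂ S₃ T₁ T₂) {x y : V} (hx₂ : x ∉ S₂)
    (hy : y ∈ T₁) : ¬ G.Adj x y := fun h => hx₂ (L.mem_left₂ y hy x h.symm)

variable [Fintype V]

/-- The vertices that some alternating walk from `v`, starting with an edge and of a length in `I`,
reaches. -/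
def reachSet (G : SimpleGraph V) (v : V) (I : Finset ℕ) : Finset V :=
  Finset.univ.filter fun x => ∃ k ∈ I, AltReach G ∅ v k x

lemma mem_reachSet {I : Finset ℕ} {x : V} :
    x ∈ reachSet G v I ↔ ∃ k ∈ I, AltReach G ∅ v k x := by simp [reachSet]

lemma reachSet_mono {I J : Finset ℕ} (h : I ⊆ J) : reachSet G v I ⊆ reachSet G v J := fun _ hx =>
  let ⟨k, hk, hkx⟩ := mem_reachSet.1 hx
  mem_reachSet.2 ⟨k, h hk, hkx⟩

lemma mem_reachSet_of_adj {I J : Finset ℕ} {x y : V} (hI : ∀ k ∈ I, Even k ∧ k + 1 ∈ J)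
    (hx : x ∈ reachSet G v I) (hxy : G.Adj x y) : y ∈ reachSet G v J :=
  let ⟨k, hk, hkx⟩ := mem_reachSet.1 hx
  mem_reachSet.2 ⟨k + 1, (hI k hk).2, hkx.succ (Set.notMem_empty x)
    (altStep_of_adj hxy (hI k hk).1)⟩

lemma mem_reachSet_of_not_adj {I J : Finset ℕ} {x y : V} (hI : ∀ k ∈ I, ¬ Even k ∧ k + 1 ∈ J)
    (hx : x ∈ reachSet G v I) (hne : y ≠ x) (hxy : ¬ G.Adj x y) : y ∈ reachSet G v J :=
  let ⟨k, hk, hkx⟩ := mem_reachSet.1 hx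
  mem_reachSet.2 ⟨k + 1, (hI k hk).2, hkx.succ (Set.notMem_empty x)
    (altStep_of_not_adj hne.symm hxy (hI k hk).1)⟩

lemma mem_reachSet_one_iff {x : V} : x ∈ reachSet G v {1} ↔ G.Adj v x := by
  refine ⟨fun h => ?_, fun h => mem_reachSet_of_adj (I := {0}) (by decide)
    (mem_reachSet.2 ⟨0, by decide, altReach_zero ∅ v⟩) h⟩
  obtain ⟨k, hk, hx⟩ := mem_reachSet.1 h
  obtain rfl := Finset.mem_singleton.1 hk
  obtain ⟨y, hy, -, hyx⟩ := hx.exists_pred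
  obtain rfl := altReach_zero_iff.1 hy
  exact hyx.2.2 (by decide)

lemma altLayers_reachSet (h : Disjoint (reachSet G v {1, 3, 5}) (reachSet G v {0, 2, 4})) :
    AltLayers G v (reachSet G v {1}) (reachSet G v {1, 3}) (reachSet G v {1, 3, 5})
      (reachSet G v {0, 2}) (reachSet G v {0, 2, 4}) where
  mem_left₁ _ := mem_reachSet_one_iff
  left₁_subset := reachSet_mono (by decide)
  left₂_subset := reachSet_mono (by decide)
  mem_right₁ := mem_reachSet.2 ⟨0, by decide, altReach_zero ∅ v⟩
  right₁_subset := reachSet_mono (by decide)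
  disjoint := h
  mem_left₂ _ hy _ := mem_reachSet_of_adj (by decide) hy
  mem_left₃ _ hy _ := mem_reachSet_of_adj (by decide) hy
  mem_right₁_of_not_adj _ hx _ := mem_reachSet_of_not_adj (by decide) hx
  mem_right₂_of_not_adj _ hx _ := mem_reachSet_of_not_adj (by decide) hx

namespace AltLayers

variable {d : V → ℕ} {c₁ c₂ m : ℕ}

lemma card_left₁ (L : AltLayers G v S₁ S₂ S₃ T₁ T₂) : (S₁.card : ℤ) = intDegree G v := by
  rw [← sum_adjIndicator_eq_intDegree G fun y hy => (L.mem_left₁ y).2 hy,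
    Finset.sum_congr rfl fun y hy => adjIndicator_of_adj ((L.mem_left₁ y).1 hy)]
  simp

lemma le_sum_adjIndicator (L : AltLayers G v S₁ S₂ S₃ T₁ T₂) (hlo : ∀ x, c₂ ≤ d x)
    (hT : ∀ y ∈ T₂, (d y : ℤ) + (if y = v then 1 else 0) ≤ intDegree G y) {y : V} (hy : y ∈ T₂) :
    (c₂ : ℤ) + (if y = v then 1 else 0) ≤ ∑ x ∈ S₂, adjIndicator G y x := by
  have hc₂ : ∀ x, (c₂ : ℤ) ≤ d x := fun x => by exact_mod_cast hlo x
  by_cases hy₁ : y ∈ T₁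
  · rw [sum_adjIndicator_eq_intDegree G (L.mem_left₂ y hy₁)]
    linarith [hT y hy, hc₂ y]
  · have hyv : y ≠ v := fun h => hy₁ (h ▸ L.mem_right₁)
    have hv := hT v (L.right₁_subset L.mem_right₁)
    have hS₁ : ∑ x ∈ S₁, adjIndicator G y x = S₁.card := by
      rw [Finset.sum_congr rfl fun x hx => adjIndicator_of_adj (L.adj_of_notMem hx hy hy₁)]
      simp
    have hle : ∑ x ∈ S₁, adjIndicator G y x ≤ ∑ x ∈ S₂, adjIndicator G y x :=
      Finset.sum_le_sum_of_subset_of_nonneg L.left₁_subset fun _ _ _ => adjIndicator_nonneg G _ _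
    rw [if_pos rfl] at hv
    rw [if_neg hyv]
    linarith [hc₂ v, L.card_left₁]

lemma sum_add_lt_card_mul_card (L : AltLayers G v S₁ S₂ S₃ T₁ T₂) (hlo : ∀ x, c₂ ≤ d x)
    (hS : ∀ x ∈ S₂, intDegree G x ≤ d x)
    (hT : ∀ y ∈ T₂, (d y : ℤ) + (if y = v then 1 else 0) ≤ intDegree G y) :
    ∑ x ∈ S₂, ((Fintype.card V : ℤ) - 1 - d x) + T₂.card * c₂ < S₂.card * T₂.card := by
  have hnonedges : ∑ x ∈ S₂, ((Fintype.card V : ℤ) - 1 - d x) ≤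
      ∑ x ∈ S₂, ∑ y ∈ T₂, (1 - adjIndicator G x y) := Finset.sum_le_sum fun x hx => by
    rw [sum_one_sub_adjIndicator_eq G (Finset.disjoint_left.1 L.disjoint (L.left₂_subset hx))
      (L.mem_right₂_of_not_adj x hx)]
    linarith [hS x hx]
  have hedges := Finset.sum_le_sum fun y hy => L.le_sum_adjIndicator hlo hT hy
  rw [Finset.sum_add_distrib, Finset.sum_ite_eq' T₂ v, if_pos (L.right₁_subset L.mem_right₁),
    Finset.sum_const, nsmul_eq_mul] at hedges
  linarith [card_mul_card_eq G S₂ T₂]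

lemma le_card_right₁ (L : AltLayers G v S₁ S₂ S₃ T₁ T₂) (hhi : ∀ x, d x ≤ c₁)
    (hS : ∀ x ∈ S₂, intDegree G x ≤ d x)
    (hv : (d v : ℤ) + 1 ≤ intDegree G v) : (Fintype.card V : ℤ) - 1 - c₁ ≤ T₁.card := by
  obtain ⟨x, hx⟩ : S₁.Nonempty := by
    have hcard := L.card_left₁
    rw [← Finset.card_pos]
    omega
  have hxT : x ∉ T₁ := fun h => Finset.disjoint_left.1 L.disjoint
    (L.left₂_subset (L.left₁_subset hx)) (L.right₁_subset h)
  have hle : ∑ y ∈ T₁, (1 - adjIndicator G x y) ≤ ∑ _y ∈ T₁, (1 : ℤ) :=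
    Finset.sum_le_sum fun y _ => sub_le_self _ (adjIndicator_nonneg G x y)
  rw [sum_one_sub_adjIndicator_eq G hxT (L.mem_right₁_of_not_adj x hx)] at hle
  simp only [Finset.sum_const, nsmul_eq_mul, mul_one] at hle
  have hd : (d x : ℤ) ≤ c₁ := by exact_mod_cast hhi x
  linarith [hS x (L.left₁_subset hx)]

lemma le_sum_one_sub_adjIndicator (L : AltLayers G v S₁ S₂ S₃ T₁ T₂) (hhi : ∀ x, d x ≤ c₁)
    (hS : ∀ x ∈ S₂, intDegree G x ≤ d x) (hv : (d v : ℤ) + 1 ≤ intDegree G v) {x : V}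
    (hx : x ∈ S₃) : (Fintype.card V : ℤ) - 1 - c₁ ≤ ∑ y ∈ T₂, (1 - adjIndicator G x y) := by
  by_cases hx₂ : x ∈ S₂
  · rw [sum_one_sub_adjIndicator_eq G (Finset.disjoint_left.1 L.disjoint hx)
      (L.mem_right₂_of_not_adj x hx₂)]
    have hd : (d x : ℤ) ≤ c₁ := by exact_mod_cast hhi x
    linarith [hS x hx₂]
  · calc (Fintype.card V : ℤ) - 1 - c₁ ≤ T₁.card := L.le_card_right₁ hhi hS hv
      _ = ∑ y ∈ T₁, (1 - adjIndicator G x y) := by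
          rw [Finset.sum_sub_distrib,
            Finset.sum_eq_zero fun y hy => adjIndicator_of_not_adj (L.not_adj_of_notMem hx₂ hy)]
          simp
      _ ≤ ∑ y ∈ T₂, (1 - adjIndicator G x y) :=
          Finset.sum_le_sum_of_subset_of_nonneg L.right₁_subset
            fun y _ _ => sub_nonneg.2 (adjIndicator_le_one G x y)

lemma card_mul_add_sum_lt (L : AltLayers G v S₁ S₂ S₃ T₁ T₂) (hhi : ∀ x, d x ≤ c₁)
    (hS : ∀ x ∈ S₂, intDegree G x ≤ d x)
    (hT : ∀ y ∈ T₂, (d y : ℤ) + (if y = v then 1 else 0) ≤ intDegree G y) :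
    S₃.card * ((Fintype.card V : ℤ) - 1 - c₁) + ∑ y ∈ T₂, (d y : ℤ) < S₃.card * T₂.card := by
  have hvT := L.right₁_subset L.mem_right₁
  have hnonedges := Finset.sum_le_sum fun x hx =>
    L.le_sum_one_sub_adjIndicator hhi hS (by simpa using hT v hvT) (x := x) hx
  have hedges : ∑ y ∈ T₂, ((d y : ℤ) + if y = v then 1 else 0) ≤
      ∑ y ∈ T₂, ∑ x ∈ S₃, adjIndicator G y x := Finset.sum_le_sum fun y hy => by
    rw [sum_adjIndicator_eq_intDegree G (L.mem_left₃ y hy)]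
    exact hT y hy
  rw [Finset.sum_add_distrib, Finset.sum_ite_eq' T₂ v, if_pos hvT] at hedges
  rw [Finset.sum_const, nsmul_eq_mul] at hnonedges
  linarith [card_mul_card_eq G S₃ T₂]

lemma false_of_cornerBound (L : AltLayers G v S₁ S₂ S₃ T₁ T₂) (hd : CornerBound d c₁ c₂ m)
    (hS : ∀ x ∈ S₂, intDegree G x ≤ d x)
    (hT : ∀ y ∈ T₂, (d y : ℤ) + (if y = v then 1 else 0) ≤ intDegree G y) : False := by
  have hcard : S₃.card + T₂.card ≤ Fintype.card V := by
    rw [← Finset.card_union_of_disjoint L.disjoint]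
    exact Finset.card_le_univ _
  have hcard₂ : S₂.card ≤ S₃.card := Finset.card_le_card L.left₂_subset
  by_cases ht : T₂.card + m + 1 ≤ Fintype.card V
  · exact absurd (hd.left S₂ T₂.card ht (by omega))
      (L.sum_add_lt_card_mul_card hd.lower hS hT).not_ge
  · exact absurd (hd.right T₂ S₃.card (by omega) hcard)
      (L.card_mul_add_sum_lt hd.upper hS hT).not_ge

end AltLayers

lemma reachSet_meet_or_mem {d : V → ℕ} {c₁ c₂ m : ℕ} (hd : CornerBound d c₁ c₂ m) {z : V} {ε : ℤ}
    (hε : ε = 1 ∨ ε = -1)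
    (hG : ∀ x, intDegree G x = d x + (if x = v then 1 else 0) + ε * (if x = z then 1 else 0)) :
    ¬ Disjoint (reachSet G v {1, 3, 5}) (reachSet G v {0, 2, 4}) ∨
      (ε = 1 ∧ z ∈ reachSet G v {1, 3}) ∨ (ε = -1 ∧ z ∈ reachSet G v {0, 2, 4}) := by
  by_contra! hcon
  obtain ⟨hdisj, hodd, heven⟩ := hcon
  have L := altLayers_reachSet hdisj
  refine L.false_of_cornerBound hd (fun x hx => ?_) fun y hy => ?_
  · have hxv : x ≠ v := by
      rintro rfl
      exact Finset.disjoint_left.1 hdisj (L.left₂_subset hx) (L.right₁_subset L.mem_right₁)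
    rcases hε with rfl | rfl
    · have hxz : x ≠ z := by rintro rfl; exact hodd rfl hx
      simp [hG, hxv, hxz]
    · rw [hG, if_neg hxv]
      split_ifs <;> simp
  · rcases hε with rfl | rfl
    · rw [hG]
      split_ifs <;> simp
    · have hyz : y ≠ z := by rintro rfl; exact heven rfl hy
      simp [hG, hyz]

end Layers

/-! ### Exchanging edges along alternating trails -/

section Toggling

variable {V : Type*}

lemma symmDiff_adj (G H : SimpleGraph V) (a b : V) :
    (G ∆ H).Adj a b ↔ ¬ (G.Adj a b ↔ H.Adj a b) := by
  simp only [symmDiff_def, SimpleGraph.sup_adj, SimpleGraph.sdiff_adj]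
  tauto

/-- The first `L` steps of the walk `w` use pairwise different (unordered) pairs of vertices. -/
def DistinctSteps (w : ℕ → V) (L : ℕ) : Prop :=
  ∀ s t, s < t → t < L → s(w s, w (s + 1)) ≠ s(w t, w (t + 1))

/-- The graph of the pairs that occur an odd number of times among the first `L` steps of `w`. -/
def trailGraph (w : ℕ → V) : ℕ → SimpleGraph V
  | 0 => ⊥
  | L + 1 => trailGraph w L ∆ SimpleGraph.edge (w L) (w (L + 1))

lemma exists_of_trailGraph_adj {w : ℕ → V} {L : ℕ} {a b : V} (h : (trailGraph w L).Adj a b) :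
    ∃ t < L, s(w t, w (t + 1)) = s(a, b) := by
  induction L with
  | zero => exact absurd h id
  | succ L ih =>
    rw [trailGraph, symmDiff_adj] at h
    by_cases hL : (trailGraph w L).Adj a b
    · obtain ⟨t, ht, hab⟩ := ih hL
      exact ⟨t, by omega, hab⟩
    · have hedge : (SimpleGraph.edge (w L) (w (L + 1))).Adj a b := by tauto
      rw [SimpleGraph.edge_adj] at hedge
      refine ⟨L, by omega, ?_⟩
      rw [Sym2.eq_iff]
      tauto

lemma trailGraph_congr {w w' : ℕ → V} {L : ℕ} (h : ∀ t ≤ L, w t = w' t) :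
    trailGraph w L = trailGraph w' L := by
  induction L with
  | zero => rfl
  | succ L ih =>
    rw [trailGraph, trailGraph, ih fun t ht => h t (by omega), h L (by omega), h (L + 1) le_rfl]

lemma trailGraph_add (w : ℕ → V) (K L : ℕ) :
    trailGraph w (K + L) = trailGraph w K ∆ trailGraph (fun t => w (K + t)) L := by
  induction L with
  | zero => simp [trailGraph]
  | succ L ih => rw [← add_assoc, trailGraph, ih, trailGraph, symmDiff_assoc]; rfl

lemma trailGraph_succ_left (w : ℕ → V) (L : ℕ) :
    trailGraph w (L + 1) = SimpleGraph.edge (w 0) (w 1) ∆ trailGraph (fun t => w (t + 1)) L := by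
  rw [add_comm, trailGraph_add]
  simp [trailGraph, add_comm]

lemma trailGraph_reverse (w : ℕ → V) (L : ℕ) :
    trailGraph (fun t => w (L - t)) L = trailGraph w L := by
  induction L with
  | zero => rfl
  | succ L ih =>
    rw [trailGraph_succ_left]
    simp only [Nat.add_sub_add_right, ih, trailGraph]
    rw [symmDiff_comm, SimpleGraph.edge_comm]
    rfl

lemma trailGraph_of_const {w : ℕ → V} {K L : ℕ} (hw : ∀ t, K ≤ t → w t = w K) (h : K ≤ L) :
    trailGraph w L = trailGraph w K := by
  induction L, h using Nat.le_induction with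
  | base => rfl
  | succ L hL ih =>
    rw [trailGraph, ih, hw L hL, hw (L + 1) (by omega)]
    simp

lemma adjIndicator_symmDiff_edge (G : SimpleGraph V) {a b : V} (hab : a ≠ b) (x y : V) :
    adjIndicator (G ∆ SimpleGraph.edge a b) x y = adjIndicator G x y +
      (if G.Adj a b then -1 else 1) * ((if x = a then (if y = b then 1 else 0) else 0) +
        if x = b then (if y = a then 1 else 0) else 0) := by
  simp only [adjIndicator, symmDiff_adj, SimpleGraph.edge_adj]
  by_cases hxa : x = a
  · subst hxa
    by_cases hyb : y = b
    · subst hyb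
      by_cases hG : G.Adj x y <;> simp [hG, hab]
    · simp [hyb, hab]
  · by_cases hxb : x = b
    · subst hxb
      by_cases hya : y = a
      · subst hya
        by_cases hG : G.Adj y x <;> simp [hG, hab, hab.symm, G.adj_comm x y]
      · simp [hxa, hya]
    · simp [hxa, hxb]

variable [Fintype V]

lemma intDegree_symmDiff_edge (G : SimpleGraph V) {a b : V} (hab : a ≠ b) (x : V) :
    intDegree (G ∆ SimpleGraph.edge a b) x = intDegree G x +
      (if G.Adj a b then -1 else 1) * ((if x = a then 1 else 0) + if x = b then 1 else 0) := by
  simp_rw [intDegree, adjIndicator_symmDiff_edge G hab, Finset.sum_add_distrib, ← Finset.mul_sum,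
    Finset.sum_add_distrib]
  congr 3 <;> split_ifs <;> simp

lemma intDegree_symmDiff_trailGraph {G : SimpleGraph V} {o : ℕ} {w : ℕ → V} {L : ℕ}
    (hw : AltWalk G o w L) (hinj : DistinctSteps w L) (x : V) :
    intDegree (G ∆ trailGraph w L) x = intDegree G x - (-1) ^ o * (if x = w 0 then 1 else 0)
      + (-1) ^ (o + L) * (if x = w L then 1 else 0) := by
  induction L with
  | zero => simp [trailGraph]
  | succ L ih =>
    obtain ⟨hne, hadj⟩ := hw L (by omega)
    have hfresh : ¬ (trailGraph w L).Adj (w L) (w (L + 1)) := fun h =>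
      let ⟨t, ht, heq⟩ := exists_of_trailGraph_adj h
      hinj t L ht (by omega) heq
    have hstep : (G ∆ trailGraph w L).Adj (w L) (w (L + 1)) ↔ Even (o + L) := by
      rw [symmDiff_adj, ← hadj]
      tauto
    have hsign : (if (G ∆ trailGraph w L).Adj (w L) (w (L + 1)) then (-1 : ℤ) else 1)
        = - (-1) ^ (o + L) := by
      rw [hstep]
      split_ifs with h
      · rw [h.neg_one_pow]
      · rw [(Nat.not_even_iff_odd.1 h).neg_one_pow, neg_neg]
    rw [trailGraph, ← symmDiff_assoc, intDegree_symmDiff_edge _ hne, hsign,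
      ih (fun t ht => hw t (by omega)) (fun s t hst ht => hinj s t hst (by omega)),
      ← add_assoc, pow_succ]
    ring

end Toggling

section Trails

variable {V : Type*} {G : SimpleGraph V}

lemma AltWalk.ne_add_two {o L : ℕ} {w : ℕ → V} (hw : AltWalk G o w L) {s : ℕ} (hs : s + 1 < L) :
    w s ≠ w (s + 2) := by
  intro heq
  have hnext := (hw (s + 1) hs).symm
  rw [show s + 1 + 1 = s + 2 from rfl, ← heq] at hnext
  have hparity := (hw s (by omega)).2.symm.trans hnext.2
  rw [← add_assoc, Nat.even_add_one] at hparity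
  tauto

lemma AltWalk.distinctSteps_of_cycle {o L : ℕ} {w : ℕ → V} (hw : AltWalk G o w L)
    (h : ∀ a b, a < b → b ≤ L → w a = w b → a = 0 ∧ b = L) : DistinctSteps w L := by
  intro s t hst ht heq
  rcases Sym2.eq_iff.1 heq with ⟨hs, -⟩ | ⟨hcross, hs⟩
  · have := h s t hst ht.le hs
    omega
  · rcases Nat.lt_or_ge (s + 1) t with hlt | hge
    · have := h (s + 1) t hlt ht.le hs
      omega
    · obtain rfl : t = s + 1 := by omega
      exact hw.ne_add_two ht hcross

lemma AltWalk.distinctSteps_of_shortest {o L : ℕ} {w : ℕ → V} (hw : AltWalk G o w L)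
    (h : ∀ a b, a < b → b ≤ L → w a = w b → b + 1 = L) : DistinctSteps w L := by
  intro s t hst ht heq
  rcases Sym2.eq_iff.1 heq with ⟨hs, hs'⟩ | ⟨hcross, hs⟩
  · have := h (s + 1) (t + 1) (by omega) (by omega) hs'
    have := h s t hst ht.le hs
    omega
  · rcases Nat.lt_or_ge (s + 1) t with hlt | hge
    · have := h (s + 1) t hlt ht.le hs
      have := h s (t + 1) (by omega) (by omega) hcross
      omega
    · obtain rfl : t = s + 1 := by omega
      exact hw.ne_add_two ht hcross

lemma AltWalk.distinctSteps_of_le_three {o L : ℕ} {w : ℕ → V} (hw : AltWalk G o w L)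
    (hL : L ≤ 3) : DistinctSteps w L := by
  intro s t hst ht heq
  by_cases hnext : t = s + 1
  · subst hnext
    rcases Sym2.eq_iff.1 heq with ⟨h, -⟩ | ⟨h, -⟩
    · exact (hw s (by omega)).1 h
    · exact hw.ne_add_two ht h
  · obtain ⟨rfl, rfl⟩ : s = 0 ∧ t = 2 := by omega
    rcases Sym2.eq_iff.1 heq with ⟨h, -⟩ | ⟨-, h⟩
    · exact hw.ne_add_two (by omega) h
    · exact (hw 1 (by omega)).1 h

lemma AltWalk.distinctSteps_five {w : ℕ → V} (hw : AltWalk G 0 w 5) (hne : w 0 ≠ w 5)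
    (hadj : ¬ G.Adj (w 0) (w 5)) : DistinctSteps w 5 := by
  intro s t hst ht heq
  have hparity : Even s ↔ Even t := by
    have hs := (hw s (by omega)).2
    have ht := (hw t (by omega)).2
    rw [zero_add] at hs ht
    rw [← hs, ← ht, ← SimpleGraph.mem_edgeSet, ← SimpleGraph.mem_edgeSet, heq]
  by_cases htwo : t = s + 2
  · subst htwo
    rcases Sym2.eq_iff.1 heq with ⟨h, -⟩ | ⟨-, h⟩
    · exact hw.ne_add_two (by omega) h
    · exact (hw (s + 1) (by omega)).1 h
  · obtain ⟨rfl, rfl⟩ : s = 0 ∧ t = 4 := by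
      rw [Nat.even_iff, Nat.even_iff] at hparity
      omega
    rcases Sym2.eq_iff.1 heq with ⟨-, h⟩ | ⟨h, -⟩
    · have hfirst := (hw 0 (by omega)).2.2 (by decide)
      rw [h] at hfirst
      exact hadj hfirst
    · exact hne h

lemma AltWalk.reverse {w : ℕ → V} {L : ℕ} (hw : AltWalk G 0 w L) (hL : Odd L) :
    AltWalk G 0 (fun t => w (L - t)) L := by
  intro t ht
  have hstep := (hw (L - (t + 1)) (by omega)).symm
  rw [show L - (t + 1) + 1 = L - t by omega] at hstep
  refine hstep.of_even_iff ?_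
  rw [Nat.even_iff, Nat.even_iff]
  rw [Nat.odd_iff] at hL
  omega

lemma AltReach.reverse {u v : V} {L : ℕ} (h : AltReach G ∅ u L v) (hL : Odd L) :
    AltReach G ∅ v L u := by
  obtain ⟨w, hu, hv, hw, -⟩ := h
  exact ⟨fun t => w (L - t), by simp [hv], by simp [hu], hw.reverse hL, by simp⟩

lemma AltReach.follow {X : Set V} {v : V} {q : ℕ → V} {a b k : ℕ} (h : AltReach G X v a (q b))
    (hq : AltWalk G 0 q k) (hX : ∀ t < k, q t ∉ X) (hab : Even a ↔ Even b) (s : ℕ)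
    (hs : b + s ≤ k) : AltReach G X v (a + s) (q (b + s)) := by
  induction s with
  | zero => exact h
  | succ s ih =>
    refine (ih (by omega)).succ (hX _ (by omega)) ((hq (b + s) (by omega)).of_even_iff ?_)
    rw [zero_add, Nat.even_add, Nat.even_add, hab]

lemma AltReach.exists_shortest {X : Set V} {v x : V} {k : ℕ} (hx : x ∈ X)
    (h : AltReach G X v k x) :
    ∃ K ≤ k, ∃ q : ℕ → V, q 0 = v ∧ q K = x ∧ AltWalk G 0 q K ∧ (∀ t < K, q t ∉ X) ∧
      ∀ a b, a < b → b ≤ K → q a = q b → b + 1 = K := by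
  have hex : ∃ k, AltReach G X v k x := ⟨k, h⟩
  refine ⟨Nat.find hex, Nat.find_min' hex h, ?_⟩
  have hmin : ∀ l, AltReach G X v l x → Nat.find hex ≤ l := fun l hl => Nat.find_min' hex hl
  obtain ⟨q, hv, hqx, hq, hX⟩ := Nat.find_spec hex
  refine ⟨q, hv, hqx, hq, hX, fun a b hab hb heq => ?_⟩
  generalize Nat.find hex = K at *
  have hprefix : ∀ s ≤ K, AltReach G X v s (q s) := fun s hs =>
    ⟨q, hv, rfl, fun t ht => hq t (by omega), fun t ht => hX t (by omega)⟩
  have ha := hprefix a (by omega)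
  rcases hb.lt_or_eq with hbK | rfl
  · by_cases hparity : Even a ↔ Even b
    · have hshort := (heq ▸ ha).follow hq hX hparity (K - b) (by omega)
      rw [Nat.add_sub_cancel' hb, hqx] at hshort
      have := hmin _ hshort
      omega
    · -- A vertex reached with both parities can be joined to `x` directly: the pair they form is a
      -- legal next step for one of the two parities.
      have hne : q a ≠ x := fun hqa => hX a (by omega) (hqa ▸ hx)
      rcases altStep_or_altStep (G := G) hne hparity with hstep | hstep
      · have := hmin _ (ha.succ (hX a (by omega)) hstep)
        omega
      · have := hmin _ ((hprefix b hb).succ (hX b hbK) (heq ▸ hstep))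
        omega
  · rw [← hqx, ← heq] at hx
    exact absurd hx (hX a hab)

lemma AltReach.exists_shortest_closed {u : V} {l : ℕ} (hl : Odd l) (h : AltReach G ∅ u l u) :
    ∃ k ≤ l, Odd k ∧ ∃ w : ℕ → V, w 0 = u ∧ w k = u ∧ AltWalk G 0 w k ∧
      ∀ a b, a < b → b ≤ k → w a = w b → a + b = k := by
  have hex : ∃ k, Odd k ∧ AltReach G ∅ u k u := ⟨l, hl, h⟩
  refine ⟨Nat.find hex, Nat.find_min' hex ⟨hl, h⟩, (Nat.find_spec hex).1, ?_⟩
  have hmin : ∀ l, Odd l → AltReach G ∅ u l u → Nat.find hex ≤ l :=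
    fun l hl hul => Nat.find_min' hex ⟨hl, hul⟩
  obtain ⟨hodd, w, hstart, hend, hw, -⟩ := Nat.find_spec hex
  refine ⟨w, hstart, hend, hw, fun a b hab hb heq => ?_⟩
  generalize Nat.find hex = K at *
  have hprefix : ∀ a ≤ K, AltReach G ∅ u a (w a) := fun a ha =>
    ⟨w, hstart, rfl, fun t ht => hw t (by omega), by simp⟩
  have hsuffix : ∀ a ≤ K, AltReach G ∅ u (K - a) (w a) := fun a ha =>
    ⟨fun t => w (K - t), by simp [hend], congrArg w (by omega),
      fun t ht => hw.reverse hodd t (by omega), by simp⟩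
  have hpre := hprefix b hb
  have hsuf := hsuffix b hb
  rw [← heq] at hpre hsuf
  rw [Nat.odd_iff] at hodd
  by_cases hparity : (a + b) % 2 = 0
  · have hodd' : Odd (a + (K - b)) := by rw [Nat.odd_iff]; omega
    have := hmin _ hodd' ((hprefix a (by omega)).close hsuf hodd')
    omega
  · have hpreodd : Odd (a + b) := by rw [Nat.odd_iff]; omega
    have hsufodd : Odd ((K - a) + (K - b)) := by rw [Nat.odd_iff]; omega
    have := hmin _ hpreodd ((hprefix a (by omega)).close hpre hpreodd)
    have := hmin _ hsufodd ((hsuffix a (by omega)).close hsuf hsufodd)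
    omega

end Trails

/-! ### Relieving two vertices of one edge each -/

section Relieving

variable {V : Type*} [Fintype V] {G : SimpleGraph V}

/-- Exchanging edges and non-edges along some walk of length `11` from `v` to `u` lowers the degrees
of `u` and `v` by one each (that of `u` by two if `u = v`) and keeps the others. Shorter walks can
be padded, since constant steps change nothing. -/
def HasRelievingWalk (G : SimpleGraph V) (u v : V) : Prop :=
  ∃ W : ℕ → V, W 0 = v ∧ W 11 = u ∧ ∀ x, intDegree (G ∆ trailGraph W 11) x =
    intDegree G x - (if x = u then 1 else 0) - (if x = v then 1 else 0)

lemma AltWalk.hasRelievingWalk {u v : V} {w : ℕ → V} {L : ℕ} (hw : AltWalk G 0 w L) (hL : L ≤ 11)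
    (hodd : Odd L) (hu : w 0 = u) (hv : w L = v) (hinj : DistinctSteps w L) :
    HasRelievingWalk G u v := by
  refine ⟨fun t => w (L - t), hv, ?_, fun x => ?_⟩
  · simp only [Nat.sub_eq_zero_of_le hL, hu]
  · rw [trailGraph_of_const (K := L) (fun t ht => by rw [Nat.sub_eq_zero_of_le ht, Nat.sub_self])
      hL, trailGraph_reverse, intDegree_symmDiff_trailGraph hw hinj, hu, hv, zero_add,
      hodd.neg_one_pow]
    ring

lemma AltReach.hasRelievingWalk {u v : V} {a : ℕ} (h : AltReach G ∅ u a v) (ha : a = 1 ∨ a = 3) :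
    HasRelievingWalk G u v := by
  obtain ⟨w, hu, hv, hw, -⟩ := h
  exact hw.hasRelievingWalk (by omega) (by rcases ha with rfl | rfl <;> decide) hu hv
    (hw.distinctSteps_of_le_three (by omega))

lemma AltReach.hasRelievingWalk_of_ne {u v : V} {a : ℕ} (h : AltReach G ∅ u a v) (huv : u ≠ v)
    (ha : a = 1 ∨ a = 3 ∨ a = 5) : HasRelievingWalk G u v := by
  rcases or_assoc.2 ha with ha | rfl
  · exact h.hasRelievingWalk ha
  by_cases hadj : G.Adj u v
  · exact ((altReach_zero ∅ u).succ (Set.notMem_empty u) (altStep_of_adj hadj (by decide))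
      ).hasRelievingWalk (Or.inl rfl)
  obtain ⟨w, rfl, rfl, hw, -⟩ := h
  exact hw.hasRelievingWalk (by norm_num) (by decide) rfl rfl (hw.distinctSteps_five huv hadj)

end Relieving

section Lollipops

variable {V : Type*}

/-- A closed alternating walk `w 0, …, w l` of odd length that follows a path, the stem
`w 0, …, w i`, then goes round the cycle `w i, …, w (l - i)`, and comes back along a walk that meets
the stem, if at all, in opposite vertices only. -/
structure Lollipop (G : SimpleGraph V) (w : ℕ → V) (l i : ℕ) : Prop where
  odd : Odd l
  two_mul_lt : 2 * i < l
  altWalk : AltWalk G 0 w l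
  cycle_closed : w i = w (l - i)
  add_eq : ∀ a b, a < b → b ≤ l → w a = w b → a + b = l
  ne_opposite : ∀ a, i < a → 2 * a < l → w a ≠ w (l - a)

/-- The vertices `w i, …, w (l - i)` of the cycle of a lollipop. -/
def cycleSet (w : ℕ → V) (l i : ℕ) : Set V := {x | ∃ s, i ≤ s ∧ s + i ≤ l ∧ w s = x}

lemma AltReach.exists_lollipop {G : SimpleGraph V} {u : V} {l₀ : ℕ} (h : AltReach G ∅ u l₀ u)
    (hl₀ : Odd l₀) : ∃ l ≤ l₀, ∃ w i, w 0 = u ∧ Lollipop G w l i := by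
  obtain ⟨l, hl, hodd, w, hstart, hend, hw, hadd⟩ := h.exists_shortest_closed hl₀
  let P : ℕ → Prop := fun a => w a = w (l - a)
  have hi : Nat.findGreatest P (l / 2) ≤ l / 2 := Nat.findGreatest_le _
  have hlmod := Nat.odd_iff.1 hodd
  refine ⟨l, hl, w, Nat.findGreatest P (l / 2), hstart, hodd, by omega, hw, ?_, hadd,
    fun a ha hal => Nat.findGreatest_is_greatest (P := P) ha (by omega)⟩
  exact Nat.findGreatest_spec (P := P) (Nat.zero_le _) (hstart.trans hend.symm)

namespace Lollipop

variable {G : SimpleGraph V} {w q : ℕ → V} {l i j k : ℕ}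

lemma mem_cycleSet_base (L : Lollipop G w l i) : w i ∈ cycleSet w l i :=
  ⟨i, le_rfl, by have := L.two_mul_lt; omega, rfl⟩

lemma altWalk_stem (L : Lollipop G w l i) : AltWalk G 0 w i := fun t ht =>
  L.altWalk t (by have := L.two_mul_lt; omega)

lemma distinctSteps_stem (L : Lollipop G w l i) : DistinctSteps w i :=
  L.altWalk_stem.distinctSteps_of_cycle fun a b hab hb heq => by
    have := L.two_mul_lt
    have := L.add_eq a b hab (by omega) heq
    omega

lemma not_trailGraph_stem_adj (L : Lollipop G w l i) {t : ℕ} (ht : t + 1 + 2 * i ≤ l) :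
    ¬ (trailGraph w i).Adj (w (i + t)) (w (i + t + 1)) := by
  intro h
  obtain ⟨s, hs, heq⟩ := exists_of_trailGraph_adj h
  rcases Sym2.eq_iff.1 heq with ⟨h, -⟩ | ⟨h, -⟩
  · have := L.add_eq s (i + t) (by omega) (by omega) h
    omega
  · have := L.add_eq s (i + t + 1) (by omega) (by omega) h
    omega

lemma altWalk_cycle (L : Lollipop G w l i) (hjl : j + i ≤ l)
    (hq : ∀ t < k, q t ∉ cycleSet w l i) :
    AltWalk ((G ∆ trailGraph w i) ∆ trailGraph q k) i (fun t => w (i + t)) (j - i) := by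
  intro t ht
  obtain ⟨hne, hadj⟩ := L.altWalk (i + t) (by omega)
  have hstem := L.not_trailGraph_stem_adj (t := t) (by omega)
  have hpath : ¬ (trailGraph q k).Adj (w (i + t)) (w (i + t + 1)) := by
    intro h
    obtain ⟨s, hs, heq⟩ := exists_of_trailGraph_adj h
    rcases Sym2.eq_iff.1 heq with ⟨h, -⟩ | ⟨h, -⟩
    · exact hq s hs ⟨i + t, by omega, by omega, h.symm⟩
    · exact hq s hs ⟨i + t + 1, by omega, by omega, h.symm⟩
  rw [zero_add] at hadj
  refine ⟨hne, Iff.trans ?_ hadj⟩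
  simp only [symmDiff_adj, ← add_assoc]
  tauto

lemma eq_ends_of_cycle_eq (L : Lollipop G w l i) (hjl : j + i ≤ l) {a b : ℕ} (hab : a < b)
    (hb : b ≤ j - i) (heq : w (i + a) = w (i + b)) : a = 0 ∧ b = j - i := by
  have hadd := L.add_eq (i + a) (i + b) (by omega) (by omega) heq
  by_contra hcon
  refine L.ne_opposite (i + a) (by omega) (by omega) ?_
  rw [heq]
  congr 1
  omega

lemma exists_mirror (L : Lollipop G w l i) : ∃ w', Lollipop G w' l i ∧ (∀ t ≤ i, w' t = w t) ∧
    ∀ t, i ≤ t → w' t = w (l - t) := by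
  have hil := L.two_mul_lt
  set w' : ℕ → V := fun t => if t ≤ i then w t else w (l - t)
  have hstem : ∀ t ≤ i, w' t = w t := fun t ht => if_pos ht
  have hcycle : ∀ t, i ≤ t → w' t = w (l - t) := fun t ht => by
    rcases ht.eq_or_lt with rfl | ht
    · rw [hstem _ le_rfl, L.cycle_closed]
    · exact if_neg (by omega)
  refine ⟨w', ⟨L.odd, hil, fun t ht => ?_, ?_, fun a b hab hb heq => ?_, fun a ha hal => ?_⟩,
    hstem, hcycle⟩
  · rcases Nat.lt_or_ge t i with h | h
    · rw [hstem t h.le, hstem (t + 1) h]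
      exact L.altWalk t ht
    · rw [hcycle t h, hcycle (t + 1) (by omega)]
      exact L.altWalk.reverse L.odd t ht
  · rw [hstem i le_rfl, hcycle (l - i) (by omega), Nat.sub_sub_self (by omega)]
  · rcases Nat.lt_or_ge i b with hb' | hb'
    · rw [hcycle b hb'.le] at heq
      rcases Nat.lt_or_ge i a with ha' | ha'
      · rw [hcycle a ha'.le] at heq
        have := L.add_eq (l - b) (l - a) (by omega) (by omega) heq.symm
        omega
      · rw [hstem a ha'] at heq
        rcases lt_trichotomy a (l - b) with h | h | h
        · have := L.add_eq a (l - b) h (by omega) heq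
          omega
        · omega
        · have := L.add_eq (l - b) a h (by omega) heq.symm
          omega
    · rw [hstem a (by omega), hstem b hb'] at heq
      exact L.add_eq a b hab hb heq
  · rw [hcycle a ha.le, hcycle (l - a) (by omega), Nat.sub_sub_self (by omega)]
    exact (L.ne_opposite a ha hal).symm

variable [Fintype V] {v : V}

lemma intDegree_symmDiff_stem (L : Lollipop G w l i) (x : V) :
    intDegree (G ∆ trailGraph w i) x = intDegree G x - (if x = w 0 then 1 else 0) +
      (-1) ^ i * (if x = w i then 1 else 0) := by
  rw [intDegree_symmDiff_trailGraph L.altWalk_stem L.distinctSteps_stem, pow_zero, one_mul,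
    zero_add]

lemma intDegree_symmDiff_path_cycle (L : Lollipop G w l i) (hi : i ≤ j) (hjl : j + i ≤ l)
    (hodd : Odd (k + j)) (hq0 : q 0 = v) (hqk : q k = w j)
    (hq : AltWalk (G ∆ trailGraph w i) 0 q k) (hqC : ∀ t < k, q t ∉ cycleSet w l i)
    (hqinj : DistinctSteps q k) (x : V) :
    intDegree (((G ∆ trailGraph w i) ∆ trailGraph q k) ∆ trailGraph (fun t => w (i + t)) (j - i)) x
      = intDegree G x - (if x = w 0 then 1 else 0) - (if x = v then 1 else 0) := by
  have hcycle := L.altWalk_cycle hjl hqC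
  have hsign : (-1 : ℤ) ^ k = - (-1) ^ j := by
    have hprod : (-1 : ℤ) ^ k * (-1) ^ j = -1 := by rw [← pow_add, hodd.neg_one_pow]
    rcases neg_one_pow_eq_or ℤ j with h | h <;> rw [h] at hprod ⊢ <;> linarith
  rw [intDegree_symmDiff_trailGraph hcycle (hcycle.distinctSteps_of_cycle fun a b hab hb =>
      L.eq_ends_of_cycle_eq hjl hab hb), intDegree_symmDiff_trailGraph hq hqinj,
    L.intDegree_symmDiff_stem, hq0, hqk, zero_add, hsign, add_zero, Nat.add_sub_cancel' hi]
  ring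

/-- The relieving walk runs along `q` to `w j` and then back to `w 0`, that is, against the
direction of `w`. -/
lemma hasRelievingWalk_of_path (L : Lollipop G w l i) (hi : i ≤ j) (hjl : j + i ≤ l)
    (hkj : k + j ≤ 11) (hodd : Odd (k + j)) (hq0 : q 0 = v) (hqk : q k = w j)
    (hq : AltWalk (G ∆ trailGraph w i) 0 q k) (hqC : ∀ t < k, q t ∉ cycleSet w l i)
    (hqinj : DistinctSteps q k) : HasRelievingWalk G (w 0) v := by
  set W : ℕ → V := fun t => if t ≤ k then q t else w (j - (t - k)) with hW
  have hWq : ∀ t ≤ k, W t = q t := fun t ht => if_pos ht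
  have hWw : ∀ t, W (k + t) = w (j - t) := fun t => by
    rcases Nat.eq_zero_or_pos t with rfl | ht
    · exact (hWq k le_rfl).trans hqk
    · simp [hW, ht.ne']
  have hend : ∀ t, k + j ≤ t → W t = w 0 := fun t ht => by
    rw [show t = k + (t - k) by omega, hWw, show j - (t - k) = 0 by omega]
  have htrail : trailGraph W 11 =
      trailGraph q k ∆ (trailGraph w i ∆ trailGraph (fun t => w (i + t)) (j - i)) := by
    rw [trailGraph_of_const (fun t ht => (hend t ht).trans (hend _ le_rfl).symm) hkj,
      trailGraph_add, trailGraph_congr hWq,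
      trailGraph_congr (w' := fun t => w (j - t)) (fun t _ => hWw t), trailGraph_reverse,
      ← trailGraph_add, Nat.add_sub_cancel' hi]
  have hassoc : G ∆ trailGraph W 11 =
      ((G ∆ trailGraph w i) ∆ trailGraph q k) ∆ trailGraph (fun t => w (i + t)) (j - i) := by
    rw [htrail, symmDiff_left_comm (trailGraph q k), ← symmDiff_assoc, ← symmDiff_assoc]
  refine ⟨W, (hWq 0 (Nat.zero_le k)).trans hq0, hend 11 hkj, fun x => ?_⟩
  rw [hassoc]
  exact L.intDegree_symmDiff_path_cycle hi hjl hodd hq0 hqk hq hqC hqinj x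

/-- Of the two ways round the cycle from `w s` back to its base, one has the right parity. -/
lemma hasRelievingWalk_of_altReach (L : Lollipop G w l i) {s : ℕ} (hs : i ≤ s) (hsl : s + i ≤ l)
    (hks : k + s ≤ 12) (hks' : k + (l - s) ≤ 12)
    (h : AltReach (G ∆ trailGraph w i) (cycleSet w l i) v k (w s)) :
    HasRelievingWalk G (w 0) v := by
  obtain ⟨K, hK, q, hq0, hqK, hq, hqC, hqmin⟩ := AltReach.exists_shortest
    (show w s ∈ cycleSet w l i from ⟨s, hs, hsl, rfl⟩) h
  have hqinj := hq.distinctSteps_of_shortest hqmin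
  by_cases hparity : Odd (K + s)
  · have := Nat.odd_iff.1 hparity
    exact L.hasRelievingWalk_of_path hs hsl (by omega) hparity hq0 hqK hq hqC hqinj
  · have hodd := L.odd
    have hparity' : Odd (K + (l - s)) := by
      rw [Nat.odd_iff] at *
      omega
    obtain ⟨w', L', hstem, hcycle⟩ := L.exists_mirror
    have hC : cycleSet w' l i ⊆ cycleSet w l i := by
      rintro _ ⟨t, ht, htl, rfl⟩
      exact ⟨l - t, by omega, by omega, (hcycle t ht).symm⟩
    have hqK' : q K = w' (l - s) := by
      rw [hcycle (l - s) (by omega), Nat.sub_sub_self (by omega), hqK]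
    rw [← trailGraph_congr hstem] at hq
    rw [← hstem 0 (Nat.zero_le i)]
    have := Nat.odd_iff.1 hparity'
    exact L'.hasRelievingWalk_of_path (by omega) (by omega) (by omega) hparity' hq0 hqK' hq
      (fun t ht hmem => hqC t ht (hC hmem)) hqinj

lemma hasRelievingWalk_of_avoiding (L : Lollipop G w l i) (hl : l ≤ 9) {t : ℕ} (ht : t ≤ 4)
    {c : V} (hc : c ∈ cycleSet w l i) (hne : t = 4 → i = 0 → c ≠ w 0)
    (h : AltReach (G ∆ trailGraph w i) (cycleSet w l i) v t c) : HasRelievingWalk G (w 0) v := by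
  obtain ⟨s, hs, hsl, rfl⟩ := hc
  have hfar : t = 4 → i = 0 → s ≠ 0 ∧ s ≠ l := fun ht hi =>
    ⟨by rintro rfl; exact hne ht hi rfl, by
      rintro rfl
      have hbase := L.cycle_closed
      subst hi
      exact hne ht rfl hbase.symm⟩
  exact L.hasRelievingWalk_of_altReach hs hsl (by omega) (by omega) h

lemma hasRelievingWalk_or_avoids (L : Lollipop G w l i) (hl : l ≤ 9) {t : ℕ} (ht : t ≤ 4) {x : V}
    (hne : t = 4 → i = 0 → x ≠ w 0) (h : AltReach (G ∆ trailGraph w i) ∅ v t x) :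
    HasRelievingWalk G (w 0) v ∨
      AltReach (G ∆ trailGraph w i) (cycleSet w l i) v t x ∧ x ∉ cycleSet w l i := by
  rcases h.hit_or_avoid (cycleSet w l i) with ⟨t', ht', c, hc, h'⟩ | h'
  · exact Or.inl (L.hasRelievingWalk_of_avoiding hl (by omega) hc (by omega) h')
  · by_cases hx : x ∈ cycleSet w l i
    · exact Or.inl (L.hasRelievingWalk_of_avoiding hl ht hx hne h')
    · exact Or.inr ⟨h', hx⟩

lemma hasRelievingWalk_or_notMem (L : Lollipop G w l i) (hl : l ≤ 9) :
    HasRelievingWalk G (w 0) v ∨ v ∉ cycleSet w l i :=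
  (L.hasRelievingWalk_or_avoids hl (Nat.zero_le 4) (by omega) (altReach_zero ∅ v)).imp_right
    And.right

lemma hasRelievingWalk_of_altReach_start (L : Lollipop G w l 0) (hv : v ∉ cycleSet w l 0) {a : ℕ}
    (ha : a = 1 ∨ a = 3 ∨ a = 5) (h : AltReach (G ∆ trailGraph w 0) ∅ v a (w 0)) :
    HasRelievingWalk G (w 0) v := by
  have hne : w 0 ≠ v := fun heq => hv (heq ▸ L.mem_cycleSet_base)
  rw [trailGraph, symmDiff_bot] at h
  exact (h.reverse (by rcases ha with rfl | rfl | rfl <;> decide)).hasRelievingWalk_of_ne hne ha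

/-- From a vertex off the cycle that is reached with both parities, one can step straight to the
middle vertex `w (l / 2)` of the cycle, by an edge or a non-edge. -/
lemma hasRelievingWalk_of_meet (L : Lollipop G w l i) (hl : l ≤ 9) {a b : ℕ} {x : V}
    (ha : a = 1 ∨ a = 3 ∨ a = 5) (hb : b = 0 ∨ b = 2 ∨ b = 4)
    (hax : AltReach (G ∆ trailGraph w i) ∅ v a x) (hbx : AltReach (G ∆ trailGraph w i) ∅ v b x) :
    HasRelievingWalk G (w 0) v := by
  by_contra hno
  have hv := (L.hasRelievingWalk_or_notMem hl).resolve_left hno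
  have hil := L.two_mul_lt
  have hne_start : ∀ c y, c = 1 ∨ c = 3 ∨ c = 5 → AltReach (G ∆ trailGraph w i) ∅ v c y → i = 0 →
      y ≠ w 0 := by
    rintro c _ hc h rfl rfl
    exact hno (L.hasRelievingWalk_of_altReach_start hv hc h)
  obtain ⟨hbx', hx⟩ := (L.hasRelievingWalk_or_avoids hl (by omega)
    (fun _ => hne_start a x ha hax) hbx).resolve_left hno
  have hparity : ¬ (Even a ↔ Even b) := by
    rw [Nat.even_iff, Nat.even_iff]
    omega
  obtain ⟨a', rfl⟩ : ∃ a', a = a' + 1 := ⟨a - 1, by omega⟩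
  obtain ⟨y, hy, -, hyx⟩ := hax.exists_pred
  have hby : AltReach (G ∆ trailGraph w i) ∅ v (b + 1) y :=
    hbx.succ (Set.notMem_empty x) (hyx.symm.of_even_iff (by rw [Nat.even_iff, Nat.even_iff]; omega))
  obtain ⟨hy', hyC⟩ := (L.hasRelievingWalk_or_avoids hl (by omega)
    (fun _ => hne_start (b + 1) y (by omega) hby) hy).resolve_left hno
  have hmiddle : ∀ k ≤ 6, ¬ AltReach (G ∆ trailGraph w i) (cycleSet w l i) v k (w (l / 2)) :=
    fun k hk h => hno (L.hasRelievingWalk_of_altReach (by omega) (by omega) (by omega) (by omega) h)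
  have hx_ne : x ≠ w (l / 2) := fun h => hx ⟨l / 2, by omega, by omega, h.symm⟩
  rcases altStep_or_altStep hx_ne hparity with hstep | hstep
  · exact hmiddle (a' + 1 + 1) (by omega) ((hy'.succ hyC hyx).succ hx hstep)
  · exact hmiddle (b + 1) (by omega) (hbx'.succ hx hstep)

end Lollipop

end Lollipops

section Relieving

variable {V : Type*} [Fintype V] {G : SimpleGraph V} {d : V → ℕ} {c₁ c₂ m : ℕ} {u v : V}

lemma CornerBound.exists_altReach_self (hd : CornerBound d c₁ c₂ m)
    (hG : ∀ x, intDegree G x = d x + (if x = u then 1 else 0) + (if x = v then 1 else 0))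
    (hno : ¬ HasRelievingWalk G u v) : ∃ l ≤ 9, Odd l ∧ AltReach G ∅ u l u := by
  rcases reachSet_meet_or_mem hd (v := u) (z := v) (Or.inl rfl) (by simpa using hG) with
    hmeet | ⟨-, hv⟩ | ⟨h, -⟩
  · obtain ⟨x, hodd, heven⟩ := Finset.not_disjoint_iff.1 hmeet
    obtain ⟨a, ha, hax⟩ := mem_reachSet.1 hodd
    obtain ⟨b, hb, hbx⟩ := mem_reachSet.1 heven
    simp only [Finset.mem_insert, Finset.mem_singleton] at ha hb
    have hab : Odd (a + b) := by
      rw [Nat.odd_iff]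
      omega
    exact ⟨a + b, by omega, hab, hax.close hbx hab⟩
  · obtain ⟨a, ha, hav⟩ := mem_reachSet.1 hv
    exact absurd (hav.hasRelievingWalk (by simpa using ha)) hno
  · norm_num at h

theorem CornerBound.hasRelievingWalk (hd : CornerBound d c₁ c₂ m)
    (hG : ∀ x, intDegree G x = d x + (if x = u then 1 else 0) + (if x = v then 1 else 0)) :
    HasRelievingWalk G u v := by
  by_contra hno
  obtain ⟨l₀, hl₀, hodd, hu⟩ := hd.exists_altReach_self hG hno
  obtain ⟨l, hl, w, i, rfl, L⟩ := hu.exists_lollipop hodd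
  have hdeg : ∀ x, intDegree (G ∆ trailGraph w i) x =
      d x + (if x = v then 1 else 0) + (-1) ^ i * (if x = w i then 1 else 0) := fun x => by
    rw [L.intDegree_symmDiff_stem, hG x]
    ring
  have hbase : ∀ t ≤ 4, (t = 4 → i ≠ 0) → ¬ AltReach (G ∆ trailGraph w i) ∅ v t (w i) :=
    fun t ht hi h => ((L.hasRelievingWalk_or_avoids (by omega) ht (fun h h' => absurd h' (hi h))
      h).resolve_left hno).2 L.mem_cycleSet_base
  rcases reachSet_meet_or_mem hd (neg_one_pow_eq_or ℤ i) hdeg with hmeet | ⟨-, h⟩ | ⟨hi, h⟩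
  · obtain ⟨x, hodd, heven⟩ := Finset.not_disjoint_iff.1 hmeet
    obtain ⟨a, ha, hax⟩ := mem_reachSet.1 hodd
    obtain ⟨b, hb, hbx⟩ := mem_reachSet.1 heven
    exact hno (L.hasRelievingWalk_of_meet (by omega) (by simpa using ha) (by simpa using hb) hax
      hbx)
  · obtain ⟨t, ht, h⟩ := mem_reachSet.1 h
    simp only [Finset.mem_insert, Finset.mem_singleton] at ht
    exact hbase t (by omega) (by omega) h
  · obtain ⟨t, ht, h⟩ := mem_reachSet.1 h
    simp only [Finset.mem_insert, Finset.mem_singleton] at ht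
    have hi₀ : i ≠ 0 := by
      rintro rfl
      norm_num at hi
    exact hbase t (by omega) (fun _ => hi₀) h

end Relieving

/-! ### Stability -/

section Stability

variable {n : ℕ} {d : Fin n → ℕ}

lemma Realization.intDegree_eq (G : Realization d) (x : Fin n) : intDegree G.1 x = d x := by
  rw [intDegree_eq_degree, G.2 x]

/-- A realization given by a graph whose integer degrees are the required ones. -/
def Realization.ofIntDegree (G : SimpleGraph (Fin n)) (h : ∀ x, intDegree G x = d x) :
    Realization d :=
  ⟨G, fun x => by exact_mod_cast (intDegree_eq_degree G x).symm.trans (h x)⟩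

/-- A relieving walk turns a perturbed realization into a realization, and the walk together with
its outcome determines the perturbed realization. -/
lemma sum_numRealizations_le {c₁ c₂ m : ℕ} (hd : CornerBound d c₁ c₂ m) :
    ∑ p : Fin n × Fin n, numRealizations (d + Pi.single p.1 1 + Pi.single p.2 1)
      ≤ numRealizations d * n ^ 12 := by
  have hwalk : ∀ a : (Σ p : Fin n × Fin n, Realization (d + Pi.single p.1 1 + Pi.single p.2 1)),
      ∃ W : ℕ → Fin n, W 0 = a.1.2 ∧ W 11 = a.1.1 ∧
        ∀ x, intDegree (a.2.1 ∆ trailGraph W 11) x = d x := by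
    rintro ⟨⟨i, j⟩, G⟩
    obtain ⟨W, hstart, hend, hdeg⟩ := hd.hasRelievingWalk (G := G.1) (u := i) (v := j) fun x => by
      rw [G.intDegree_eq]
      simp only [Pi.add_apply, Pi.single_apply]
      split_ifs <;> push_cast <;> ring
    refine ⟨W, hstart, hend, fun x => ?_⟩
    rw [hdeg, G.intDegree_eq]
    simp only [Pi.add_apply, Pi.single_apply]
    split_ifs <;> push_cast <;> ring
  choose W hstart hend hdeg using hwalk
  calc ∑ p : Fin n × Fin n, numRealizations (d + Pi.single p.1 1 + Pi.single p.2 1)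
      = Fintype.card (Σ p : Fin n × Fin n, Realization (d + Pi.single p.1 1 + Pi.single p.2 1)) :=
        Fintype.card_sigma.symm
    _ ≤ Fintype.card (Realization d × (Fin 12 → Fin n)) := ?_
    _ = numRealizations d * n ^ 12 := by
        rw [Fintype.card_prod, Fintype.card_fun, Fintype.card_fin, Fintype.card_fin,
          numRealizations]
  refine Fintype.card_le_of_injective (fun a =>
    (Realization.ofIntDegree (a.2.1 ∆ trailGraph (W a) 11) (hdeg a), fun t => W a t)) ?_
  intro a b hab
  obtain ⟨hgraph, hvertices⟩ := Prod.ext_iff.1 hab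
  have hW : ∀ t ≤ 11, W a t = W b t := fun t ht => congrFun hvertices ⟨t, by omega⟩
  have hab₁ : a.1 = b.1 := by
    ext1
    · rw [← hend a, ← hend b, hW 11 le_rfl]
    · rw [← hstart a, ← hstart b, hW 0 (by omega)]
  have hab₂ : a.2.1 = b.2.1 := by
    have := congrArg Subtype.val hgraph
    simp only [Realization.ofIntDegree, trailGraph_congr hW] at this
    exact symmDiff_left_injective _ this
  obtain ⟨p, G, hG⟩ := a
  obtain ⟨p', G', hG'⟩ := b
  obtain rfl : p = p' := hab₁
  obtain rfl : G = G' := hab₂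
  rfl

lemma perturbationRatio_le_pow {c₁ c₂ m : ℕ} (hd : CornerBound d c₁ c₂ m)
    (hgraphic : 0 < numRealizations d) : perturbationRatio ⟨n, d⟩ ≤ (n : ℝ) ^ 12 := by
  calc ∑ i : Fin n, ∑ j ∈ Finset.Ici i,
        (numRealizations (d + Pi.single i 1 + Pi.single j 1) : ℝ) / (numRealizations d : ℝ)
      ≤ ∑ i : Fin n, ∑ j : Fin n,
        (numRealizations (d + Pi.single i 1 + Pi.single j 1) : ℝ) / (numRealizations d : ℝ) :=
        Finset.sum_le_sum fun i _ => Finset.sum_le_sum_of_subset_of_nonneg (Finset.subset_univ _)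
          fun _ _ _ => by positivity
    _ = (∑ p : Fin n × Fin n, (numRealizations (d + Pi.single p.1 1 + Pi.single p.2 1) : ℝ))
          / (numRealizations d : ℝ) := by rw [Finset.sum_div, Fintype.sum_prod_type]
    _ ≤ (n : ℝ) ^ 12 := by
        rw [div_le_iff₀ (by exact_mod_cast hgraphic), mul_comm]
        exact_mod_cast sum_numRealizations_le hd

theorem isStable_maxFullyGraphicRegion :
    IsStable (3 * Polynomial.X ^ 13) maxFullyGraphicRegion := by
  rintro ⟨n, d⟩ hs hgraphic
  obtain ⟨c₁, c₂, m, hd⟩ := exists_cornerBound_of_mem hs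
  have hn : (1 : ℝ) ≤ n := by
    have hlt : c₁ < n := (Fintype.card_fin n).symm ▸ hd.lt
    exact_mod_cast (by omega : 1 ≤ n)
  calc perturbationRatio ⟨n, d⟩ ≤ (n : ℝ) ^ 12 :=
        perturbationRatio_le_pow hd (Fintype.card_pos_iff.2 hgraphic)
    _ ≤ (n : ℝ) ^ 13 := pow_le_pow_right₀ hn (by norm_num)
    _ ≤ 3 * (n : ℝ) ^ 13 := le_mul_of_one_le_left (by positivity) (by norm_num)
    _ = (3 * Polynomial.X ^ 13 : Polynomial ℝ).eval (n : ℝ) := by simp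

lemma isFullyGraphic_completeRegion (k : ℕ) :
    IsFullyGraphic (simpleRegion (k + 1) ((k + 1) * k) k k) := by
  rintro ⟨n, d⟩ ⟨-, hn, hd, -⟩
  obtain rfl : n = k + 1 := hn
  refine ⟨⊤, fun i : Fin (k + 1) => ?_⟩
  have hdeg : (⊤ : SimpleGraph (Fin (k + 1))).degree i = k := by simp
  convert hdeg
  exact le_antisymm (hd i).2 (hd i).1

lemma infinite_maxFullyGraphicRegion : maxFullyGraphicRegion.Infinite := by
  refine Set.infinite_of_injective_forall_mem
    (f := fun k : ℕ => (⟨k + 2, fun _ => k + 1⟩ : Seq)) (fun a b hab => ?_) fun k => ?_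
  · simpa using congrArg Sigma.fst hab
  · refine ⟨simpleRegion (k + 2) ((k + 2) * (k + 1)) (k + 1) (k + 1),
      ⟨k + 2, (k + 2) * (k + 1), k + 1, k + 1, by omega, le_rfl, by omega, rfl,
        isFullyGraphic_completeRegion (k + 1)⟩, ⟨fun i => by simp, ?_⟩, rfl, fun i => by simp,
        by simp⟩
    rw [Finset.sum_const, Finset.card_univ, Fintype.card_fin, smul_eq_mul, mul_comm]
    exact Nat.even_mul_succ_self (k + 1)

end Stability

/-! ### Balls in the space of graphs -/

section HammingBalls

variable {X Y : Type*} [Fintype X] [DecidableEq Y]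

lemma hammingDist_update_lt [DecidableEq X] {f g : X → Y} {x : X} (hx : f x ≠ g x) :
    hammingDist f (Function.update g x (f x)) < hammingDist f g := by
  refine Finset.card_lt_card ((Finset.ssubset_iff_of_subset fun y hy => ?_).2 ⟨x, by simpa using hx,
    by simp⟩)
  rw [Finset.mem_filter_univ] at hy ⊢
  rcases eq_or_ne y x with rfl | hyx
  · exact hx
  · rwa [Function.update_of_ne hyx] at hy

variable [Fintype Y]

lemma card_hammingBall_le (f : X → Y) (c : ℕ) :
    (Finset.univ.filter fun g : X → Y => hammingDist f g ≤ c).card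
      ≤ (Fintype.card X * Fintype.card Y + 1) ^ c := by
  induction c with
  | zero =>
    simp only [nonpos_iff_eq_zero, hammingDist_eq_zero, pow_zero, Finset.filter_eq,
      Finset.mem_univ, if_true, Finset.card_singleton, le_refl]
  | succ c ih =>
    let change : (X → Y) × Option (X × Y) → (X → Y) := fun p =>
      p.2.elim p.1 fun q => Function.update p.1 q.1 q.2
    have hsub : (Finset.univ.filter fun g : X → Y => hammingDist f g ≤ c + 1) ⊆
        ((Finset.univ.filter fun g : X → Y => hammingDist f g ≤ c) ×ˢ Finset.univ).image
          change := by
      intro g hg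
      simp only [Finset.mem_image, Finset.mem_product, Finset.mem_filter, Finset.mem_univ,
        true_and, and_true, Prod.exists] at hg ⊢
      by_cases hfg : f = g
      · exact ⟨g, none, by simp [hfg], rfl⟩
      · obtain ⟨x, hx⟩ := Function.ne_iff.1 hfg
        have := hammingDist_update_lt hx
        exact ⟨Function.update g x (f x), some (x, g x), by omega, by simp [change]⟩
    refine (Finset.card_le_card hsub).trans (Finset.card_image_le.trans ?_)
    rw [Finset.card_product, Finset.card_univ, Fintype.card_option, Fintype.card_prod, pow_succ]
    exact Nat.mul_le_mul_right _ ih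

lemma card_le_of_hammingDist_le (f : X → Y) (c : ℕ) (s : Finset (X → Y))
    (hs : ∀ g ∈ s, hammingDist f g ≤ c) :
    s.card ≤ (Fintype.card X * Fintype.card Y + 1) ^ c :=
  (Finset.card_le_card fun g hg => Finset.mem_filter.2 ⟨Finset.mem_univ g, hs g hg⟩).trans
    (card_hammingBall_le f c)

end HammingBalls

section EdgeDistance

variable {V : Type*}

/-- The adjacency relation of a graph as a function on pairs. -/
def adjFun (G : SimpleGraph V) : V × V → Prop := fun p => G.Adj p.1 p.2

lemma adjFun_injective : Function.Injective (adjFun : SimpleGraph V → V × V → Prop) := by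
  intro G H h
  ext a b
  exact iff_of_eq (congrFun h (a, b))

variable [Fintype V]

/-- The number of ordered pairs of vertices on which two graphs differ, which is twice the number of
edges in their symmetric difference. -/
def edgeDist (G H : SimpleGraph V) : ℕ := hammingDist (adjFun G) (adjFun H)

lemma edgeDist_eq_zero {G H : SimpleGraph V} : edgeDist G H = 0 ↔ G = H := by
  rw [edgeDist, hammingDist_eq_zero, adjFun_injective.eq_iff]

lemma edgeDist_comm (G H : SimpleGraph V) : edgeDist G H = edgeDist H G := hammingDist_comm _ _

lemma edgeDist_triangle (G H K : SimpleGraph V) : edgeDist G K ≤ edgeDist G H + edgeDist H K :=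
  hammingDist_triangle _ _ _

lemma card_le_of_edgeDist_le (G : SimpleGraph V) (c : ℕ) (s : Finset (SimpleGraph V))
    (hs : ∀ H ∈ s, edgeDist G H ≤ c) : s.card ≤ (2 * Fintype.card V ^ 2 + 1) ^ c := by
  have h := card_le_of_hammingDist_le (adjFun G) c (s.image adjFun)
    (Finset.forall_mem_image.2 hs)
  rwa [Finset.card_image_of_injective s adjFun_injective, Fintype.card_prod, Fintype.card_prop,
    ← sq, mul_comm] at h

lemma edgeDist_edge_le (G : SimpleGraph V) (a b : V) :
    edgeDist G (G ∆ SimpleGraph.edge a b) ≤ 2 := by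
  have hsub : (Finset.univ.filter fun p : V × V =>
      adjFun G p ≠ adjFun (G ∆ SimpleGraph.edge a b) p) ⊆ {(a, b), (b, a)} := by
    rintro ⟨x, y⟩ hp
    simp only [Finset.mem_filter, Finset.mem_univ, true_and, adjFun, ne_eq, eq_iff_iff,
      symmDiff_adj, SimpleGraph.edge_adj, Finset.mem_insert, Finset.mem_singleton,
      Prod.mk.injEq] at hp ⊢
    tauto
  exact (Finset.card_le_card hsub).trans Finset.card_le_two

lemma edgeDist_trailGraph_le (G : SimpleGraph V) (w : ℕ → V) (L : ℕ) :
    edgeDist G (G ∆ trailGraph w L) ≤ 2 * L := by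
  induction L with
  | zero => simp [trailGraph, edgeDist]
  | succ L ih =>
    rw [trailGraph, ← symmDiff_assoc]
    have := edgeDist_triangle G (G ∆ trailGraph w L)
      ((G ∆ trailGraph w L) ∆ SimpleGraph.edge (w L) (w (L + 1)))
    have := edgeDist_edge_le (G ∆ trailGraph w L) (w L) (w (L + 1))
    omega

end EdgeDistance

/-! ### Switches -/

section FourCycles

variable {V : Type*} {G H : SimpleGraph V} {a b c e : V}

/-- The graph with the edges `ab`, `bc`, `ce`, `ea`, if these are four different edges. -/
def fourCycle (a b c e : V) : SimpleGraph V :=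
  SimpleGraph.edge a b ∆ (SimpleGraph.edge b c ∆ (SimpleGraph.edge c e ∆ SimpleGraph.edge e a))

/-- The pairs `ab`, `bc`, `ce`, `ea` are alternately edges and non-edges of `G`. -/
structure IsAltCycle (G : SimpleGraph V) (a b c e : V) : Prop where
  adj_ab : G.Adj a b
  adj_ce : G.Adj c e
  ne_bc : b ≠ c
  ne_ea : e ≠ a
  not_adj_bc : ¬ G.Adj b c
  not_adj_ea : ¬ G.Adj e a

lemma fourCycle_rotate (a b c e : V) : fourCycle b c e a = fourCycle a b c e := by
  rw [fourCycle, fourCycle, symmDiff_comm (SimpleGraph.edge a b)]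
  simp only [symmDiff_assoc]

lemma symmDiff_fourCycle (G : SimpleGraph V) (a b c e : V) :
    G ∆ fourCycle a b c e = (((G ∆ SimpleGraph.edge a b) ∆ SimpleGraph.edge b c) ∆
      SimpleGraph.edge c e) ∆ SimpleGraph.edge e a := by
  simp only [fourCycle, symmDiff_assoc]

namespace IsAltCycle

lemma ne_ac (h : IsAltCycle G a b c e) : a ≠ c := by
  rintro rfl
  exact h.not_adj_bc h.adj_ab.symm

lemma ne_be (h : IsAltCycle G a b c e) : b ≠ e := by
  rintro rfl
  exact h.not_adj_ea h.adj_ab.symm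

lemma symmDiff_adj (h : IsAltCycle G a b c e) (x y : V) :
    (G ∆ fourCycle a b c e).Adj x y ↔
      G.Adj x y ∧ s(x, y) ≠ s(a, b) ∧ s(x, y) ≠ s(c, e) ∨
        s(x, y) = s(a, e) ∨ s(x, y) = s(c, b) := by
  have adj_congr : ∀ p q, s(x, y) = s(p, q) → (G.Adj x y ↔ G.Adj p q) ∧ (x ≠ y ↔ p ≠ q) := by
    intro p q hpq
    rcases Sym2.eq_iff.1 hpq with ⟨rfl, rfl⟩ | ⟨rfl, rfl⟩
    · exact ⟨Iff.rfl, Iff.rfl⟩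
    · exact ⟨G.adj_comm x y, ne_comm⟩
  have hab := adj_congr a b
  have hce := adj_congr c e
  have hea := adj_congr e a
  have hbc := adj_congr b c
  have hne₁ : s(a, b) ≠ s(c, e) := by simp [h.ne_ac, h.ne_ea.symm]
  have hne₂ : s(b, c) ≠ s(e, a) := by simp [h.ne_be, h.adj_ab.ne']
  rw [Sym2.eq_swap (a := a) (b := e), Sym2.eq_swap (a := c) (b := b)]
  simp only [symmDiff_fourCycle, FullyGraphic.symmDiff_adj, SimpleGraph.adj_edge,
    eq_comm (b := s(x, y))]
  have := h.adj_ab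
  have := h.adj_ce
  have := h.not_adj_bc
  have := h.not_adj_ea
  have := h.ne_bc
  have := h.ne_ea
  have := h.adj_ab.ne
  have := h.adj_ce.ne
  grind

protected lemma symmDiff (h : IsAltCycle G a b c e) :
    IsAltCycle (G ∆ fourCycle a b c e) b c e a where
  adj_ab := (h.symmDiff_adj b c).2 (by simp)
  adj_ce := (h.symmDiff_adj e a).2 (by simp)
  ne_bc := h.adj_ce.ne
  ne_ea := h.adj_ab.ne
  not_adj_bc := by
    simp [h.symmDiff_adj, h.adj_ce.ne, h.ne_bc.symm, h.ne_ac.symm, h.ne_ea, h.ne_be.symm]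
  not_adj_ea := by simp [h.symmDiff_adj, h.adj_ab.ne, h.ne_be, h.ne_ac, h.ne_ea.symm]

variable [Fintype V]

lemma intDegree_symmDiff (h : IsAltCycle G a b c e) (x : V) :
    intDegree (G ∆ fourCycle a b c e) x = intDegree G x := by
  rw [symmDiff_fourCycle, intDegree_symmDiff_edge _ h.ne_ea, intDegree_symmDiff_edge _ h.adj_ce.ne,
    intDegree_symmDiff_edge _ h.ne_bc, intDegree_symmDiff_edge _ h.adj_ab.ne]
  simp only [FullyGraphic.symmDiff_adj, SimpleGraph.edge_adj, h.adj_ab, h.adj_ce, h.not_adj_bc,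
    h.not_adj_ea, h.ne_ac, h.ne_ac.symm, h.ne_be.symm, h.ne_bc, h.ne_bc.symm, h.ne_ea,
    h.ne_ea.symm, h.adj_ab.ne, h.adj_ab.ne', h.adj_ce.ne, h.adj_ce.ne', and_false, and_self,
    and_true, or_self, not_true, not_false_eq_true, iff_false, if_true, if_false, ne_eq]
  ring

end IsAltCycle

variable [Fintype V]

lemma edgeDist_symmDiff_edge_lt (h : ¬ (G.Adj a b ↔ H.Adj a b)) :
    edgeDist (G ∆ SimpleGraph.edge a b) H < edgeDist G H := by
  have hab : a ≠ b := by
    rintro rfl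
    simp at h
  refine Finset.card_lt_card ((Finset.ssubset_iff_of_subset fun p hp => ?_).2 ⟨(a, b), ?_, ?_⟩)
  · have hp' : (p.1 = a ∧ p.2 = b ∨ p.1 = b ∧ p.2 = a) → (G.Adj p.1 p.2 ↔ G.Adj a b) ∧
        (H.Adj p.1 p.2 ↔ H.Adj a b) := by
      rintro (⟨h₁, h₂⟩ | ⟨h₁, h₂⟩) <;> simp [h₁, h₂, G.adj_comm, H.adj_comm]
    simp only [Finset.mem_filter_univ, adjFun, ne_eq, eq_iff_iff, symmDiff_adj,
      SimpleGraph.edge_adj] at hp ⊢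
    tauto
  · simpa [adjFun] using h
  · simp only [Finset.mem_filter_univ, adjFun, ne_eq, eq_iff_iff, symmDiff_adj,
      SimpleGraph.edge_adj]
    tauto

lemma edgeDist_symmDiff_fourCycle_lt (hac : a ≠ c) (hbe : b ≠ e)
    (hab : ¬ (G.Adj a b ↔ H.Adj a b)) (hbc : ¬ (G.Adj b c ↔ H.Adj b c))
    (hce : ¬ (G.Adj c e ↔ H.Adj c e)) : edgeDist (G ∆ fourCycle a b c e) H < edgeDist G H := by
  have hb : b ≠ c := by
    rintro rfl
    simp at hbc
  set G₁ := G ∆ SimpleGraph.edge a b with hG₁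
  set G₂ := G₁ ∆ SimpleGraph.edge b c with hG₂
  set G₃ := G₂ ∆ SimpleGraph.edge c e with hG₃
  have hbc₁ : G₁.Adj b c ↔ G.Adj b c := by
    simp [hG₁, symmDiff_adj, SimpleGraph.edge_adj, hac.symm, hb.symm]
  have hce₂ : G₂.Adj c e ↔ G.Adj c e := by
    simp [hG₁, hG₂, symmDiff_adj, SimpleGraph.edge_adj, hac.symm, hb.symm, hbe.symm]
  have hlt₁ : edgeDist G₁ H < edgeDist G H := edgeDist_symmDiff_edge_lt hab
  have hlt₂ : edgeDist G₂ H < edgeDist G₁ H := edgeDist_symmDiff_edge_lt (by rwa [hbc₁])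
  have hlt₃ : edgeDist G₃ H < edgeDist G₂ H := edgeDist_symmDiff_edge_lt (by rwa [hce₂])
  have htri := edgeDist_triangle (G₃ ∆ SimpleGraph.edge e a) G₃ H
  have hlast := edgeDist_edge_le G₃ e a
  rw [edgeDist_comm] at hlast
  rw [symmDiff_fourCycle, ← hG₁, ← hG₂, ← hG₃]
  omega

lemma edgeDist_symmDiff_fourCycle_le (G : SimpleGraph V) (a b c e : V) :
    edgeDist G (G ∆ fourCycle a b c e) ≤ 8 := by
  have h₁ := edgeDist_edge_le G a b
  have h₂ := edgeDist_edge_le (G ∆ SimpleGraph.edge a b) b c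
  have h₃ := edgeDist_edge_le ((G ∆ SimpleGraph.edge a b) ∆ SimpleGraph.edge b c) c e
  have h₄ := edgeDist_edge_le
    (((G ∆ SimpleGraph.edge a b) ∆ SimpleGraph.edge b c) ∆ SimpleGraph.edge c e) e a
  rw [symmDiff_fourCycle]
  exact (edgeDist_triangle _ _ _).trans (add_le_add ((edgeDist_triangle _ _ _).trans
    (add_le_add ((edgeDist_triangle _ _ _).trans (add_le_add h₁ h₂)) h₃)) h₄)

end FourCycles

section Switches

variable {n : ℕ} {G H : SimpleGraph (Fin n)}

lemma isSwitch_iff :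
    IsSwitch G H ↔ ∃ a b c e, IsAltCycle G a b c e ∧ H = G ∆ fourCycle a b c e := by
  have eq_iff : ∀ a b c e, IsAltCycle G a b c e → (H = G ∆ fourCycle a b c e ↔
      H.edgeSet = (G.edgeSet \ {s(a, b), s(c, e)}) ∪ {s(a, e), s(c, b)}) := by
    intro a b c e h
    rw [← SimpleGraph.edgeSet_inj]
    suffices (G ∆ fourCycle a b c e).edgeSet =
        (G.edgeSet \ {s(a, b), s(c, e)}) ∪ {s(a, e), s(c, b)} by rw [this]
    ext p
    induction p using Sym2.ind with
    | _ x y =>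
      simp only [Set.mem_union, Set.mem_sdiff, SimpleGraph.mem_edgeSet, Set.mem_insert_iff,
        Set.mem_singleton_iff, not_or, h.symmDiff_adj, ne_eq]
  constructor
  · rintro ⟨a, b, c, e, hab, hce, hae, hcb, hnae, hncb, hH⟩
    have h : IsAltCycle G a b c e :=
      ⟨hab, hce, hcb.symm, hae.symm, fun h => hncb h.symm, fun h => hnae h.symm⟩
    exact ⟨a, b, c, e, h, (eq_iff a b c e h).2 hH⟩
  · rintro ⟨a, b, c, e, h, hH⟩
    exact ⟨a, b, c, e, h.adj_ab, h.adj_ce, h.ne_ea.symm, h.ne_bc.symm,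
      fun h' => h.not_adj_ea h'.symm, fun h' => h.not_adj_bc h'.symm, (eq_iff a b c e h).1 hH⟩

lemma IsSwitch.symm (h : IsSwitch G H) : IsSwitch H G := by
  obtain ⟨a, b, c, e, hcycle, rfl⟩ := isSwitch_iff.1 h
  refine isSwitch_iff.2 ⟨b, c, e, a, hcycle.symmDiff, ?_⟩
  rw [fourCycle_rotate a b c e, symmDiff_symmDiff_cancel_right]

lemma IsSwitch.edgeDist_le (h : IsSwitch G H) : edgeDist G H ≤ 8 := by
  obtain ⟨a, b, c, e, -, rfl⟩ := isSwitch_iff.1 h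
  exact edgeDist_symmDiff_fourCycle_le G a b c e

/-- There is a switch of `G`, or of `H`, that preserves the degrees and brings the two graphs closer
to each other. -/
def HasCloserSwitch (G H : SimpleGraph (Fin n)) : Prop :=
  ∃ K, (IsSwitch G K ∧ (∀ x, intDegree K x = intDegree G x) ∧ edgeDist K H < edgeDist G H) ∨
    (IsSwitch H K ∧ (∀ x, intDegree K x = intDegree H x) ∧ edgeDist G K < edgeDist G H)

lemma HasCloserSwitch.symm (h : HasCloserSwitch G H) : HasCloserSwitch H G := by
  obtain ⟨K, hK⟩ := h
  rw [edgeDist_comm K, edgeDist_comm G H, edgeDist_comm G K] at hK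
  exact ⟨K, hK.symm⟩

/-- The pair `ae` closes the path `abce`, on which the edges of `G \ H` and of `H \ G` alternate, to
an alternating 4-cycle of `G` or of `H`. -/
lemma hasCloserSwitch_of_path {a b c e : Fin n} (hab : (G \ H).Adj a b) (hbc : (H \ G).Adj b c)
    (hce : (G \ H).Adj c e) (hae : a ≠ e) (hn : ¬ (G \ H).Adj a e) : HasCloserSwitch G H := by
  simp only [SimpleGraph.sdiff_adj, not_and_not_right] at hab hbc hce hn
  have hac : a ≠ c := by
    rintro rfl
    exact hbc.2 hab.1.symm
  have hbe : b ≠ e := by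
    rintro rfl
    exact hbc.2 hce.1.symm
  by_cases hG : G.Adj a e
  · have hcycle : IsAltCycle H b c e a :=
      ⟨hbc.1, (hn hG).symm, hce.1.ne, hab.1.ne, hce.2, hab.2⟩
    refine ⟨_, Or.inr ⟨isSwitch_iff.2 ⟨b, c, e, a, hcycle, rfl⟩, hcycle.intDegree_symmDiff, ?_⟩⟩
    rw [edgeDist_comm G, edgeDist_comm G, fourCycle_rotate]
    exact edgeDist_symmDiff_fourCycle_lt hac hbe (by simp [hab]) (by simp [hbc]) (by simp [hce])
  · have hcycle : IsAltCycle G a b c e :=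
      ⟨hab.1, hce.1, hbc.1.ne, hae.symm, hbc.2, fun h => hG h.symm⟩
    exact ⟨_, Or.inl ⟨isSwitch_iff.2 ⟨a, b, c, e, hcycle, rfl⟩, hcycle.intDegree_symmDiff,
      edgeDist_symmDiff_fourCycle_lt hac hbe (by simp [hab]) (by simp [hbc]) (by simp [hce])⟩⟩

lemma degree_sdiff_comm (hdeg : ∀ x, intDegree G x = intDegree H x) (x : Fin n) :
    (G \ H).degree x = (H \ G).degree x := by
  have hcard : (G.neighborFinset x).card = (H.neighborFinset x).card := by
    simpa [intDegree_eq_degree] using hdeg x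
  have hsdiff : ∀ A B : SimpleGraph (Fin n),
      (A \ B).degree x = (A.neighborFinset x \ B.neighborFinset x).card := by
    intro A B
    rw [← SimpleGraph.card_neighborFinset_eq_degree]
    congr 1
    ext y
    simp
  rw [hsdiff, hsdiff, Finset.card_sdiff_comm hcard]

lemma degree_lt_of_forall_adj {D : SimpleGraph (Fin n)} [DecidableRel D.Adj]
    {x y z : Fin n} (hxy : D.Adj x y) (hzy : ¬ D.Adj z y) (hne : z ≠ y)
    (h : ∀ t, D.Adj z t → x ≠ t → D.Adj x t) :
    D.degree z < D.degree x := by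
  have hy : y ∈ D.neighborFinset x := by simpa using hxy
  rw [← D.card_neighborFinset_eq_degree x, ← Finset.card_erase_add_one hy, Nat.lt_succ_iff,
    ← D.card_neighborFinset_eq_degree z]
  refine Finset.card_le_card_of_injOn (fun t => if t = x then z else t) ?_ ?_
  · intro t ht
    simp only [Finset.mem_coe, SimpleGraph.mem_neighborFinset, Finset.mem_erase] at ht ⊢
    split_ifs with htx
    · exact ⟨hne, htx ▸ ht.symm⟩
    · exact ⟨fun hty => hzy (hty ▸ ht), h t ht (Ne.symm htx)⟩
  · intro t ht t' ht' heq
    simp only [Finset.mem_coe, SimpleGraph.mem_neighborFinset] at ht ht'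
    grind [SimpleGraph.irrefl]

/-- Were there no such switch, the degree in `G \ H` would strictly decrease along an edge of
`G \ H` followed by an edge of `H \ G`; reversing this path and interchanging the two graphs, it
would also strictly increase. -/
theorem hasCloserSwitch_of_intDegree_eq (hdeg : ∀ x, intDegree G x = intDegree H x)
    (hne : G ≠ H) : HasCloserSwitch G H := by
  by_contra hno
  have degree_lt : ∀ {A B : SimpleGraph (Fin n)}, ¬ HasCloserSwitch A B → ∀ {x y z : Fin n},
      (A \ B).Adj x y → (B \ A).Adj y z → (A \ B).degree z < (A \ B).degree x := by
    intro A B hAB x y z hxy hyz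
    refine degree_lt_of_forall_adj hxy (fun h => hyz.2 h.1.symm) hyz.ne' fun t hzt hxt => ?_
    by_contra hn
    exact hAB (hasCloserSwitch_of_path hxy hyz hzt hxt hn)
  obtain ⟨x, y, hxy⟩ : ∃ x y, (G \ H).Adj x y := by
    by_contra! hsdiff
    refine hne (le_antisymm (sdiff_eq_bot_iff.1 ?_) (sdiff_eq_bot_iff.1 ?_)) <;> ext x y
    · simpa using hsdiff x y
    · have hzero : (H \ G).degree x = 0 := by
        rw [← degree_sdiff_comm hdeg, SimpleGraph.degree_eq_zero]
        exact fun y => hsdiff x y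
      simp only [SimpleGraph.bot_adj, iff_false]
      exact fun h => (SimpleGraph.degree_pos_iff_exists_adj _ _).2 ⟨y, h⟩ |>.ne' hzero
  obtain ⟨z, hyz⟩ : ∃ z, (H \ G).Adj y z := by
    rw [← SimpleGraph.degree_pos_iff_exists_adj, ← degree_sdiff_comm hdeg,
      SimpleGraph.degree_pos_iff_exists_adj]
    exact ⟨x, hxy.symm⟩
  have hlt := degree_lt hno hxy hyz
  have hgt := degree_lt (fun h => hno h.symm) hyz.symm hxy.symm
  rw [← degree_sdiff_comm hdeg, ← degree_sdiff_comm hdeg] at hgt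
  omega

end Switches

/-! ### Sums of squared differences -/

section PairSum

variable {Ω : Type*} [Fintype Ω]

/-- The sum of the squared differences of `f` over all ordered pairs related by `r`. -/
def pairSum (r : Ω → Ω → Prop) (f : Ω → ℝ) : ℝ :=
  ∑ x, ∑ y, if r x y then (f x - f y) ^ 2 else 0

lemma pairSum_nonneg (r : Ω → Ω → Prop) (f : Ω → ℝ) : 0 ≤ pairSum r f :=
  Finset.sum_nonneg fun x _ => Finset.sum_nonneg fun y _ => by split_ifs <;> positivity

lemma sum_sum_sum_ite_le (r s : Ω → Ω → Prop) (f : Ω → ℝ) (N : ℕ)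
    (hN : ∀ x, (Finset.univ.filter fun z => s x z).card ≤ N) :
    ∑ x, ∑ y, ∑ z, (if r x y ∧ s x z then (f x - f y) ^ 2 else 0) ≤ N * pairSum r f := by
  rw [pairSum, Finset.mul_sum]
  refine Finset.sum_le_sum fun x _ => ?_
  rw [Finset.mul_sum]
  refine Finset.sum_le_sum fun y _ => ?_
  by_cases hxy : r x y
  · simp only [hxy, true_and, if_true]
    rw [← Finset.sum_filter, Finset.sum_const, nsmul_eq_mul]
    exact mul_le_mul_of_nonneg_right (by exact_mod_cast hN x) (sq_nonneg _)
  · simp [hxy]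

/-- The bound `(f x - f y)² ≤ 2 (f x - f z)² + 2 (f z - f y)²` for a detour from `x` to `y` via `z`
along `r` and `s`, its two terms weighted so that each can be summed separately. -/
def detourCost (q r s : Ω → Ω → Prop) (f : Ω → ℝ) (x y z : Ω) : ℝ :=
  2 * (if r x z ∧ q x y then (f x - f z) ^ 2 else 0) +
    2 * (if s z y ∧ r z x then (f z - f y) ^ 2 else 0)

lemma sum_detourCost_le (f : Ω → ℝ) {q r s : Ω → Ω → Prop} {A B : ℕ}
    (hq : ∀ x, (Finset.univ.filter fun z => q x z).card ≤ A)
    (hr : ∀ x, (Finset.univ.filter fun z => r x z).card ≤ B) :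
    ∑ x, ∑ y, ∑ z, detourCost q r s f x y z ≤ 2 * A * pairSum r f + 2 * B * pairSum s f := by
  have hA := sum_sum_sum_ite_le r q f A hq
  have hB := sum_sum_sum_ite_le s r f B hr
  have hswap : ∀ F : Ω → Ω → Ω → ℝ, ∑ x, ∑ y, ∑ z, F z y x = ∑ x, ∑ y, ∑ z, F x y z := by
    intro F
    rw [Finset.sum_comm, Finset.sum_comm (f := fun x y => ∑ z, F x y z)]
    exact Finset.sum_congr rfl fun y _ => Finset.sum_comm
  calc ∑ x, ∑ y, ∑ z, detourCost q r s f x y z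
      = 2 * ∑ x, ∑ z, ∑ y, (if r x z ∧ q x y then (f x - f z) ^ 2 else 0) +
        2 * ∑ z, ∑ y, ∑ x, (if s z y ∧ r z x then (f z - f y) ^ 2 else 0) := by
        simp only [detourCost, Finset.sum_add_distrib, ← Finset.mul_sum]
        rw [← hswap fun z y x => if s z y ∧ r z x then (f z - f y) ^ 2 else 0]
        congr 2
        exact Finset.sum_congr rfl fun x _ => Finset.sum_comm
    _ ≤ 2 * A * pairSum r f + 2 * B * pairSum s f := by linarith

lemma pairSum_le_of_detour {q r s : Ω → Ω → Prop} (f : Ω → ℝ) {A B : ℕ}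
    (hq_symm : ∀ {x y}, q x y → q y x) (hr_symm : ∀ {x y}, r x y → r y x)
    (hq : ∀ x, (Finset.univ.filter fun z => q x z).card ≤ A)
    (hr : ∀ x, (Finset.univ.filter fun z => r x z).card ≤ B)
    (h : ∀ x y, q x y → x ≠ y → ∃ z, (r x z ∧ s z y) ∨ (r y z ∧ s z x)) :
    pairSum q f ≤ 4 * A * pairSum r f + 4 * B * pairSum s f := by
  set P := detourCost q r s f with hP
  have hP_nonneg : ∀ x y z, 0 ≤ P x y z := fun x y z => by
    simp only [hP, detourCost]
    split_ifs <;> positivity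
  have sq_le_P : ∀ {x y z}, q x y → r x z → s z y → (f x - f y) ^ 2 ≤ P x y z := by
    intro x y z hxy hxz hzy
    simp only [hP, detourCost, hxy, hxz, hzy, hr_symm hxz, and_self, if_true]
    nlinarith [sq_nonneg ((f x - f z) - (f z - f y))]
  have hnonneg : ∀ x y, 0 ≤ ∑ z, P x y z := fun x y => Finset.sum_nonneg fun z _ => hP_nonneg x y z
  have hsingle : ∀ x y z, P x y z ≤ ∑ z, P x y z := fun x y z =>
    Finset.single_le_sum (fun z _ => hP_nonneg x y z) (Finset.mem_univ z)
  have hpair : ∀ x y, (if q x y then (f x - f y) ^ 2 else 0) ≤ ∑ z, P x y z + ∑ z, P y x z := by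
    intro x y
    split_ifs with hxy
    · rcases eq_or_ne x y with rfl | hne
      · simpa using hnonneg x x
      obtain ⟨z, ⟨hxz, hzy⟩ | ⟨hyz, hzx⟩⟩ := h x y hxy hne
      · exact (sq_le_P hxy hxz hzy).trans
          ((hsingle x y z).trans (le_add_of_nonneg_right (hnonneg y x)))
      · rw [← neg_sub, neg_sq]
        exact (sq_le_P (hq_symm hxy) hyz hzx).trans
          ((hsingle y x z).trans (le_add_of_nonneg_left (hnonneg x y)))
    · exact add_nonneg (hnonneg x y) (hnonneg y x)
  calc pairSum q f ≤ ∑ x, ∑ y, (∑ z, P x y z + ∑ z, P y x z) :=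
        Finset.sum_le_sum fun x _ => Finset.sum_le_sum fun y _ => hpair x y
    _ = 2 * ∑ x, ∑ y, ∑ z, P x y z := by
        simp only [Finset.sum_add_distrib]
        rw [Finset.sum_comm (f := fun x y => ∑ z, P y x z), two_mul]
    _ ≤ 4 * A * pairSum r f + 4 * B * pairSum s f := by
        linarith [sum_detourCost_le (s := s) f hq hr]

end PairSum

section NearRealizations

variable {n : ℕ} {d : Fin n → ℕ}

/-- The relation between realizations that are a switch apart. -/
def switchRel (G H : Realization d) : Prop := IsSwitch G.1 H.1

/-- The relation between realizations that differ on at most `c` ordered pairs. -/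
def nearRel (c : ℕ) (G H : Realization d) : Prop := edgeDist G.1 H.1 ≤ c

lemma switchRel.symm {G H : Realization d} (h : switchRel G H) : switchRel H G := IsSwitch.symm h

lemma nearRel.symm {c : ℕ} {G H : Realization d} (h : nearRel c G H) : nearRel c H G :=
  (edgeDist_comm H.1 G.1).trans_le h

lemma card_nearRel_le (c : ℕ) (G : Realization d) :
    (Finset.univ.filter fun H => nearRel c G H).card ≤ (2 * n ^ 2 + 1) ^ c := by
  have h := card_le_of_edgeDist_le G.1 c
    ((Finset.univ.filter fun H => nearRel c G H).image Subtype.val)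
    (Finset.forall_mem_image.2 fun H hH => (Finset.mem_filter.1 hH).2)
  rwa [Finset.card_image_of_injective _ Subtype.val_injective, Fintype.card_fin] at h

lemma card_switchRel_le (G : Realization d) :
    (Finset.univ.filter fun H => switchRel G H).card ≤ (2 * n ^ 2 + 1) ^ 8 :=
  have hsub : (Finset.univ.filter fun H => switchRel G H) ⊆
      Finset.univ.filter fun H => nearRel 8 G H :=
    Finset.monotone_filter_right _ fun _ _ h => IsSwitch.edgeDist_le h
  (Finset.card_le_card hsub).trans (card_nearRel_le 8 G)

lemma exists_switchRel_of_nearRel {c : ℕ} {G H : Realization d} (h : nearRel (c + 1) G H)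
    (hne : G ≠ H) :
    ∃ K, (switchRel G K ∧ nearRel c K H) ∨ (switchRel H K ∧ nearRel c K G) := by
  obtain ⟨K, hK⟩ := hasCloserSwitch_of_intDegree_eq (G := G.1) (H := H.1)
    (fun x => by rw [G.intDegree_eq, H.intDegree_eq]) (Subtype.coe_ne_coe.2 hne)
  have hdeg : ∀ x, intDegree K x = d x := by
    intro x
    rcases hK with ⟨-, hK, -⟩ | ⟨-, hK, -⟩
    · rw [hK, G.intDegree_eq]
    · rw [hK, H.intDegree_eq]
  refine ⟨Realization.ofIntDegree K hdeg, hK.imp ?_ ?_⟩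
  · exact fun ⟨hswitch, _, hlt⟩ => ⟨hswitch, Nat.lt_succ_iff.1 (hlt.trans_le h)⟩
  · refine fun ⟨hswitch, _, hlt⟩ => ⟨hswitch, Nat.lt_succ_iff.1 ?_⟩
    exact ((edgeDist_comm K G.1).trans_lt hlt).trans_le h

lemma pairSum_nearRel_zero (f : Realization d → ℝ) : pairSum (nearRel 0) f = 0 := by
  refine Finset.sum_eq_zero fun G _ => Finset.sum_eq_zero fun H _ => ?_
  split_ifs with h
  · rw [nearRel, Nat.le_zero, edgeDist_eq_zero] at h
    rw [Subtype.ext h, sub_self, zero_pow two_ne_zero]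
  · rfl

theorem pairSum_nearRel_le (c : ℕ) (f : Realization d → ℝ) :
    pairSum (nearRel c) f ≤ (8 * (2 * n ^ 2 + 1) ^ 8) ^ c * pairSum switchRel f := by
  have hswitch := pairSum_nonneg (switchRel (d := d)) f
  induction c with
  | zero => simpa [pairSum_nearRel_zero] using hswitch
  | succ c ih =>
    set b : ℝ := 2 * n ^ 2 + 1 with hb
    have hb_one : 1 ≤ b := le_add_of_nonneg_left (by positivity)
    have hb_le : b ≤ b ^ 8 := le_self_pow₀ hb_one (by norm_num)
    have hpow : b ^ (c + 1) ≤ b ^ 8 * (8 * b ^ 8) ^ c := by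
      rw [pow_succ']
      gcongr
      linarith
    have hstep := pairSum_le_of_detour f nearRel.symm switchRel.symm
      (card_nearRel_le (c + 1)) card_switchRel_le fun _ _ => exists_switchRel_of_nearRel
    push_cast at hstep
    rw [← hb] at hstep
    calc pairSum (nearRel (c + 1)) f
        ≤ 4 * b ^ (c + 1) * pairSum switchRel f + 4 * b ^ 8 * pairSum (nearRel c) f := hstep
      _ ≤ 4 * (b ^ 8 * (8 * b ^ 8) ^ c) * pairSum switchRel f
          + 4 * b ^ 8 * ((8 * b ^ 8) ^ c * pairSum switchRel f) := by gcongr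
      _ = (8 * b ^ 8) ^ (c + 1) * pairSum switchRel f := by ring

end NearRealizations

/-! ### Matchings and their alternating components -/

lemma sq_sub_le_mul_sum_sq (a : ℕ → ℝ) (m : ℕ) :
    (a 0 - a m) ^ 2 ≤ m * ∑ t ∈ Finset.range m, (a t - a (t + 1)) ^ 2 := by
  have hcauchy := sq_sum_le_card_mul_sum_sq (s := Finset.range m) (f := fun t => a t - a (t + 1))
  rwa [Finset.sum_range_sub', Finset.card_range] at hcauchy

section Matchings

variable {X : Type*}

/-- A matching along a relation `Γ`, as an involution whose fixed points are the unmatched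
elements. -/
def IsMatching (Γ : X → X → Prop) (M : X → X) : Prop :=
  Function.Involutive M ∧ ∀ x, M x ≠ x → Γ x (M x)

lemma IsMatching.piecewise {Γ : X → X → Prop} {M M' : X → X} (hM : IsMatching Γ M)
    (hM' : IsMatching Γ M') {A : Set X} (hA : Set.MapsTo M A A) (hA' : Set.MapsTo M' A A) :
    IsMatching Γ (A.piecewise M' M) := by
  have hA_compl : ∀ x ∉ A, M x ∉ A := fun x hx hMx => hx (hM.1 x ▸ hA hMx)
  refine ⟨fun x => ?_, fun x => ?_⟩ <;> by_cases hx : x ∈ A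
  · rw [A.piecewise_eq_of_mem _ _ hx, A.piecewise_eq_of_mem _ _ (hA' hx), hM'.1]
  · rw [A.piecewise_eq_of_notMem _ _ hx, A.piecewise_eq_of_notMem _ _ (hA_compl x hx), hM.1]
  · rw [A.piecewise_eq_of_mem _ _ hx]
    exact hM'.2 x
  · rw [A.piecewise_eq_of_notMem _ _ hx]
    exact hM.2 x

/-- `x` and `y` lie in the same component of the union of `M` and `M'`. -/
def SameComponent (M M' : X → X) : X → X → Prop :=
  Relation.ReflTransGen fun p q => q = M p ∨ q = M' p

namespace SameComponent

variable {M M' : X → X} {x y z : X}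

lemma left (h : SameComponent M M' x y) : SameComponent M M' x (M y) :=
  Relation.ReflTransGen.tail h (Or.inl rfl)

lemma right (h : SameComponent M M' x y) : SameComponent M M' x (M' y) :=
  Relation.ReflTransGen.tail h (Or.inr rfl)

lemma trans (hxy : SameComponent M M' x y) (hyz : SameComponent M M' y z) :
    SameComponent M M' x z :=
  Relation.ReflTransGen.trans hxy hyz

lemma symm (hM : Function.Involutive M) (hM' : Function.Involutive M')
    (h : SameComponent M M' x y) : SameComponent M M' y x := by
  induction h with
  | refl => exact .refl
  | tail _ hstep ih =>
    refine .head ?_ ih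
    rcases hstep with rfl | rfl
    · exact Or.inl (hM _).symm
    · exact Or.inr (hM' _).symm

end SameComponent

lemma sameComponent_comm (M M' : X → X) : SameComponent M' M = SameComponent M M' := by
  simp only [SameComponent, or_comm]

lemma sameComponent_piecewise (A : Set X) (M M' : X → X) :
    SameComponent (A.piecewise M' M) (A.piecewise M M') = SameComponent M M' := by
  unfold SameComponent
  congr 1
  funext p q
  unfold Set.piecewise
  split_ifs
  · exact propext or_comm
  · rfl

/-- The matching `M`, exchanged for `M'` on the component of `x`. -/
def swapComponent (M M' : X → X) (x : X) : X → X :=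
  {y | SameComponent M M' x y}.piecewise M' M

variable [Fintype X]

/-- The union of the components of the first `t` elements. -/
def initialComponents (M M' : X → X) (t : ℕ) : Set X :=
  {y | ∃ s, (Fintype.equivFin X s).val < t ∧ SameComponent M M' s y}

/-- The matching `M`, exchanged for `M'` on the components of the first `t` elements. -/
def swapInitial (M M' : X → X) (t : ℕ) : X → X := (initialComponents M M' t).piecewise M' M

lemma initialComponents_comm (M M' : X → X) :
    initialComponents M' M = initialComponents M M' := by
  funext t
  rw [initialComponents, initialComponents, sameComponent_comm M M']

lemma sameComponent_swapInitial (M M' : X → X) (t : ℕ) :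
    SameComponent (swapInitial M M' t) (swapInitial M' M t) = SameComponent M M' := by
  rw [swapInitial, swapInitial, initialComponents_comm M M', sameComponent_piecewise]

lemma initialComponents_swapInitial (M M' : X → X) (t : ℕ) :
    initialComponents (swapInitial M M' t) (swapInitial M' M t) = initialComponents M M' := by
  funext s
  rw [initialComponents, sameComponent_swapInitial, initialComponents]

lemma swapInitial_swapInitial (M M' : X → X) (t : ℕ) :
    swapInitial (swapInitial M M' t) (swapInitial M' M t) t = M := by
  rw [swapInitial, initialComponents_swapInitial, swapInitial, swapInitial,
    initialComponents_comm M M']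
  funext x
  unfold Set.piecewise
  split_ifs <;> rfl

lemma swapInitial_zero (M M' : X → X) : swapInitial M M' 0 = M :=
  funext fun _ => Set.piecewise_eq_of_notMem _ _ _ fun ⟨_, hs, _⟩ => Nat.not_lt_zero _ hs

lemma swapInitial_card (M M' : X → X) : swapInitial M M' (Fintype.card X) = M' :=
  funext fun x => Set.piecewise_eq_of_mem _ _ _ ⟨x, Fin.is_lt _, .refl⟩

lemma mem_initialComponents_succ {M M' : X → X} {t : ℕ} (ht : t < Fintype.card X) (y : X) :
    y ∈ initialComponents M M' (t + 1) ↔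
      SameComponent M M' ((Fintype.equivFin X).symm ⟨t, ht⟩) y ∨ y ∈ initialComponents M M' t := by
  constructor
  · rintro ⟨s, hs, hsy⟩
    rcases Nat.lt_succ_iff_lt_or_eq.1 hs with hs | hs
    · exact Or.inr ⟨s, hs, hsy⟩
    · refine Or.inl ?_
      rwa [← (Equiv.eq_symm_apply _).2 (Fin.ext hs)]
  · rintro (hty | ⟨s, hs, hsy⟩)
    · exact ⟨_, by simp, hty⟩
    · exact ⟨s, hs.trans t.lt_succ_self, hsy⟩

lemma swapInitial_succ {M M' : X → X} (hM : Function.Involutive M)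
    (hM' : Function.Involutive M') {t : ℕ} (ht : t < Fintype.card X) :
    swapInitial M M' (t + 1) = swapInitial M M' t ∨
    swapInitial M M' (t + 1) = swapComponent (swapInitial M M' t) (swapInitial M' M t)
      ((Fintype.equivFin X).symm ⟨t, ht⟩) := by
  have hmem := mem_initialComponents_succ (M := M) (M' := M') ht
  set x := (Fintype.equivFin X).symm ⟨t, ht⟩
  by_cases hx : x ∈ initialComponents M M' t
  · refine Or.inl ?_
    have heq : initialComponents M M' (t + 1) = initialComponents M M' t := by
      ext y
      refine (hmem y).trans (or_iff_right_of_imp fun hxy => ?_)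
      obtain ⟨s, hs, hsx⟩ := hx
      exact ⟨s, hs, hsx.trans hxy⟩
    rw [swapInitial, heq, swapInitial]
  · refine Or.inr (funext fun y => ?_)
    have hdisjoint : SameComponent M M' x y → y ∉ initialComponents M M' t :=
      fun hxy ⟨s, hs, hsy⟩ => hx ⟨s, hs, hsy.trans (hxy.symm hM hM')⟩
    rw [swapComponent, sameComponent_swapInitial, swapInitial, swapInitial, swapInitial,
      initialComponents_comm M M']
    simp only [Set.piecewise, hmem, Set.mem_ofPred_eq]
    by_cases hxy : SameComponent M M' x y
    · rw [if_pos (Or.inl hxy), if_pos hxy, if_neg (hdisjoint hxy)]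
    · simp only [hxy, false_or, if_false]

/-- The perfect matchings along `Γ`. -/
def perfectMatchings (Γ : X → X → Prop) : Finset (X → X) :=
  Finset.univ.filter fun M => IsMatching Γ M ∧ ∀ x, M x ≠ x

variable {Γ : X → X → Prop} {M M' : X → X}

lemma mem_perfectMatchings : M ∈ perfectMatchings Γ ↔ IsMatching Γ M ∧ ∀ x, M x ≠ x := by
  simp [perfectMatchings]

lemma piecewise_mem_perfectMatchings (hM : M ∈ perfectMatchings Γ) (hM' : M' ∈ perfectMatchings Γ)
    {A : Set X} (hA : Set.MapsTo M A A) (hA' : Set.MapsTo M' A A) :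
    A.piecewise M' M ∈ perfectMatchings Γ := by
  rw [mem_perfectMatchings] at *
  refine ⟨hM.1.piecewise hM'.1 hA hA', fun x => ?_⟩
  unfold Set.piecewise
  split_ifs
  · exact hM'.2 x
  · exact hM.2 x

lemma swapComponent_mem_perfectMatchings (hM : M ∈ perfectMatchings Γ)
    (hM' : M' ∈ perfectMatchings Γ) (x : X) : swapComponent M M' x ∈ perfectMatchings Γ :=
  piecewise_mem_perfectMatchings hM hM' (fun _ => SameComponent.left)
    (fun _ => SameComponent.right)

lemma swapInitial_mem_perfectMatchings (hM : M ∈ perfectMatchings Γ)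
    (hM' : M' ∈ perfectMatchings Γ) (t : ℕ) : swapInitial M M' t ∈ perfectMatchings Γ :=
  piecewise_mem_perfectMatchings hM hM' (fun _ ⟨s, hs, hsx⟩ => ⟨s, hs, hsx.left⟩)
    (fun _ ⟨s, hs, hsx⟩ => ⟨s, hs, hsx.right⟩)

lemma sq_sub_le_sum_swapInitial (F : (X → X) → ℝ) (M M' : X → X) :
    (F M - F M') ^ 2 ≤ Fintype.card X * ∑ t ∈ Finset.range (Fintype.card X),
      (F (swapInitial M M' t) - F (swapInitial M M' (t + 1))) ^ 2 := by
  simpa only [swapInitial_zero, swapInitial_card] using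
    sq_sub_le_mul_sum_sq (fun t => F (swapInitial M M' t)) (Fintype.card X)

-- `(M, M') ↦ (swapInitial M M' t, swapInitial M' M t)` is an involution on pairs of perfect
-- matchings, which turns the step from `t` to `t + 1` into the exchange of one component.
lemma sum_sq_swapInitial_succ_le (F : (X → X) → ℝ) {t : ℕ} (ht : t < Fintype.card X) :
    ∑ p ∈ perfectMatchings Γ ×ˢ perfectMatchings Γ,
      (F (swapInitial p.1 p.2 t) - F (swapInitial p.1 p.2 (t + 1))) ^ 2 ≤
    ∑ p ∈ perfectMatchings Γ ×ˢ perfectMatchings Γ,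
      (F p.1 - F (swapComponent p.1 p.2 ((Fintype.equivFin X).symm ⟨t, ht⟩))) ^ 2 := by
  let x := (Fintype.equivFin X).symm ⟨t, ht⟩
  let φ (p : (X → X) × (X → X)) := (swapInitial p.1 p.2 t, swapInitial p.2 p.1 t)
  have hφφ (p) : φ (φ p) = p :=
    Prod.ext (swapInitial_swapInitial p.1 p.2 t) (swapInitial_swapInitial p.2 p.1 t)
  have hφ_mem : ∀ p ∈ perfectMatchings Γ ×ˢ perfectMatchings Γ,
      φ p ∈ perfectMatchings Γ ×ˢ perfectMatchings Γ := fun p hp =>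
    have ⟨hM, hM'⟩ := Finset.mem_product.1 hp
    Finset.mem_product.2 ⟨swapInitial_mem_perfectMatchings hM hM' t,
      swapInitial_mem_perfectMatchings hM' hM t⟩
  calc _ ≤ ∑ p ∈ perfectMatchings Γ ×ˢ perfectMatchings Γ,
        (F (φ p).1 - F (swapComponent (φ p).1 (φ p).2 x)) ^ 2 := by
        refine Finset.sum_le_sum fun p hp => ?_
        rw [Finset.mem_product, mem_perfectMatchings, mem_perfectMatchings] at hp
        rcases swapInitial_succ hp.1.1.1 hp.2.1.1 ht with hstay | hswap
        · rw [hstay, sub_self, zero_pow two_ne_zero]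
          positivity
        · rw [hswap]
    _ = _ := Finset.sum_nbij' φ φ hφ_mem hφ_mem (fun p _ => hφφ p) (fun p _ => hφφ p)
        fun _ _ => rfl

lemma sum_perfectMatchings_sq_le (F : (X → X) → ℝ) :
    ∑ p ∈ perfectMatchings Γ ×ˢ perfectMatchings Γ, (F p.1 - F p.2) ^ 2 ≤
      (Fintype.card X : ℝ) ^ 2 * ∑ x, ∑ p ∈ perfectMatchings Γ ×ˢ perfectMatchings Γ,
        (F p.1 - F (swapComponent p.1 p.2 x)) ^ 2 := by
  set N := Fintype.card X
  let P := perfectMatchings Γ ×ˢ perfectMatchings Γ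
  let S (x : X) := ∑ p ∈ P, (F p.1 - F (swapComponent p.1 p.2 x)) ^ 2
  have hS_nonneg (x) : 0 ≤ S x := Finset.sum_nonneg fun _ _ => sq_nonneg _
  calc _ ≤ ∑ p ∈ P, (N : ℝ) * ∑ t ∈ Finset.range N,
        (F (swapInitial p.1 p.2 t) - F (swapInitial p.1 p.2 (t + 1))) ^ 2 :=
        Finset.sum_le_sum fun p _ => sq_sub_le_sum_swapInitial F p.1 p.2
    _ = N * ∑ t ∈ Finset.range N, ∑ p ∈ P,
        (F (swapInitial p.1 p.2 t) - F (swapInitial p.1 p.2 (t + 1))) ^ 2 := by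
        rw [← Finset.mul_sum, Finset.sum_comm]
    _ ≤ N * ∑ _t ∈ Finset.range N, ∑ x, S x := by
        refine mul_le_mul_of_nonneg_left (Finset.sum_le_sum fun t ht => ?_) (Nat.cast_nonneg _)
        exact (sum_sq_swapInitial_succ_le F (Finset.mem_range.1 ht)).trans
          (Finset.single_le_sum (fun x _ => hS_nonneg x) (Finset.mem_univ _))
    _ = N ^ 2 * ∑ x, S x := by
        rw [Finset.sum_const, Finset.card_range, nsmul_eq_mul]
        ring

end Matchings

/-! ### Alternating paths -/

section Patch

variable {X : Type*} {M M' N N' : X → X} {A B : Set X}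

/-- The map `M'` on `A` and `M` off `B`, with the elements of `B \ A` fixed. -/
def patch (A B : Set X) (M M' : X → X) : X → X := A.piecewise M' (B.piecewise id M)

/-- The complement of `patch A B M M'` in the union of `M` and `M'`: the edges of `M` inside `A`
and the edges of `M'` off `A`. -/
def copatch (A : Set X) (M M' : X → X) : X → X := patch (A ∩ M ⁻¹' A) A M' M

lemma IsMatching.patch {Γ : X → X → Prop} (hM : IsMatching Γ M) (hM' : IsMatching Γ M')
    (hA : Set.MapsTo M' A A) (hB : Set.MapsTo M B B) (hAB : A ⊆ B) :
    IsMatching Γ (patch A B M M') := by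
  have hid : IsMatching Γ id := ⟨fun _ => rfl, fun _ hne => absurd rfl hne⟩
  refine (hM.piecewise hid hB (Set.mapsTo_id B)).piecewise hM' (fun x hx => ?_) hA
  rwa [Set.piecewise_eq_of_mem _ _ _ (hAB hx)]

lemma patch_of_mem {x : X} (hx : x ∈ A) : patch A B M M' x = M' x :=
  Set.piecewise_eq_of_mem _ _ _ hx

lemma patch_of_mem_diff {x : X} (hx : x ∈ B \ A) : patch A B M M' x = x :=
  (Set.piecewise_eq_of_notMem _ _ _ hx.2).trans (Set.piecewise_eq_of_mem _ _ _ hx.1)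

lemma patch_of_notMem {x : X} (hAB : A ⊆ B) (hx : x ∉ B) : patch A B M M' x = M x :=
  (Set.piecewise_eq_of_notMem _ _ _ fun hxA => hx (hAB hxA)).trans
    (Set.piecewise_eq_of_notMem _ _ _ hx)

lemma copatch_of_mem {x : X} (hx : x ∈ A) (hMx : M x ∈ A) : copatch A M M' x = M x :=
  patch_of_mem ⟨hx, hMx⟩

lemma copatch_of_notMem {x : X} (hx : x ∉ A) : copatch A M M' x = M' x :=
  patch_of_notMem Set.inter_subset_left hx

lemma fixedPoints_patch (hM : ∀ x, M x ≠ x) (hM' : ∀ x, M' x ≠ x) (hAB : A ⊆ B) :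
    Function.fixedPoints (patch A B M M') = B \ A := by
  ext x
  refine ⟨fun hx => ?_, patch_of_mem_diff⟩
  by_contra hxAB
  by_cases hxA : x ∈ A
  · exact hM' x ((patch_of_mem hxA).symm.trans hx)
  · exact hM x ((patch_of_notMem hAB fun hxB => hxAB ⟨hxB, hxA⟩).symm.trans hx)

lemma eq_of_patch_eq (hM : Function.Involutive M) (hN : Function.Involutive N)
    (hMB : Set.MapsTo M B B) (hNB : Set.MapsTo N B B) (hAB : A ⊆ B)
    (hpatch : patch A B M M' = patch A B N N') (hcopatch : copatch A M M' = copatch A N N')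
    (hends : ∀ x ∈ B \ A, M x = N x) : M = N ∧ M' = N' := by
  refine ⟨funext fun x => ?_, funext fun x => ?_⟩
  · by_cases hxB : x ∈ B
    swap
    · simpa only [patch_of_notMem hAB hxB] using congrFun hpatch x
    by_cases hxA : x ∈ A
    swap
    · exact hends x ⟨hxB, hxA⟩
    by_cases hMxA : M x ∈ A
    swap
    · rw [eq_comm, hN.eq_iff, ← hends _ ⟨hMB hxB, hMxA⟩, hM]
    by_cases hNxA : N x ∈ A
    swap
    · rw [hM.eq_iff, hends _ ⟨hNB hxB, hNxA⟩, hN]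
    simpa only [copatch_of_mem hxA hMxA, copatch_of_mem hxA hNxA] using congrFun hcopatch x
  · by_cases hxA : x ∈ A
    · simpa only [patch_of_mem hxA] using congrFun hpatch x
    · simpa only [copatch_of_notMem hxA] using congrFun hcopatch x

end Patch

section NearPerfect

variable {X : Type*} [Fintype X] {Γ : X → X → Prop} {M M' : X → X} {A B : Set X} {p q : X}

/-- The matchings along `Γ` that are perfect or leave exactly two elements unmatched. -/
def nearPerfectMatchings (Γ : X → X → Prop) : Finset (X → X) :=
  Finset.univ.filter fun M => IsMatching Γ M ∧
    (Function.fixedPoints M = ∅ ∨ ∃ p q, p ≠ q ∧ Function.fixedPoints M = {p, q})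

lemma mem_nearPerfectMatchings : M ∈ nearPerfectMatchings Γ ↔ IsMatching Γ M ∧
    (Function.fixedPoints M = ∅ ∨ ∃ p q, p ≠ q ∧ Function.fixedPoints M = {p, q}) := by
  simp [nearPerfectMatchings]

lemma perfectMatchings_subset_nearPerfectMatchings (Γ : X → X → Prop) :
    perfectMatchings Γ ⊆ nearPerfectMatchings Γ := fun _ hM =>
  have ⟨hmatching, hfixed⟩ := mem_perfectMatchings.1 hM
  mem_nearPerfectMatchings.2 ⟨hmatching, Or.inl (Set.eq_empty_of_forall_notMem hfixed)⟩

lemma patch_mem_nearPerfectMatchings (hM : M ∈ perfectMatchings Γ) (hM' : M' ∈ perfectMatchings Γ)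
    (hA : Set.MapsTo M' A A) (hB : Set.MapsTo M B B) (hAB : A ⊆ B) (hpq : p ≠ q)
    (hdiff : B \ A = {p, q}) : patch A B M M' ∈ nearPerfectMatchings Γ := by
  rw [mem_perfectMatchings] at hM hM'
  rw [mem_nearPerfectMatchings, fixedPoints_patch hM.2 hM'.2 hAB]
  exact ⟨hM.1.patch hM'.1 hA hB hAB, Or.inr ⟨p, q, hpq, hdiff⟩⟩

-- The unmatched elements of the copatch are the partners under `M` of those of the patch, unless
-- the latter are matched to each other by `M`.
lemma copatch_mem_nearPerfectMatchings (hM : M ∈ perfectMatchings Γ)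
    (hM' : M' ∈ perfectMatchings Γ) (hA : Set.MapsTo M' A A) (hB : Set.MapsTo M B B) (hAB : A ⊆ B)
    (hpq : p ≠ q) (hdiff : B \ A = {p, q}) : copatch A M M' ∈ nearPerfectMatchings Γ := by
  rw [mem_perfectMatchings] at hM hM'
  have hinv : Function.Involutive M := hM.1.1
  have hMA : Set.MapsTo M (A ∩ M ⁻¹' A) (A ∩ M ⁻¹' A) := fun x hx =>
    ⟨hx.2, by rw [Set.mem_preimage, hinv]; exact hx.1⟩
  rw [mem_nearPerfectMatchings, copatch, fixedPoints_patch hM'.2 hM.2 Set.inter_subset_left]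
  refine ⟨hM'.1.patch hM.1 hMA hA Set.inter_subset_left, ?_⟩
  have hmem (y) : y ∈ B \ A ↔ y = p ∨ y = q := by simp [hdiff]
  have hleave (x) : x ∈ A \ (A ∩ M ⁻¹' A) ↔ x ∈ A ∧ (M x = p ∨ M x = q) := by
    rw [← hmem (M x), Set.sdiff_self_inter, Set.mem_sdiff, Set.mem_preimage]
    exact ⟨fun hx => ⟨hx.1, hB (hAB hx.1), hx.2⟩, fun hx => ⟨hx.1, hx.2.2⟩⟩
  have hp : p ∈ B \ A := (hmem p).2 (Or.inl rfl)
  have hq : q ∈ B \ A := (hmem q).2 (Or.inr rfl)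
  have hpartner (r) (hr : r ∈ B \ A) : M r ∈ A ∨ M r = p ∨ M r = q := by
    exact or_iff_not_imp_left.2 fun hrA => (hmem _).1 ⟨hB hr.1, hrA⟩
  by_cases hMpq : M p = q
  · refine Or.inl (Set.eq_empty_of_forall_notMem fun x hx => ?_)
    rcases (hleave x).1 hx with ⟨hxA, hxp | hxq⟩
    · exact hq.2 (by rwa [← hMpq, ← hxp, hinv])
    · exact hp.2 (by rwa [← hinv p, hMpq, ← hxq, hinv])
  · have hMp : M p ∈ A := (hpartner p hp).resolve_right (not_or.2 ⟨hM.2 p, hMpq⟩)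
    have hMq : M q ∈ A := (hpartner q hq).resolve_right
      (not_or.2 ⟨fun h => hMpq (hinv.eq_iff.1 h).symm, hM.2 q⟩)
    refine Or.inr ⟨M p, M q, hinv.injective.ne hpq, Set.ext fun x => (hleave x).trans ?_⟩
    rw [Set.mem_insert_iff, Set.mem_singleton_iff, hinv.eq_iff, hinv.eq_iff]
    exact and_iff_right_of_imp fun hx => hx.elim (· ▸ hMp) (· ▸ hMq)

end NearPerfect

section Alternating

variable {X : Type*} {M M' : X → X} {x : X} {j : ℕ}

/-- The sequence obtained from `x` by applying `f` and `g` alternately, starting with `f`. -/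
def altIter (f g : X → X) (x : X) : ℕ → X
  | 0 => x
  | t + 1 => if Even t then f (altIter f g x t) else g (altIter f g x t)

lemma altIter_succ_of_even {t : ℕ} (ht : Even t) :
    altIter M M' x (t + 1) = M (altIter M M' x t) := by
  rw [altIter, if_pos ht]

lemma altIter_succ_of_odd {t : ℕ} (ht : Odd t) :
    altIter M M' x (t + 1) = M' (altIter M M' x t) := by
  rw [altIter, if_neg (Nat.not_even_iff_odd.2 ht)]

lemma apply_altIter_succ_of_even (hM : Function.Involutive M) {t : ℕ} (ht : Even t) :
    M (altIter M M' x (t + 1)) = altIter M M' x t := by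
  rw [altIter_succ_of_even ht, hM]

lemma apply_altIter_succ_of_odd (hM' : Function.Involutive M') {t : ℕ} (ht : Odd t) :
    M' (altIter M M' x (t + 1)) = altIter M M' x t := by
  rw [altIter_succ_of_odd ht, hM']

lemma altIter_two_mul (M M' : X → X) (x : X) (k : ℕ) :
    altIter M M' x (2 * k) = (M' ∘ M)^[k] x := by
  induction k with
  | zero => rfl
  | succ k ih =>
    rw [Nat.mul_succ, altIter_succ_of_odd (odd_two_mul_add_one k),
      altIter_succ_of_even (even_two_mul k), ih, Function.iterate_succ_apply']
    rfl

lemma sameComponent_altIter (M M' : X → X) (x : X) (t : ℕ) :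
    SameComponent M M' x (altIter M M' x t) := by
  induction t with
  | zero => exact .refl
  | succ t ih =>
    rcases Nat.even_or_odd t with ht | ht
    · exact altIter_succ_of_even (M := M) ht ▸ ih.left
    · exact altIter_succ_of_odd (M := M) ht ▸ ih.right

lemma altIter_ne_add_odd (hM : Function.Involutive M) (hM' : Function.Involutive M')
    (hne : ∀ x, M x ≠ x) (hne' : ∀ x, M' x ≠ x) (r a : ℕ) :
    altIter M M' x a ≠ altIter M M' x (a + (2 * r + 1)) := by
  induction r generalizing a with
  | zero =>
    rcases Nat.even_or_odd a with ha | ha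
    · exact altIter_succ_of_even (M := M) ha ▸ (hne _).symm
    · exact altIter_succ_of_odd (M := M) ha ▸ (hne' _).symm
  | succ r ih =>
    intro heq
    apply ih (a + 1)
    rw [show a + 1 + (2 * r + 1) = a + 2 * (r + 1) by ring]
    rw [show a + (2 * (r + 1) + 1) = a + 2 * (r + 1) + 1 by ring] at heq
    rcases Nat.even_or_odd a with ha | ha
    · rw [altIter_succ_of_even ha, heq, apply_altIter_succ_of_even hM (ha.add (even_two_mul _))]
    · rw [altIter_succ_of_odd ha, heq,
        apply_altIter_succ_of_odd hM' (ha.add_even (even_two_mul _))]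

/-- Half the length of the alternating cycle through `x`. -/
def halfPeriod (M M' : X → X) (x : X) : ℕ := Function.minimalPeriod (M' ∘ M) x

lemma halfPeriod_pos [Finite X] (hM : Function.Involutive M) (hM' : Function.Involutive M') :
    0 < halfPeriod M M' x :=
  Function.minimalPeriod_pos_of_mem_periodicPts
    ((hM'.injective.comp hM.injective).mem_periodicPts x)

lemma altIter_two_mul_halfPeriod (M M' : X → X) (x : X) :
    altIter M M' x (2 * halfPeriod M M' x) = x :=
  (altIter_two_mul M M' x _).trans Function.iterate_minimalPeriod

lemma altIter_injOn (hM : Function.Involutive M) (hM' : Function.Involutive M')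
    (hne : ∀ x, M x ≠ x) (hne' : ∀ x, M' x ≠ x) :
    Set.InjOn (altIter M M' x) (Set.Iio (2 * halfPeriod M M' x)) := by
  have heven {r s : ℕ} (hr : 2 * r < 2 * halfPeriod M M' x) (hs : 2 * s < 2 * halfPeriod M M' x)
      (heq : altIter M M' x (2 * r) = altIter M M' x (2 * s)) : r = s := by
    rw [altIter_two_mul, altIter_two_mul] at heq
    exact Function.iterate_injOn_Iio_minimalPeriod (Nat.lt_of_mul_lt_mul_left hr)
      (Nat.lt_of_mul_lt_mul_left hs) heq
  intro a ha b hb heq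
  wlog hab : a ≤ b generalizing a b
  · exact (this hb ha heq.symm (le_of_not_ge hab)).symm
  rw [Set.mem_Iio] at ha hb
  obtain ⟨c, rfl⟩ := Nat.exists_eq_add_of_le hab
  obtain ⟨s, rfl | rfl⟩ := Nat.even_or_odd' c
  swap
  · exact absurd heq (altIter_ne_add_odd hM hM' hne hne' s a)
  obtain ⟨r, rfl | rfl⟩ := Nat.even_or_odd' a
  · rw [← Nat.mul_add] at heq hb ⊢
    exact congrArg (2 * ·) (heven ha hb heq)
  · rw [show 2 * r + 1 + 2 * s = 2 * (r + s) + 1 by ring] at heq hb ⊢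
    rw [altIter_succ_of_even (even_two_mul r), altIter_succ_of_even (even_two_mul _)] at heq
    exact congrArg (2 * · + 1) (heven (by omega) (by omega) (hM.injective heq))

/-- The inner part `x₁, …, x₂ⱼ` of the alternating path from `x`. -/
def innerPath (M M' : X → X) (x : X) (j : ℕ) : Set X := altIter M M' x '' Set.Icc 1 (2 * j)

/-- The alternating path `x₀, …, x₂ⱼ₊₁` from `x`. -/
def outerPath (M M' : X → X) (x : X) (j : ℕ) : Set X := altIter M M' x '' Set.Iic (2 * j + 1)

lemma innerPath_mapsTo (hM' : Function.Involutive M') :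
    Set.MapsTo M' (innerPath M M' x j) (innerPath M M' x j) := by
  rintro _ ⟨t, ⟨ht_pos, ht_le⟩, rfl⟩
  rcases Nat.even_or_odd' t with ⟨r, rfl | rfl⟩
  · obtain ⟨s, rfl⟩ : ∃ s, r = s + 1 := ⟨r - 1, by omega⟩
    exact ⟨2 * s + 1, ⟨by omega, by omega⟩,
      (apply_altIter_succ_of_odd hM' (odd_two_mul_add_one s)).symm⟩
  · exact ⟨2 * r + 1 + 1, ⟨by omega, by omega⟩, altIter_succ_of_odd (odd_two_mul_add_one r)⟩

lemma outerPath_mapsTo (hM : Function.Involutive M) :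
    Set.MapsTo M (outerPath M M' x j) (outerPath M M' x j) := by
  rintro _ ⟨t, ht : t ≤ 2 * j + 1, rfl⟩
  rcases Nat.even_or_odd' t with ⟨r, rfl | rfl⟩
  · exact ⟨2 * r + 1, Set.mem_Iic.2 (by omega), altIter_succ_of_even (even_two_mul r)⟩
  · exact ⟨2 * r, Set.mem_Iic.2 (by omega), (apply_altIter_succ_of_even hM (even_two_mul r)).symm⟩

lemma outerPath_eq (M M' : X → X) (x : X) (j : ℕ) :
    outerPath M M' x j = innerPath M M' x j ∪ {x, altIter M M' x (2 * j + 1)} := by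
  have hIic : Set.Iic (2 * j + 1) = Set.Icc 1 (2 * j) ∪ {0, 2 * j + 1} := by
    ext t
    simp only [Set.mem_Iic, Set.mem_union, Set.mem_Icc, Set.mem_insert_iff, Set.mem_singleton_iff]
    omega
  rw [outerPath, hIic, Set.image_union, Set.image_pair]
  rfl

lemma innerPath_subset_outerPath (M M' : X → X) (x : X) (j : ℕ) :
    innerPath M M' x j ⊆ outerPath M M' x j := by
  rw [outerPath_eq]
  exact Set.subset_union_left

end Alternating

lemma hammingDist_le_card {X Y : Type*} [Fintype X] [DecidableEq Y] {f g : X → Y} (s : Finset X)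
    (hfg : ∀ x ∉ s, f x = g x) : hammingDist f g ≤ s.card :=
  Finset.card_le_card fun x hx =>
    by_contra fun hxs => (Finset.mem_filter.1 hx).2 (hfg x hxs)

section Interpolation

variable {X : Type*} {M M' N N' : X → X} {x y : X} {j : ℕ}

/-- The interpolating matchings on the way from `M` to the exchange of `M` and `M'` along the
alternating cycle through `x`. -/
def interpolation (M M' : X → X) (x : X) (j : ℕ) : X → X :=
  patch (innerPath M M' x j) (outerPath M M' x j) M M'

/-- The matchings complementary to the interpolating ones. -/
def coInterpolation (M M' : X → X) (x : X) (j : ℕ) : X → X := copatch (innerPath M M' x j) M M'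

-- From the second vertex of the path on, the edges of `M'` on the path belong to the
-- interpolation and the edges of `M` to its complement.
lemma altIter_interpolation {t : ℕ} (ht : t < 2 * j) :
    altIter (interpolation M M' x j) (coInterpolation M M' x j) (M x) t =
      altIter M M' x (t + 1) := by
  induction t with
  | zero => rfl
  | succ t ih =>
    have hmem : altIter M M' x (t + 1) ∈ innerPath M M' x j := ⟨t + 1, ⟨by omega, by omega⟩, rfl⟩
    have hmem' : altIter M M' x (t + 1 + 1) ∈ innerPath M M' x j :=
      ⟨t + 1 + 1, ⟨by omega, by omega⟩, rfl⟩
    rcases Nat.even_or_odd t with heven | hodd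
    · rw [altIter_succ_of_even heven, ih (by omega), altIter_succ_of_odd heven.add_one,
        interpolation, patch_of_mem hmem]
    · rw [altIter_succ_of_even hodd.add_one] at hmem'
      rw [altIter_succ_of_odd hodd, ih (by omega), altIter_succ_of_even hodd.add_one,
        coInterpolation, copatch_of_mem hmem hmem']

lemma innerPath_eq (M M' : X → X) (x : X) (j : ℕ) : innerPath M M' x j =
    altIter (interpolation M M' x j) (coInterpolation M M' x j) (M x) '' Set.Iio (2 * j) := by
  have himage : altIter (interpolation M M' x j) (coInterpolation M M' x j) (M x) ''
      Set.Iio (2 * j) = (fun t => altIter M M' x (t + 1)) '' Set.Iio (2 * j) :=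
    Set.image_congr fun t ht => altIter_interpolation ht
  rw [himage, innerPath]
  ext y
  constructor
  · rintro ⟨t, ⟨ht_pos, ht_le⟩, rfl⟩
    exact ⟨t - 1, Set.mem_Iio.2 (by omega), congrArg _ (Nat.sub_add_cancel ht_pos)⟩
  · rintro ⟨t, ht : t < 2 * j, rfl⟩
    exact ⟨t + 1, ⟨by omega, ht⟩, rfl⟩

/-- The code of a pair of matchings at a position of the alternating path. -/
def pathCode (x : X) (j : ℕ) (p : (X → X) × (X → X)) : (X → X) × (X → X) × X × X × X :=
  (interpolation p.1 p.2 x j, coInterpolation p.1 p.2 x j, p.1 x, altIter p.1 p.2 x (2 * j + 1),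
    p.1 (altIter p.1 p.2 x (2 * j + 1)))

lemma eq_of_pathCode_eq (hM : Function.Involutive M) (hN : Function.Involutive N)
    (hcode : pathCode x j (M, M') = pathCode x j (N, N')) : M = N ∧ M' = N' := by
  simp only [pathCode, Prod.mk.injEq] at hcode
  obtain ⟨hpatch, hcopatch, hx, hend, hMend⟩ := hcode
  have hinner : innerPath M M' x j = innerPath N N' x j := by
    rw [innerPath_eq M, innerPath_eq N, hpatch, hcopatch, hx]
  have houter : outerPath M M' x j = outerPath N N' x j := by
    rw [outerPath_eq M, outerPath_eq N, hinner, hend]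
  rw [interpolation, interpolation, ← hinner, ← houter] at hpatch
  rw [coInterpolation, coInterpolation, ← hinner] at hcopatch
  refine eq_of_patch_eq hM hN (outerPath_mapsTo hM) (houter ▸ outerPath_mapsTo hN)
    (innerPath_subset_outerPath M M' x j) hpatch hcopatch fun y hy => ?_
  rw [outerPath_eq, Set.union_sdiff_left] at hy
  rcases hy.1 with rfl | rfl
  · exact hx
  · rw [hMend, hend]

lemma sameComponent_iff_mem_outerPath (hM : Function.Involutive M) (hM' : Function.Involutive M')
    (hj : halfPeriod M M' x = j + 1) :
    SameComponent M M' x y ↔ y ∈ outerPath M M' x j := by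
  have hperiod : M' (altIter M M' x (2 * j + 1)) = x := by
    have hreturn := altIter_two_mul_halfPeriod M M' x
    rwa [hj, Nat.mul_succ, altIter_succ_of_odd (odd_two_mul_add_one j)] at hreturn
  refine ⟨fun hxy => ?_, ?_⟩
  · induction hxy with
    | refl => exact ⟨0, Nat.zero_le _, rfl⟩
    | tail _ hstep ih =>
      rcases hstep with rfl | rfl
      · exact outerPath_mapsTo hM ih
      · rw [outerPath_eq] at ih ⊢
        rcases ih with hinner | rfl | rfl
        · exact Or.inl (innerPath_mapsTo hM' hinner)
        · exact Or.inr (Or.inr (hM'.eq_iff.2 hperiod.symm))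
        · exact Or.inr (Or.inl hperiod)
  · rintro ⟨t, -, rfl⟩
    exact sameComponent_altIter M M' x t

variable [Fintype X]

lemma hammingDist_interpolation_zero [DecidableEq X] (M M' : X → X) (x : X) :
    hammingDist (interpolation M M' x 0) M ≤ 3 := by
  refine (hammingDist_le_card {x, altIter M M' x 1} fun y hy => ?_).trans
    (Finset.card_le_two.trans (by norm_num))
  refine patch_of_notMem (innerPath_subset_outerPath M M' x 0) ?_
  rw [outerPath_eq]
  rintro (⟨t, ⟨ht_pos, ht_le⟩, -⟩ | hends)
  · omega
  · exact hy (by simpa using hends)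

lemma hammingDist_interpolation_succ [DecidableEq X] (M M' : X → X) (x : X) (j : ℕ) :
    hammingDist (interpolation M M' x j) (interpolation M M' x (j + 1)) ≤ 3 := by
  refine (hammingDist_le_card {altIter M M' x (2 * j + 1), altIter M M' x (2 * j + 2),
    altIter M M' x (2 * j + 3)} fun y hy => ?_).trans Finset.card_le_three
  simp only [Finset.mem_insert, Finset.mem_singleton, not_or] at hy
  obtain ⟨hne_one, hne_two, hne_three⟩ := hy
  have hinner : y ∈ innerPath M M' x (j + 1) ↔ y ∈ innerPath M M' x j := by
    constructor
    · rintro ⟨t, ⟨ht_pos, ht_le⟩, rfl⟩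
      have : t ≠ 2 * j + 1 := by rintro rfl; exact hne_one rfl
      have : t ≠ 2 * j + 2 := by rintro rfl; exact hne_two rfl
      exact ⟨t, ⟨ht_pos, by omega⟩, rfl⟩
    · rintro ⟨t, ⟨ht_pos, ht_le⟩, rfl⟩
      exact ⟨t, ⟨ht_pos, by omega⟩, rfl⟩
  have houter : y ∈ outerPath M M' x (j + 1) ↔ y ∈ outerPath M M' x j := by
    rw [outerPath_eq, outerPath_eq, Set.mem_union, Set.mem_union, hinner, Set.mem_insert_iff,
      Set.mem_insert_iff, Set.mem_singleton_iff, Set.mem_singleton_iff, Nat.mul_succ]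
    simp only [hne_one, hne_three]
  simp only [interpolation, patch, Set.piecewise, hinner, houter]

lemma hammingDist_interpolation_swapComponent [DecidableEq X]
    (hM : Function.Involutive M) (hM' : Function.Involutive M') (hj : halfPeriod M M' x = j + 1) :
    hammingDist (interpolation M M' x j) (swapComponent M M' x) ≤ 3 := by
  refine (hammingDist_le_card {x, altIter M M' x (2 * j + 1)} fun y hy => ?_).trans
    (Finset.card_le_two.trans (by norm_num))
  have hcomponent := sameComponent_iff_mem_outerPath (y := y) hM hM' hj
  rw [swapComponent, interpolation]
  by_cases hinner : y ∈ innerPath M M' x j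
  · rw [patch_of_mem hinner,
      Set.piecewise_eq_of_mem]
    exact hcomponent.2 (innerPath_subset_outerPath M M' x j hinner)
  · have houter : y ∉ outerPath M M' x j := by
      rw [outerPath_eq]
      exact fun h => h.elim hinner fun hends => hy (by simpa using hends)
    rw [patch_of_notMem (innerPath_subset_outerPath M M' x j) houter]
    exact (Set.piecewise_eq_of_notMem _ _ _ (mt hcomponent.1 houter)).symm

variable {Γ : X → X → Prop}

lemma outerPath_diff_innerPath (hM : M ∈ perfectMatchings Γ) (hM' : M' ∈ perfectMatchings Γ)
    (hj : j < halfPeriod M M' x) : x ≠ altIter M M' x (2 * j + 1) ∧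
      outerPath M M' x j \ innerPath M M' x j = {x, altIter M M' x (2 * j + 1)} := by
  rw [mem_perfectMatchings] at hM hM'
  have hinj := altIter_injOn (x := x) hM.1.1 hM'.1.1 hM.2 hM'.2
  have hne {s t : ℕ} (hs : s ≤ 2 * j + 1) (ht : t ≤ 2 * j + 1) (hst : s ≠ t) :
      altIter M M' x s ≠ altIter M M' x t :=
    hinj.ne (Set.mem_Iio.2 (by omega)) (Set.mem_Iio.2 (by omega)) hst
  refine ⟨hne (Nat.zero_le _) le_rfl (by omega), ?_⟩
  rw [outerPath_eq, Set.union_sdiff_left, sdiff_eq_left, Set.disjoint_left]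
  rintro _ (rfl | rfl) ⟨t, ⟨ht_pos, ht_le⟩, ht⟩
  · exact hne (s := t) (t := 0) (by omega) (by omega) (by omega) ht
  · exact hne (s := t) (by omega) le_rfl (by omega) ht

lemma interpolation_mem (hM : M ∈ perfectMatchings Γ) (hM' : M' ∈ perfectMatchings Γ)
    (hj : j < halfPeriod M M' x) : interpolation M M' x j ∈ nearPerfectMatchings Γ :=
  have ⟨hends, hdiff⟩ := outerPath_diff_innerPath hM hM' hj
  patch_mem_nearPerfectMatchings hM hM' (innerPath_mapsTo (mem_perfectMatchings.1 hM').1.1)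
    (outerPath_mapsTo (mem_perfectMatchings.1 hM).1.1) (innerPath_subset_outerPath M M' x j)
    hends hdiff

lemma coInterpolation_mem (hM : M ∈ perfectMatchings Γ) (hM' : M' ∈ perfectMatchings Γ)
    (hj : j < halfPeriod M M' x) : coInterpolation M M' x j ∈ nearPerfectMatchings Γ :=
  have ⟨hends, hdiff⟩ := outerPath_diff_innerPath hM hM' hj
  copatch_mem_nearPerfectMatchings hM hM' (innerPath_mapsTo (mem_perfectMatchings.1 hM').1.1)
    (outerPath_mapsTo (mem_perfectMatchings.1 hM).1.1) (innerPath_subset_outerPath M M' x j)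
    hends hdiff

variable [DecidableEq X]

/-- The sum of the squared differences of `F` over the near-perfect matchings close to `Z`. -/
def localSum (Γ : X → X → Prop) (F : (X → X) → ℝ) (Z : X → X) : ℝ :=
  ∑ Z' ∈ (nearPerfectMatchings Γ).filter fun Z' => hammingDist Z Z' ≤ 3, (F Z - F Z') ^ 2

lemma localSum_nonneg (F : (X → X) → ℝ) (Z : X → X) : 0 ≤ localSum Γ F Z :=
  Finset.sum_nonneg fun _ _ => sq_nonneg _

lemma sq_le_localSum (F : (X → X) → ℝ) {Z Z' : X → X} (hZ' : Z' ∈ nearPerfectMatchings Γ)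
    (hdist : hammingDist Z Z' ≤ 3) : (F Z - F Z') ^ 2 ≤ localSum Γ F Z :=
  Finset.single_le_sum (f := fun Z' => (F Z - F Z') ^ 2) (fun _ _ => sq_nonneg _)
    (Finset.mem_filter.2 ⟨hZ', hdist⟩)

lemma sq_sub_interpolation_le (F : (X → X) → ℝ) (hM : M ∈ perfectMatchings Γ)
    (hM' : M' ∈ perfectMatchings Γ) (hj : j < halfPeriod M M' x) :
    (F (interpolation M M' x 0) - F (interpolation M M' x j)) ^ 2 ≤
      j * ∑ t ∈ Finset.range j, localSum Γ F (interpolation M M' x t) := by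
  refine (sq_sub_le_mul_sum_sq (fun t => F (interpolation M M' x t)) j).trans ?_
  gcongr with t ht
  exact sq_le_localSum F
    (interpolation_mem hM hM' ((Nat.succ_le_of_lt (Finset.mem_range.1 ht)).trans_lt hj))
    (hammingDist_interpolation_succ M M' x t)

lemma sq_sub_swapComponent_le (F : (X → X) → ℝ) (hM : M ∈ perfectMatchings Γ)
    (hM' : M' ∈ perfectMatchings Γ) :
    (F M - F (swapComponent M M' x)) ^ 2 ≤ 3 * (Fintype.card X + 2) *
      ∑ j ∈ Finset.range (halfPeriod M M' x), localSum Γ F (interpolation M M' x j) := by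
  have ⟨⟨hinv, _⟩, _⟩ := mem_perfectMatchings.1 hM
  have ⟨⟨hinv', _⟩, _⟩ := mem_perfectMatchings.1 hM'
  obtain ⟨l, hl⟩ := Nat.exists_eq_add_one.2 (halfPeriod_pos (x := x) hinv hinv')
  set S := ∑ j ∈ Finset.range (halfPeriod M M' x), localSum Γ F (interpolation M M' x j)
  have hlocal {j} (hj : j < halfPeriod M M' x) : localSum Γ F (interpolation M M' x j) ≤ S :=
    Finset.single_le_sum (f := fun j => localSum Γ F (interpolation M M' x j))
      (fun _ _ => localSum_nonneg F _) (Finset.mem_range.2 hj)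
  have hstart : (F (interpolation M M' x 0) - F M) ^ 2 ≤ S :=
    (sq_le_localSum F (perfectMatchings_subset_nearPerfectMatchings Γ hM)
      (hammingDist_interpolation_zero M M' x)).trans (hlocal (by omega))
  have hmiddle : (F (interpolation M M' x 0) - F (interpolation M M' x l)) ^ 2 ≤
      Fintype.card X * S := by
    refine (sq_sub_interpolation_le F hM hM' (by omega)).trans ?_
    have hle : l ≤ halfPeriod M M' x := by omega
    gcongr
    · exact Finset.sum_nonneg fun _ _ => localSum_nonneg F _
    · exact hle.trans Function.minimalPeriod_le_card
    · exact Finset.sum_le_sum_of_subset_of_nonneg (Finset.range_mono hle)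
        fun _ _ _ => localSum_nonneg F _
  have hend : (F (interpolation M M' x l) - F (swapComponent M M' x)) ^ 2 ≤ S :=
    (sq_le_localSum F (perfectMatchings_subset_nearPerfectMatchings Γ
      (swapComponent_mem_perfectMatchings hM hM' x))
      (hammingDist_interpolation_swapComponent hinv hinv' hl)).trans (hlocal (by omega))
  have hthree (a b c e : ℝ) : (a - e) ^ 2 ≤ 3 * ((b - a) ^ 2 + (b - c) ^ 2 + (c - e) ^ 2) := by
    nlinarith [sq_nonneg ((a - b) - (b - c)), sq_nonneg ((b - c) - (c - e)),
      sq_nonneg ((a - b) - (c - e))]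
  linarith [hthree (F M) (F (interpolation M M' x 0)) (F (interpolation M M' x l))
    (F (swapComponent M M' x))]

lemma sum_localSum_interpolation_le (F : (X → X) → ℝ) (x : X) (j : ℕ) :
    ∑ p ∈ (perfectMatchings Γ ×ˢ perfectMatchings Γ).filter (fun p => j < halfPeriod p.1 p.2 x),
        localSum Γ F (interpolation p.1 p.2 x j) ≤
      Fintype.card X ^ 3 * (nearPerfectMatchings Γ).card *
        ∑ Z ∈ nearPerfectMatchings Γ, localSum Γ F Z := by
  set T := (perfectMatchings Γ ×ˢ perfectMatchings Γ).filter fun p => j < halfPeriod p.1 p.2 x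
  have hperfect {p} (hp : p ∈ T) : p.1 ∈ perfectMatchings Γ ∧ p.2 ∈ perfectMatchings Γ :=
    Finset.mem_product.1 (Finset.mem_filter.1 hp).1
  have hinj : Set.InjOn (pathCode x j) T := fun p hp q hq hcode =>
    Prod.ext_iff.2 (eq_of_pathCode_eq (mem_perfectMatchings.1 (hperfect hp).1).1.1
      (mem_perfectMatchings.1 (hperfect hq).1).1.1 hcode)
  have hsub : T.image (pathCode x j) ⊆
      nearPerfectMatchings Γ ×ˢ nearPerfectMatchings Γ ×ˢ (Finset.univ : Finset (X × X × X)) := by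
    refine Finset.image_subset_iff.2 fun p hp => ?_
    have ⟨hM, hM'⟩ := hperfect hp
    have hj := (Finset.mem_filter.1 hp).2
    simp only [pathCode, Finset.mem_product, Finset.mem_univ, and_true]
    exact ⟨interpolation_mem hM hM' hj, coInterpolation_mem hM hM' hj⟩
  calc _ = ∑ c ∈ T.image (pathCode x j), localSum Γ F c.1 := (Finset.sum_image hinj).symm
    _ ≤ ∑ c ∈ nearPerfectMatchings Γ ×ˢ nearPerfectMatchings Γ ×ˢ
          (Finset.univ : Finset (X × X × X)), localSum Γ F c.1 :=
        Finset.sum_le_sum_of_subset_of_nonneg hsub fun c _ _ => localSum_nonneg F _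
    _ = _ := by
        rw [Finset.sum_product]
        simp only [Finset.sum_const, Finset.card_product, Finset.card_univ, Fintype.card_prod,
          nsmul_eq_mul, ← Finset.mul_sum]
        push_cast
        ring

lemma sum_sq_sub_swapComponent_le (F : (X → X) → ℝ) (x : X) :
    ∑ p ∈ perfectMatchings Γ ×ˢ perfectMatchings Γ, (F p.1 - F (swapComponent p.1 p.2 x)) ^ 2 ≤
      3 * (Fintype.card X + 2) * Fintype.card X ^ 4 * (nearPerfectMatchings Γ).card *
        ∑ Z ∈ nearPerfectMatchings Γ, localSum Γ F Z := by
  set N := Fintype.card X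
  let P := perfectMatchings Γ ×ˢ perfectMatchings Γ
  calc _ ≤ ∑ p ∈ P, 3 * ((N : ℝ) + 2) * ∑ j ∈ Finset.range (halfPeriod p.1 p.2 x),
          localSum Γ F (interpolation p.1 p.2 x j) := by
        refine Finset.sum_le_sum fun p hp => ?_
        exact sq_sub_swapComponent_le F (Finset.mem_product.1 hp).1 (Finset.mem_product.1 hp).2
    _ = 3 * ((N : ℝ) + 2) * ∑ j ∈ Finset.range N, ∑ p ∈ P with j < halfPeriod p.1 p.2 x,
          localSum Γ F (interpolation p.1 p.2 x j) := by
        rw [← Finset.mul_sum]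
        congr 1
        refine Finset.sum_comm' fun p j => ?_
        have hle : halfPeriod p.1 p.2 x ≤ N := Function.minimalPeriod_le_card
        simp only [Finset.mem_filter, Finset.mem_range]
        exact ⟨fun h => ⟨h, h.2.trans_le hle⟩, And.left⟩
    _ ≤ 3 * ((N : ℝ) + 2) * ∑ _j ∈ Finset.range N, (N : ℝ) ^ 3 * (nearPerfectMatchings Γ).card *
          ∑ Z ∈ nearPerfectMatchings Γ, localSum Γ F Z := by
        gcongr with j _
        exact sum_localSum_interpolation_le F x j
    _ = _ := by
        rw [Finset.sum_const, Finset.card_range, nsmul_eq_mul]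
        ring

theorem sum_perfectMatchings_sq_le_sum_localSum (Γ : X → X → Prop) (F : (X → X) → ℝ) :
    ∑ p ∈ perfectMatchings Γ ×ˢ perfectMatchings Γ, (F p.1 - F p.2) ^ 2 ≤
      3 * (Fintype.card X + 2) * Fintype.card X ^ 7 * (nearPerfectMatchings Γ).card *
        ∑ Z ∈ nearPerfectMatchings Γ, localSum Γ F Z := by
  refine (sum_perfectMatchings_sq_le F).trans ?_
  refine (mul_le_mul_of_nonneg_left (Finset.sum_le_sum fun x _ => sum_sq_sub_swapComponent_le F x)
    (by positivity)).trans (le_of_eq ?_)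
  rw [Finset.sum_const, Finset.card_univ, nsmul_eq_mul]
  ring

end Interpolation

/-! ### Graphs with nearly the prescribed degrees -/

section Repair

variable {V : Type*} [Fintype V] {d : V → ℕ} {c₁ c₂ m : ℕ} {G : SimpleGraph V} {a b : V}

lemma exists_not_adj_of_intDegree_lt (hb : intDegree G b < (Fintype.card V : ℤ) - 1) :
    ∃ w, b ≠ w ∧ ¬ G.Adj b w := by
  by_contra! hadj
  have huniv : G.neighborFinset b = Finset.univ.erase b := by
    ext w
    simp only [SimpleGraph.mem_neighborFinset, Finset.mem_erase, Finset.mem_univ, and_true]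
    exact ⟨fun h => h.ne', fun h => hadj w h.symm⟩
  rw [intDegree_eq_degree, ← SimpleGraph.card_neighborFinset_eq_degree, huniv,
    Finset.card_erase_of_mem (Finset.mem_univ _), Finset.card_univ] at hb
  have := Fintype.card_pos_iff.2 ⟨b⟩
  omega

namespace CornerBound

lemma exists_near_of_add_add (hd : CornerBound d c₁ c₂ m)
    (hG : ∀ x, intDegree G x = d x + (if x = a then 1 else 0) + (if x = b then 1 else 0)) :
    ∃ H : SimpleGraph V, (∀ x, intDegree H x = d x) ∧ edgeDist G H ≤ 22 := by
  obtain ⟨W, -, -, hW⟩ := hd.hasRelievingWalk hG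
  exact ⟨_, fun x => by rw [hW, hG]; ring, edgeDist_trailGraph_le G W 11⟩

lemma exists_near_of_add_sub (hd : CornerBound d c₁ c₂ m)
    (hG : ∀ x, intDegree G x = d x + (if x = a then 1 else 0) - (if x = b then 1 else 0)) :
    ∃ H : SimpleGraph V, (∀ x, intDegree H x = d x) ∧ edgeDist G H ≤ 24 := by
  rcases eq_or_ne a b with rfl | hab
  · exact ⟨G, fun x => by rw [hG]; ring, (edgeDist_eq_zero.2 rfl).trans_le (Nat.zero_le _)⟩
  obtain ⟨w, hbw, hadj⟩ : ∃ w, b ≠ w ∧ ¬ G.Adj b w := by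
    refine exists_not_adj_of_intDegree_lt ?_
    have := hd.upper b
    have := hd.lt
    rw [hG, if_neg hab.symm, if_pos rfl]
    omega
  obtain ⟨H, hH, hdist⟩ := hd.exists_near_of_add_add (G := G ∆ SimpleGraph.edge b w) (a := a)
    (b := w) (fun x => by rw [intDegree_symmDiff_edge G hbw, hG, if_neg hadj]; ring)
  have := edgeDist_triangle G (G ∆ SimpleGraph.edge b w) H
  have := edgeDist_edge_le G b w
  exact ⟨H, hH, by omega⟩

lemma exists_near_of_sub_sub (hd : CornerBound d c₁ c₂ m)
    (hG : ∀ x, intDegree G x = d x - (if x = a then 1 else 0) - (if x = b then 1 else 0)) :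
    ∃ H : SimpleGraph V, (∀ x, intDegree H x = d x) ∧ edgeDist G H ≤ 26 := by
  obtain ⟨w, hbw, hadj⟩ : ∃ w, b ≠ w ∧ ¬ G.Adj b w := by
    refine exists_not_adj_of_intDegree_lt ?_
    have := hd.upper b
    have := hd.lt
    rw [hG, if_pos (rfl : b = b)]
    split_ifs <;> omega
  obtain ⟨H, hH, hdist⟩ := hd.exists_near_of_add_sub (G := G ∆ SimpleGraph.edge b w) (a := w)
    (b := a) fun x => by rw [intDegree_symmDiff_edge G hbw, hG, if_neg hadj]; ring
  have := edgeDist_triangle G (G ∆ SimpleGraph.edge b w) H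
  have := edgeDist_edge_le G b w
  exact ⟨H, hH, by omega⟩

end CornerBound

end Repair

/-! ### The matching gadget -/

section Gadget

variable {n : ℕ} (d : Fin n → ℕ)

/-- The elements of the matching gadget for the degree sequence `d`: a stub for each ordered pair
of vertices, and `n - d v` cores at each vertex `v`. The loop stubs `(v, v)` are included, so that
in a perfect matching exactly `d v` of the `n` stubs at `v` avoid the cores. -/
abbrev Gadget : Type := (Fin n × Fin n) ⊕ Σ v, Fin (n - d v)

/-- The edges of the matching gadget: a stub may be matched to its reverse or to a core at its
tail. -/
def gadgetRel : Gadget d → Gadget d → Prop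
  | Sum.inl p, Sum.inl q => p.1 ≠ p.2 ∧ q = p.swap
  | Sum.inl p, Sum.inr c => c.1 = p.1
  | Sum.inr c, Sum.inl p => c.1 = p.1
  | Sum.inr _, Sum.inr _ => False

variable {d}

/-- The graph formed by the pairs whose stubs are matched to each other. -/
def gadgetGraph (Z : Gadget d → Gadget d) : SimpleGraph (Fin n) where
  Adj v u := v ≠ u ∧ Z (Sum.inl (v, u)) = Sum.inl (u, v) ∧ Z (Sum.inl (u, v)) = Sum.inl (v, u)
  symm := ⟨fun _ _ h => ⟨h.1.symm, h.2.2, h.2.1⟩⟩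
  loopless := ⟨fun _ h => h.1 rfl⟩

namespace IsMatching

variable {Z : Gadget d → Gadget d}

lemma gadgetGraph_adj (hZ : IsMatching (gadgetRel d) Z) {v u : Fin n} :
    (gadgetGraph Z).Adj v u ↔ v ≠ u ∧ Z (Sum.inl (v, u)) = Sum.inl (u, v) :=
  ⟨fun h => ⟨h.1, h.2.1⟩, fun h => ⟨h.1, h.2, by rw [← h.2, hZ.1]⟩⟩

lemma stub_cases (hZ : IsMatching (gadgetRel d) Z) (v u : Fin n) :
    Z (Sum.inl (v, u)) = Sum.inl (v, u) ∨ (gadgetGraph Z).Adj v u ∨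
      ∃ i, Z (Sum.inl (v, u)) = Sum.inr ⟨v, i⟩ := by
  refine or_iff_not_imp_left.2 fun hfixed => ?_
  have hrel := hZ.2 _ hfixed
  match hmate : Z (Sum.inl (v, u)) with
  | Sum.inl q =>
    rw [hmate] at hrel
    obtain ⟨hne, rfl⟩ := hrel
    exact Or.inl (hZ.gadgetGraph_adj.2 ⟨hne, hmate⟩)
  | Sum.inr ⟨w, i⟩ =>
    rw [hmate] at hrel
    obtain rfl : w = v := hrel
    exact Or.inr ⟨i, rfl⟩

lemma core_cases (hZ : IsMatching (gadgetRel d) Z) (v : Fin n) (i : Fin (n - d v)) :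
    Z (Sum.inr ⟨v, i⟩) = Sum.inr ⟨v, i⟩ ∨ ∃ u, Z (Sum.inr ⟨v, i⟩) = Sum.inl (v, u) := by
  refine or_iff_not_imp_left.2 fun hfixed => ?_
  have hrel := hZ.2 _ hfixed
  match hmate : Z (Sum.inr ⟨v, i⟩) with
  | Sum.inl (w, u) =>
    rw [hmate] at hrel
    obtain rfl : v = w := hrel
    exact ⟨u, rfl⟩
  | Sum.inr c =>
    rw [hmate] at hrel
    exact hrel.elim

lemma stub_count (hZ : IsMatching (gadgetRel d) Z) (v u : Fin n) :
    (if (gadgetGraph Z).Adj v u then 1 else 0) +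
      (if Z (Sum.inl (v, u)) = Sum.inl (v, u) then 1 else 0) +
      ∑ i, (if Z (Sum.inl (v, u)) = Sum.inr ⟨v, i⟩ then 1 else 0) = 1 := by
  rw [hZ.gadgetGraph_adj]
  rcases hZ.stub_cases v u with hfixed | hadj | ⟨i, hi⟩
  · simp +contextual [hfixed]
  · simp [hZ.gadgetGraph_adj.1 hadj]
  · simp [hi]

lemma core_count (hZ : IsMatching (gadgetRel d) Z) (v : Fin n) (i : Fin (n - d v)) :
    (if Z (Sum.inr ⟨v, i⟩) = Sum.inr ⟨v, i⟩ then 1 else 0) +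
      ∑ u, (if Z (Sum.inl (v, u)) = Sum.inr ⟨v, i⟩ then 1 else 0) = 1 := by
  simp only [hZ.1.eq_iff (x := Sum.inl _)]
  rcases hZ.core_cases v i with hfixed | ⟨u, hu⟩
  · simp [hfixed]
  · simp [hu]

lemma degree_add (hZ : IsMatching (gadgetRel d) Z) {v : Fin n} (hv : d v ≤ n) :
    (gadgetGraph Z).degree v +
      (Finset.univ.filter fun u => Z (Sum.inl (v, u)) = Sum.inl (v, u)).card =
    d v + (Finset.univ.filter fun i => Z (Sum.inr ⟨v, i⟩) = Sum.inr ⟨v, i⟩).card := by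
  have hstubs := Finset.sum_congr (rfl : (Finset.univ : Finset (Fin n)) = _)
    fun u _ => hZ.stub_count v u
  have hcores := Finset.sum_congr (rfl : (Finset.univ : Finset (Fin (n - d v))) = _)
    fun i _ => hZ.core_count v i
  rw [Finset.sum_add_distrib, Finset.sum_comm] at hcores
  rw [Finset.sum_add_distrib, Finset.sum_add_distrib] at hstubs
  simp only [Finset.sum_boole, Nat.cast_id, Finset.sum_const, Finset.card_univ, Fintype.card_fin,
    smul_eq_mul, mul_one] at hstubs hcores
  rw [← SimpleGraph.card_neighborFinset_eq_degree, SimpleGraph.neighborFinset_eq_filter]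
  omega

end IsMatching

variable {H : SimpleGraph (Fin n)}

/-- The perfect matching of the gadget given by a graph and an assignment of the cores to the
non-neighbours. -/
def gadgetLift (H : SimpleGraph (Fin n)) (g : ∀ v, Fin (n - d v) ≃ {u // ¬ H.Adj v u}) :
    Gadget d → Gadget d
  | Sum.inl p => if h : H.Adj p.1 p.2 then Sum.inl p.swap
      else Sum.inr ⟨p.1, (g p.1).symm ⟨p.2, h⟩⟩
  | Sum.inr c => Sum.inl (c.1, g c.1 c.2)

lemma gadgetLift_mem_perfectMatchings (g : ∀ v, Fin (n - d v) ≃ {u // ¬ H.Adj v u}) :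
    gadgetLift H g ∈ perfectMatchings (gadgetRel d) := by
  rw [mem_perfectMatchings]
  refine ⟨⟨?_, ?_⟩, ?_⟩
  · rintro (⟨v, u⟩ | ⟨v, i⟩)
    · by_cases hadj : H.Adj v u
      · simp [gadgetLift, hadj, hadj.symm]
      · simp [gadgetLift, hadj]
    · simp [gadgetLift, (g v i).2]
  · rintro (⟨v, u⟩ | ⟨v, i⟩) -
    · by_cases hadj : H.Adj v u
      · simp [gadgetLift, hadj, gadgetRel, hadj.ne]
      · simp [gadgetLift, hadj, gadgetRel]
    · simp [gadgetLift, gadgetRel]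
  · rintro (⟨v, u⟩ | ⟨v, i⟩)
    · by_cases hadj : H.Adj v u
      · simp [gadgetLift, hadj, hadj.ne']
      · simp [gadgetLift, hadj]
    · simp [gadgetLift]

lemma gadgetGraph_gadgetLift (g : ∀ v, Fin (n - d v) ≃ {u // ¬ H.Adj v u}) :
    gadgetGraph (gadgetLift H g) = H := by
  ext v u
  rw [(mem_perfectMatchings.1 (gadgetLift_mem_perfectMatchings g)).1.gadgetGraph_adj]
  by_cases hadj : H.Adj v u
  · simp [gadgetLift, hadj, hadj.ne]
  · simp [gadgetLift, hadj]

lemma gadgetLift_injective (H : SimpleGraph (Fin n)) :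
    Function.Injective (gadgetLift (d := d) H) := by
  intro g g' heq
  funext v
  ext i
  have hcore := congrFun heq (Sum.inr ⟨v, i⟩)
  simp only [gadgetLift, Sum.inl.injEq, Prod.mk.injEq, true_and] at hcore
  exact congrArg Fin.val hcore

lemma card_not_adj (hH : ∀ x, intDegree H x = d x) (v : Fin n) :
    Fintype.card {u // ¬ H.Adj v u} = n - d v := by
  have hdeg := hH v
  rw [intDegree_eq_degree, Nat.cast_inj, ← SimpleGraph.card_neighborFinset_eq_degree,
    SimpleGraph.neighborFinset_eq_filter] at hdeg
  rw [Fintype.card_subtype_compl, Fintype.card_fin, Fintype.card_subtype, hdeg]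

variable {Z : Gadget d → Gadget d}

lemma exists_equiv_not_adj (hH : ∀ x, intDegree H x = d x) (hZ : Function.Involutive Z)
    (v : Fin n) : ∃ g : Fin (n - d v) ≃ {u // ¬ H.Adj v u},
      ∀ i u, Z (Sum.inr ⟨v, i⟩) = Sum.inl (v, u) → ¬ H.Adj v u → g i = u := by
  let s : Set (Fin (n - d v)) := {i | ∃ u, Z (Sum.inr ⟨v, i⟩) = Sum.inl (v, u) ∧ ¬ H.Adj v u}
  let f : Fin (n - d v) → Fin n := fun i => (Z (Sum.inr ⟨v, i⟩)).elim Prod.snd Sigma.fst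
  have hf {i u} (hi : Z (Sum.inr ⟨v, i⟩) = Sum.inl (v, u)) : f i = u := by
    simp only [f, hi, Sum.elim_inl]
  have hmaps : s.MapsTo f ({u | ¬ H.Adj v u} : Finset (Fin n)) := by
    rintro i ⟨u, hi, hadj⟩
    simpa [hf hi] using hadj
  have hinj : s.InjOn f := by
    rintro i ⟨u, hi, -⟩ i' ⟨u', hi', -⟩ heq
    rw [hf hi, hf hi'] at heq
    subst heq
    simpa using hZ.injective (hi.trans hi'.symm)
  obtain ⟨g, hg⟩ := hmaps.exists_equiv_extend_of_card_eq
    (by rw [Fintype.card_fin, ← card_not_adj hH v, Fintype.card_subtype]) hinj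
  refine ⟨g.trans (Equiv.subtypeEquivRight (by simp)), fun i u hi hadj => ?_⟩
  exact (hg i ⟨u, hi, hadj⟩).trans (hf hi)

lemma exists_gadgetLift (hH : ∀ x, intDegree H x = d x) (hZ : IsMatching (gadgetRel d) Z) :
    ∃ g, ∀ x, Z x ≠ gadgetLift H g x → Z x = x ∨
      ∃ p, adjFun (gadgetGraph Z) p ≠ adjFun H p ∧ (x = Sum.inl p ∨ Z x = Sum.inl p) := by
  choose g hg using exists_equiv_not_adj hH hZ.1
  refine ⟨g, ?_⟩
  rintro (⟨v, u⟩ | ⟨v, i⟩) hne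
  · by_cases hagree : (gadgetGraph Z).Adj v u ↔ H.Adj v u
    · left
      rcases hZ.stub_cases v u with hfixed | hadj | ⟨i, hi⟩
      · exact hfixed
      · exact absurd (by simp [gadgetLift, hagree.1 hadj, hadj.2.1]) hne
      · have hadj : ¬ H.Adj v u := fun h => by simpa [hi] using (hagree.2 h).2.1
        refine absurd ?_ hne
        simp [gadgetLift, hadj, hi, Equiv.eq_symm_apply, Subtype.ext_iff,
          hg v i u (by rw [← hi, hZ.1]) hadj]
    · exact Or.inr ⟨(v, u), fun h => hagree (iff_of_eq h), Or.inl rfl⟩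
  · rcases hZ.core_cases v i with hfixed | ⟨u, hu⟩
    · exact Or.inl hfixed
    · by_cases hadj : H.Adj v u
      · refine Or.inr ⟨(v, u), fun h => ?_, Or.inr hu⟩
        have hstub := ((iff_of_eq h).2 hadj).2.1
        rw [← hu, hZ.1] at hstub
        exact Sum.inr_ne_inl hstub
      · exact absurd (by simp [gadgetLift, hu, hg v i u hu hadj]) hne

end Gadget

section NearPerfect

variable {n : ℕ} {d : Fin n → ℕ} {c₁ c₂ m : ℕ}

/-- The contribution of an unmatched element of the gadget to the excess degree of the vertex `x`:
an unmatched core leaves a stub to the graph, an unmatched stub is lost for it. -/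
def excess (x : Fin n) : Gadget d → ℤ :=
  Sum.elim (fun p => if x = p.1 then -1 else 0) (fun c => if x = c.1 then 1 else 0)

lemma IsMatching.intDegree_gadgetGraph {Z : Gadget d → Gadget d} (hZ : IsMatching (gadgetRel d) Z)
    {x : Fin n} (hx : d x ≤ n) :
    intDegree (gadgetGraph Z) x = d x + ∑ a with Z a = a, excess x a := by
  have hstubs : ∑ p : Fin n × Fin n, (if Z (Sum.inl p) = Sum.inl p then
      excess x (Sum.inl p : Gadget d) else 0) =
      -(Finset.univ.filter fun u => Z (Sum.inl (x, u)) = Sum.inl (x, u)).card := by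
    rw [Fintype.sum_prod_type, Fintype.sum_eq_single x fun v hv => by simp [excess, hv.symm]]
    simp [excess, ← Finset.sum_filter]
  have hcores : ∑ c : Σ v, Fin (n - d v), (if Z (Sum.inr c) = Sum.inr c then
      excess x (Sum.inr c) else 0) =
      (Finset.univ.filter fun i => Z (Sum.inr ⟨x, i⟩) = Sum.inr ⟨x, i⟩).card := by
    rw [Fintype.sum_sigma, Fintype.sum_eq_single x fun v hv => by simp [excess, hv.symm]]
    simp [excess]
  have hdeg := hZ.degree_add hx
  rw [Finset.sum_filter, Fintype.sum_sum_type, hstubs, hcores, intDegree_eq_degree]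
  omega

lemma intDegree_gadgetGraph_of_perfect (hd : ∀ v, d v ≤ n) {M : Gadget d → Gadget d}
    (hM : M ∈ perfectMatchings (gadgetRel d)) (v : Fin n) :
    intDegree (gadgetGraph M) v = d v := by
  rw [mem_perfectMatchings] at hM
  rw [hM.1.intDegree_gadgetGraph (hd v)]
  simp only [hM.2, Finset.filter_false, Finset.sum_empty, add_zero]

lemma CornerBound.le_card (hd : CornerBound d c₁ c₂ m) (v : Fin n) : d v ≤ n :=
  (hd.upper v).trans (by simpa using hd.lt.le)

lemma CornerBound.exists_near_gadgetGraph (hd : CornerBound d c₁ c₂ m) {Z : Gadget d → Gadget d}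
    (hZ : Z ∈ nearPerfectMatchings (gadgetRel d)) :
    ∃ H, (∀ x, intDegree H x = d x) ∧ edgeDist (gadgetGraph Z) H ≤ 26 := by
  obtain ⟨hmatching, hempty | ⟨a, b, hab, hpair⟩⟩ := mem_nearPerfectMatchings.1 hZ
  · refine ⟨gadgetGraph Z, intDegree_gadgetGraph_of_perfect hd.le_card
      (mem_perfectMatchings.2 ⟨hmatching, Set.eq_empty_iff_forall_notMem.1 hempty⟩), ?_⟩
    rw [edgeDist_eq_zero.2 rfl]
    exact Nat.zero_le _
  have hfixed : (Finset.univ.filter fun x => Z x = x) = {a, b} := by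
    ext x
    simpa [Function.IsFixedPt] using Set.ext_iff.1 hpair x
  have hdeg (x) : intDegree (gadgetGraph Z) x = d x + (excess x a + excess x b) := by
    rw [hmatching.intDegree_gadgetGraph (hd.le_card x), hfixed, Finset.sum_pair hab]
  rcases a with p | c <;> rcases b with p' | c' <;>
    simp only [excess, Sum.elim_inl, Sum.elim_inr] at hdeg
  · exact hd.exists_near_of_sub_sub (a := p.1) (b := p'.1) fun x => by
      rw [hdeg]; split_ifs <;> ring
  · obtain ⟨H, hH, hdist⟩ := hd.exists_near_of_add_sub (G := gadgetGraph Z) (a := c'.1) (b := p.1)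
      fun x => by rw [hdeg]; split_ifs <;> ring
    exact ⟨H, hH, hdist.trans (by norm_num)⟩
  · obtain ⟨H, hH, hdist⟩ := hd.exists_near_of_add_sub (G := gadgetGraph Z) (a := c.1) (b := p'.1)
      fun x => by rw [hdeg]; split_ifs <;> ring
    exact ⟨H, hH, hdist.trans (by norm_num)⟩
  · obtain ⟨H, hH, hdist⟩ := hd.exists_near_of_add_add (G := gadgetGraph Z) (a := c.1) (b := c'.1)
      fun x => by rw [hdeg]; split_ifs <;> ring
    exact ⟨H, hH, hdist.trans (by norm_num)⟩

lemma card_fixedPoints_le_two {X : Type*} [Fintype X] [DecidableEq X] {Γ : X → X → Prop} {Z : X → X}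
    (hZ : Z ∈ nearPerfectMatchings Γ) : (Finset.univ.filter fun x => Z x = x).card ≤ 2 := by
  obtain ⟨-, hempty | ⟨a, b, -, hpair⟩⟩ := mem_nearPerfectMatchings.1 hZ
  · have hfixed : (Finset.univ.filter fun x => Z x = x) = ∅ := by
      ext x
      simpa [Function.IsFixedPt] using Set.ext_iff.1 hempty x
    simp [hfixed]
  · have hfixed : (Finset.univ.filter fun x => Z x = x) = {a, b} := by
      ext x
      simpa [Function.IsFixedPt] using Set.ext_iff.1 hpair x
    exact hfixed ▸ Finset.card_le_two

lemma CornerBound.exists_near_perfectMatching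
    (hd : CornerBound d c₁ c₂ m) {Z : Gadget d → Gadget d}
    (hZ : Z ∈ nearPerfectMatchings (gadgetRel d)) :
    ∃ M ∈ perfectMatchings (gadgetRel d), hammingDist Z M ≤ 54 := by
  obtain ⟨H, hH, hdist⟩ := hd.exists_near_gadgetGraph hZ
  have hmatching := (mem_nearPerfectMatchings.1 hZ).1
  obtain ⟨g, hg⟩ := exists_gadgetLift hH hmatching
  refine ⟨gadgetLift H g, gadgetLift_mem_perfectMatchings g, ?_⟩
  let P : Finset (Gadget d) := (Finset.univ.filter fun p =>
    adjFun (gadgetGraph Z) p ≠ adjFun H p).image Sum.inl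
  let F : Finset (Gadget d) := Finset.univ.filter fun x => Z x = x
  have hP : P.card ≤ 26 := Finset.card_image_le.trans hdist
  have hF : F.card ≤ 2 := card_fixedPoints_le_two hZ
  have hPZ : (P.image Z).card ≤ P.card := Finset.card_image_le
  refine (hammingDist_le_card (F ∪ (P ∪ P.image Z)) fun x hx => ?_).trans
    ((Finset.card_union_le _ _).trans (by have := Finset.card_union_le P (P.image Z); omega))
  by_contra hne
  refine hx ?_
  simp only [F, P, Finset.mem_union, Finset.mem_image, Finset.mem_filter_univ]
  rcases hg x hne with hfixed | ⟨p, hp, rfl | hstub⟩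
  · exact Or.inl hfixed
  · exact Or.inr (Or.inl ⟨p, hp, rfl⟩)
  · exact Or.inr (Or.inr ⟨Sum.inl p, ⟨p, hp, rfl⟩, by rw [← hstub, hmatching.1]⟩)

lemma edgeDist_gadgetGraph_le {M M' : Gadget d → Gadget d}
    (hM : IsMatching (gadgetRel d) M) (hM' : IsMatching (gadgetRel d) M') :
    edgeDist (gadgetGraph M) (gadgetGraph M') ≤ hammingDist M M' := by
  refine Finset.card_le_card_of_injOn (fun p => (Sum.inl p : Gadget d)) ?_
    Sum.inl_injective.injOn
  rintro ⟨v, u⟩ hp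
  rw [Finset.mem_coe, Finset.mem_filter_univ] at hp ⊢
  refine fun heq => hp (propext ?_)
  change (gadgetGraph M).Adj v u ↔ (gadgetGraph M').Adj v u
  rw [hM.gadgetGraph_adj, hM'.gadgetGraph_adj, heq]

variable (d) in
lemma card_gadget_le : Fintype.card (Gadget d) ≤ 2 * n ^ 2 := by
  have hcores : ∑ v, (n - d v) ≤ n * n := by
    simpa using Finset.sum_le_card_nsmul Finset.univ (fun v => n - d v) n fun v _ => Nat.sub_le _ _
  rw [Fintype.card_sum, Fintype.card_prod, Fintype.card_sigma]
  simp only [Fintype.card_fin]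
  linarith

variable (d) in
/-- The number of perfect matchings of the gadget that lift a given realization of `d`. -/
def liftCount : ℕ := ∏ v, (n - d v).factorial

lemma liftCount_pos : 0 < liftCount d := Finset.prod_pos fun _ _ => Nat.factorial_pos _

lemma card_perfectMatchings_gadgetGraph_eq {H : SimpleGraph (Fin n)}
    (hH : ∀ x, intDegree H x = d x) :
    ((perfectMatchings (gadgetRel d)).filter fun M => gadgetGraph M = H).card = liftCount d := by
  have hlifts : ((perfectMatchings (gadgetRel d)).filter fun M => gadgetGraph M = H) =
      Finset.univ.image (gadgetLift (d := d) H) := by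
    ext M
    rw [Finset.mem_filter, Finset.mem_image]
    constructor
    · rintro ⟨hM, rfl⟩
      rw [mem_perfectMatchings] at hM
      obtain ⟨g, hg⟩ := exists_gadgetLift hH hM.1
      refine ⟨g, Finset.mem_univ _, funext fun x => ?_⟩
      by_contra hne
      rcases hg x (Ne.symm hne) with hfixed | ⟨p, hp, -⟩
      · exact hM.2 x hfixed
      · exact hp rfl
    · rintro ⟨g, -, rfl⟩
      exact ⟨gadgetLift_mem_perfectMatchings g, gadgetGraph_gadgetLift g⟩
  rw [hlifts, Finset.card_image_of_injective _ (gadgetLift_injective H), Finset.card_univ,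
    Fintype.card_pi]
  refine Finset.prod_congr rfl fun v _ => ?_
  have hcard : Fintype.card (Fin (n - d v)) = Fintype.card {u // ¬ H.Adj v u} := by
    rw [Fintype.card_fin, card_not_adj hH]
  rw [Fintype.card_equiv (Fintype.equivOfCardEq hcard), Fintype.card_fin]

lemma sum_perfectMatchings_gadgetGraph (hd : ∀ v, d v ≤ n) (φ : SimpleGraph (Fin n) → ℝ) :
    ∑ M ∈ perfectMatchings (gadgetRel d), φ (gadgetGraph M) =
      liftCount d * ∑ H : Realization d, φ H.1 := by
  have hmaps : ∀ M ∈ perfectMatchings (gadgetRel d), gadgetGraph M ∈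
      (Finset.univ : Finset (Realization d)).image Subtype.val := fun M hM =>
    Finset.mem_image.2 ⟨Realization.ofIntDegree _ (intDegree_gadgetGraph_of_perfect hd hM),
      Finset.mem_univ _, rfl⟩
  rw [← Finset.sum_fiberwise_of_maps_to hmaps, Finset.sum_image Subtype.val_injective.injOn,
    Finset.mul_sum]
  refine Finset.sum_congr rfl fun H _ => ?_
  rw [Finset.sum_congr rfl (g := fun _ => φ H.1)
    (fun M hM => by rw [(Finset.mem_filter.1 hM).2]), Finset.sum_const, nsmul_eq_mul,
    card_perfectMatchings_gadgetGraph_eq (Realization.intDegree_eq H)]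

end NearPerfect

/-! ### The Poincaré inequality -/

section Retraction

lemma sum_comp_le_card_mul {α β : Type*} [DecidableEq β] {s : Finset α} {t : Finset β} {φ : α → β}
    {ψ : β → ℝ} {B : ℕ} (hmaps : ∀ x ∈ s, φ x ∈ t)
    (hcard : ∀ y ∈ t, (s.filter fun x => φ x = y).card ≤ B) (hψ : ∀ y ∈ t, 0 ≤ ψ y) :
    ∑ x ∈ s, ψ (φ x) ≤ B * ∑ y ∈ t, ψ y := by
  rw [← Finset.sum_fiberwise_of_maps_to hmaps, Finset.mul_sum]
  refine Finset.sum_le_sum fun y hy => ?_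
  rw [Finset.sum_congr rfl (g := fun _ => ψ y) (fun x hx => by rw [(Finset.mem_filter.1 hx).2]),
    Finset.sum_const, nsmul_eq_mul]
  exact mul_le_mul_of_nonneg_right (by exact_mod_cast hcard y hy) (hψ y hy)

variable {X : Type*} [Fintype X] [DecidableEq X] {Γ : X → X → Prop} {r : ℕ} {Φ : (X → X) → X → X}

/-- A retraction of the near-perfect matchings of `Γ` onto the perfect ones that moves each of them
by a Hamming distance of at most `r`. -/
structure IsRetraction (Γ : X → X → Prop) (r : ℕ) (Φ : (X → X) → X → X) : Prop where
  mem : ∀ Z ∈ nearPerfectMatchings Γ, Φ Z ∈ perfectMatchings Γ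
  hammingDist_le : ∀ Z ∈ nearPerfectMatchings Γ, hammingDist Z (Φ Z) ≤ r
  apply_eq : ∀ M ∈ perfectMatchings Γ, Φ M = M

lemma exists_isRetraction
    (hnear : ∀ Z ∈ nearPerfectMatchings Γ, ∃ M ∈ perfectMatchings Γ, hammingDist Z M ≤ r) :
    ∃ Φ, IsRetraction Γ r Φ := by
  choose! Ψ hmem hdist using hnear
  refine ⟨fun Z => if Z ∈ perfectMatchings Γ then Z else Ψ Z, fun Z hZ => ?_, fun Z hZ => ?_,
    fun M hM => if_pos hM⟩
  · split_ifs with hperfect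
    exacts [hperfect, hmem Z hZ]
  · split_ifs
    exacts [(hammingDist_self Z).trans_le (Nat.zero_le r), hdist Z hZ]

namespace IsRetraction

lemma card_fiber_le (hΦ : IsRetraction Γ r Φ) (M : X → X) :
    ((nearPerfectMatchings Γ).filter fun Z => Φ Z = M).card ≤
      (Fintype.card X * Fintype.card X + 1) ^ r := by
  refine card_le_of_hammingDist_le M r _ fun Z hZ => ?_
  obtain ⟨hnear, rfl⟩ := Finset.mem_filter.1 hZ
  rw [hammingDist_comm]
  exact hΦ.hammingDist_le Z hnear

lemma card_nearPerfectMatchings_le (hΦ : IsRetraction Γ r Φ) :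
    (nearPerfectMatchings Γ).card ≤
      (Fintype.card X * Fintype.card X + 1) ^ r * (perfectMatchings Γ).card :=
  Finset.card_le_mul_card_image_of_maps_to hΦ.mem _ fun M _ => hΦ.card_fiber_le M

lemma hammingDist_apply_le (hΦ : IsRetraction Γ r Φ) {Z Z' : X → X} {c : ℕ}
    (hZ : Z ∈ nearPerfectMatchings Γ) (hZ' : Z' ∈ nearPerfectMatchings Γ)
    (hdist : hammingDist Z Z' ≤ c) : hammingDist (Φ Z) (Φ Z') ≤ 2 * r + c := by
  have hleft := hammingDist_triangle_left (Φ Z) (Φ Z') Z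
  have hright := hammingDist_triangle Z Z' (Φ Z')
  have hmove := hΦ.hammingDist_le Z hZ
  have hmove' := hΦ.hammingDist_le Z' hZ'
  omega

lemma sum_localSum_le (hΦ : IsRetraction Γ r Φ) (F : (X → X) → ℝ) :
    ∑ Z ∈ nearPerfectMatchings Γ, localSum Γ (fun Z => F (Φ Z)) Z ≤
      ((Fintype.card X : ℝ) * Fintype.card X + 1) ^ (2 * r) *
        ∑ M ∈ perfectMatchings Γ, ∑ M' ∈ perfectMatchings Γ with hammingDist M M' ≤ 2 * r + 3,
          (F M - F M') ^ 2 := by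
  let Ω := nearPerfectMatchings Γ
  let P := (perfectMatchings Γ ×ˢ perfectMatchings Γ).filter
    fun q => hammingDist q.1 q.2 ≤ 2 * r + 3
  let Q := (Ω ×ˢ Ω).filter fun q => hammingDist q.1 q.2 ≤ 3
  let ψ : (X → X) × (X → X) → ℝ := fun q => (F q.1 - F q.2) ^ 2
  have hmaps : ∀ q ∈ Q, (Φ q.1, Φ q.2) ∈ P := fun q hq => by
    simp only [P, Q, Finset.mem_filter, Finset.mem_product] at hq ⊢
    exact ⟨⟨hΦ.mem _ hq.1.1, hΦ.mem _ hq.1.2⟩, hΦ.hammingDist_apply_le hq.1.1 hq.1.2 hq.2⟩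
  have hfiber : ∀ p ∈ P, (Q.filter fun q => (Φ q.1, Φ q.2) = p).card ≤
      (Fintype.card X * Fintype.card X + 1) ^ (2 * r) := fun p _ => by
    have hsub : (Q.filter fun q => (Φ q.1, Φ q.2) = p) ⊆
        (Ω.filter fun Z => Φ Z = p.1) ×ˢ (Ω.filter fun Z => Φ Z = p.2) := fun q hq => by
      simp only [Q, Finset.mem_filter, Finset.mem_product, Prod.ext_iff] at hq ⊢
      exact ⟨⟨hq.1.1.1, hq.2.1⟩, hq.1.1.2, hq.2.2⟩
    refine (Finset.card_le_card hsub).trans ?_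
    rw [Finset.card_product, two_mul, pow_add]
    exact Nat.mul_le_mul (hΦ.card_fiber_le p.1) (hΦ.card_fiber_le p.2)
  calc _ = ∑ q ∈ Q, ψ (Φ q.1, Φ q.2) := by
        simp only [Q, ψ, localSum, Finset.sum_filter, Finset.sum_product, Ω]
    _ ≤ ((Fintype.card X * Fintype.card X + 1) ^ (2 * r) : ℕ) * ∑ p ∈ P, ψ p :=
        sum_comp_le_card_mul hmaps hfiber fun _ _ => sq_nonneg _
    _ = _ := by
        push_cast
        simp only [P, ψ, Finset.sum_filter, Finset.sum_product]

theorem sum_perfectMatchings_sq_le (hΦ : IsRetraction Γ r Φ) (F : (X → X) → ℝ) :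
    ∑ p ∈ perfectMatchings Γ ×ˢ perfectMatchings Γ, (F p.1 - F p.2) ^ 2 ≤
      3 * (Fintype.card X + 2) * Fintype.card X ^ 7 *
        ((Fintype.card X : ℝ) * Fintype.card X + 1) ^ (3 * r) * (perfectMatchings Γ).card *
        ∑ M ∈ perfectMatchings Γ, ∑ M' ∈ perfectMatchings Γ with hammingDist M M' ≤ 2 * r + 3,
          (F M - F M') ^ 2 := by
  have hcard : ((nearPerfectMatchings Γ).card : ℝ) ≤
      ((Fintype.card X : ℝ) * Fintype.card X + 1) ^ r * (perfectMatchings Γ).card := by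
    exact_mod_cast hΦ.card_nearPerfectMatchings_le
  have hlocal_nonneg : 0 ≤ ∑ Z ∈ nearPerfectMatchings Γ, localSum Γ (fun Z => F (Φ Z)) Z :=
    Finset.sum_nonneg fun Z _ => localSum_nonneg _ Z
  calc ∑ p ∈ perfectMatchings Γ ×ˢ perfectMatchings Γ, (F p.1 - F p.2) ^ 2
      = ∑ p ∈ perfectMatchings Γ ×ˢ perfectMatchings Γ, (F (Φ p.1) - F (Φ p.2)) ^ 2 := by
        refine Finset.sum_congr rfl fun p hp => ?_
        rw [Finset.mem_product] at hp
        rw [hΦ.apply_eq _ hp.1, hΦ.apply_eq _ hp.2]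
    _ ≤ _ := sum_perfectMatchings_sq_le_sum_localSum Γ fun Z => F (Φ Z)
    _ ≤ 3 * (Fintype.card X + 2) * Fintype.card X ^ 7 *
          (((Fintype.card X : ℝ) * Fintype.card X + 1) ^ r * (perfectMatchings Γ).card) *
          (((Fintype.card X : ℝ) * Fintype.card X + 1) ^ (2 * r) * ∑ M ∈ perfectMatchings Γ,
            ∑ M' ∈ perfectMatchings Γ with hammingDist M M' ≤ 2 * r + 3, (F M - F M') ^ 2) := by
        gcongr
        exact hΦ.sum_localSum_le F
    _ = _ := by ring

end IsRetraction

end Retraction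

section Poincare

variable {n : ℕ} {d : Fin n → ℕ}

/-- The extension by zero of a function on the realizations of `d` to all graphs. -/
def extendByZero (f : Realization d → ℝ) (G : SimpleGraph (Fin n)) : ℝ :=
  if h : ∀ x, intDegree G x = d x then f (Realization.ofIntDegree G h) else 0

lemma extendByZero_val (f : Realization d → ℝ) (G : Realization d) :
    extendByZero f G.1 = f G :=
  dif_pos (Realization.intDegree_eq G)

lemma sum_perfectMatchings_sq_eq (hd : ∀ v, d v ≤ n) (f : Realization d → ℝ) :
    ∑ p ∈ perfectMatchings (gadgetRel d) ×ˢ perfectMatchings (gadgetRel d),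
      (extendByZero f (gadgetGraph p.1) - extendByZero f (gadgetGraph p.2)) ^ 2 =
    (liftCount d : ℝ) ^ 2 * ∑ G, ∑ H, (f G - f H) ^ 2 := by
  rw [Finset.sum_product, Finset.sum_congr rfl fun M _ => sum_perfectMatchings_gadgetGraph hd
      fun G => (extendByZero f (gadgetGraph M) - extendByZero f G) ^ 2,
    sum_perfectMatchings_gadgetGraph hd fun G => liftCount d * ∑ H : Realization d,
      (extendByZero f G - extendByZero f H.1) ^ 2, ← Finset.mul_sum]
  simp only [extendByZero_val]
  ring

lemma card_perfectMatchings_gadgetRel (hd : ∀ v, d v ≤ n) :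
    ((perfectMatchings (gadgetRel d)).card : ℝ) = liftCount d * numRealizations d := by
  simpa [numRealizations] using sum_perfectMatchings_gadgetGraph hd fun _ => 1

lemma sum_hammingDist_le_gadgetGraph_le (hd : ∀ v, d v ≤ n)
    {M : Gadget d → Gadget d} (hM : M ∈ perfectMatchings (gadgetRel d)) {c : ℕ}
    {φ : SimpleGraph (Fin n) → ℝ} (hφ : ∀ G, 0 ≤ φ G) :
    ∑ M' ∈ perfectMatchings (gadgetRel d) with hammingDist M M' ≤ c, φ (gadgetGraph M') ≤
      ((Fintype.card (Gadget d) : ℝ) * Fintype.card (Gadget d) + 1) ^ c *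
        ∑ H : Realization d, if edgeDist (gadgetGraph M) H.1 ≤ c then φ H.1 else 0 := by
  let B := (Fintype.card (Gadget d) * Fintype.card (Gadget d) + 1) ^ c
  let t := ((Finset.univ : Finset (Realization d)).filter
    fun H => edgeDist (gadgetGraph M) H.1 ≤ c).image Subtype.val
  have hmaps : ∀ M' ∈ (perfectMatchings (gadgetRel d)).filter fun M' => hammingDist M M' ≤ c,
      gadgetGraph M' ∈ t := fun M' hM' => by
    rw [Finset.mem_filter] at hM'
    exact Finset.mem_image.2 ⟨Realization.ofIntDegree _
      (intDegree_gadgetGraph_of_perfect hd hM'.1), Finset.mem_filter.2 ⟨Finset.mem_univ _,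
        (edgeDist_gadgetGraph_le (mem_perfectMatchings.1 hM).1
          (mem_perfectMatchings.1 hM'.1).1).trans hM'.2⟩, rfl⟩
  have hfiber : ∀ G ∈ t, (((perfectMatchings (gadgetRel d)).filter
      fun M' => hammingDist M M' ≤ c).filter fun M' => gadgetGraph M' = G).card ≤ B :=
    fun G _ => card_le_of_hammingDist_le M c _ fun M' hM' =>
      (Finset.mem_filter.1 (Finset.mem_filter.1 hM').1).2
  refine (sum_comp_le_card_mul hmaps hfiber fun G _ => hφ G).trans (le_of_eq ?_)
  rw [Finset.sum_image Subtype.val_injective.injOn, Finset.sum_filter]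
  push_cast [B]
  rfl

lemma sum_near_perfectMatchings_le (hd : ∀ v, d v ≤ n)
    (f : Realization d → ℝ) (c : ℕ) :
    ∑ M ∈ perfectMatchings (gadgetRel d),
      ∑ M' ∈ perfectMatchings (gadgetRel d) with hammingDist M M' ≤ c,
        (extendByZero f (gadgetGraph M) - extendByZero f (gadgetGraph M')) ^ 2 ≤
    ((Fintype.card (Gadget d) : ℝ) * Fintype.card (Gadget d) + 1) ^ c *
      (liftCount d * pairSum (nearRel c) f) := by
  refine (Finset.sum_le_sum fun M hM => sum_hammingDist_le_gadgetGraph_le hd hM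
    (φ := fun G => (extendByZero f (gadgetGraph M) - extendByZero f G) ^ 2)
    fun _ => sq_nonneg _).trans (le_of_eq ?_)
  rw [← Finset.mul_sum, sum_perfectMatchings_gadgetGraph hd fun G => ∑ H : Realization d,
    if edgeDist G H.1 ≤ c then (extendByZero f G - extendByZero f H.1) ^ 2 else 0]
  simp only [extendByZero_val]
  congr 2
  exact Finset.sum_congr rfl fun G _ => Finset.sum_congr rfl fun H _ => if_congr Iff.rfl rfl rfl

lemma IsRetraction.sum_sq_le_pairSum_nearRel {r : ℕ}
    {Φ : (Gadget d → Gadget d) → Gadget d → Gadget d} (hΦ : IsRetraction (gadgetRel d) r Φ)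
    (hd : ∀ v, d v ≤ n) (f : Realization d → ℝ) :
    ∑ G, ∑ H, (f G - f H) ^ 2 ≤
      3 * (Fintype.card (Gadget d) + 2) * Fintype.card (Gadget d) ^ 7 *
        ((Fintype.card (Gadget d) : ℝ) * Fintype.card (Gadget d) + 1) ^ (5 * r + 3) *
        numRealizations d * pairSum (nearRel (2 * r + 3)) f := by
  have hlift : (0 : ℝ) < (liftCount d : ℝ) ^ 2 := pow_pos (Nat.cast_pos.2 liftCount_pos) 2
  have hsum := hΦ.sum_perfectMatchings_sq_le fun M => extendByZero f (gadgetGraph M)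
  have hnear := sum_near_perfectMatchings_le hd f (2 * r + 3)
  rw [sum_perfectMatchings_sq_eq hd, card_perfectMatchings_gadgetRel hd] at hsum
  refine le_of_mul_le_mul_left (hsum.trans ?_) hlift
  grw [hnear]
  refine le_of_eq ?_
  rw [show 5 * r + 3 = 3 * r + (2 * r + 3) by ring, pow_add]
  ring

lemma IsRetraction.sum_sq_le_pairSum_switchRel {r : ℕ}
    {Φ : (Gadget d → Gadget d) → Gadget d → Gadget d} (hΦ : IsRetraction (gadgetRel d) r Φ)
    (hd : ∀ v, d v ≤ n) (f : Realization d → ℝ) :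
    ∑ G, ∑ H, (f G - f H) ^ 2 ≤
      3 * (2 * (n : ℝ) ^ 2 + 2) * (2 * (n : ℝ) ^ 2) ^ 7 *
        ((2 * (n : ℝ) ^ 2) * (2 * (n : ℝ) ^ 2) + 1) ^ (5 * r + 3) *
        (8 * (2 * (n : ℝ) ^ 2 + 1) ^ 8) ^ (2 * r + 3) * numRealizations d *
        pairSum switchRel f := by
  have hcard : (Fintype.card (Gadget d) : ℝ) ≤ 2 * (n : ℝ) ^ 2 := by
    exact_mod_cast card_gadget_le d
  refine (hΦ.sum_sq_le_pairSum_nearRel hd f).trans ?_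
  rw [mul_assoc _ (numRealizations d : ℝ), mul_assoc _ (numRealizations d : ℝ),
    mul_assoc _ (_ ^ (2 * r + 3)), mul_left_comm (_ ^ (2 * r + 3))]
  refine mul_le_mul ?_ (mul_le_mul_of_nonneg_left (pairSum_nearRel_le _ f) (Nat.cast_nonneg _))
    (mul_nonneg (Nat.cast_nonneg _) (pairSum_nonneg _ f)) (by positivity)
  gcongr

/-- The polynomial factor relating the sum of `(f G - f H) ^ 2` over all pairs of realizations to
the sum over the switches; `54` is the distance of a near-perfect matching of the gadget from the
perfect ones. -/
def poincareBound {R : Type*} [CommSemiring R] (x : R) : R :=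
  3 * (2 * x ^ 2 + 2) * (2 * x ^ 2) ^ 7 * ((2 * x ^ 2) * (2 * x ^ 2) + 1) ^ (5 * 54 + 3) *
    (8 * (2 * x ^ 2 + 1) ^ 8) ^ (2 * 54 + 3)

lemma map_poincareBound {R S : Type*} [CommSemiring R] [CommSemiring S] (φ : R →+* S) (x : R) :
    φ (poincareBound x) = poincareBound (φ x) := by
  simp only [poincareBound, map_mul, map_add, map_pow, map_ofNat, map_one]

lemma poincareBound_nonneg (n : ℕ) : 0 ≤ poincareBound (n : ℝ) := by
  unfold poincareBound
  positivity

theorem CornerBound.sum_sq_le_pairSum_switchRel {c₁ c₂ m : ℕ} (hd : CornerBound d c₁ c₂ m)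
    (f : Realization d → ℝ) :
    ∑ G, ∑ H, (f G - f H) ^ 2 ≤
      poincareBound (n : ℝ) * numRealizations d * pairSum switchRel f := by
  obtain ⟨Φ, hΦ⟩ := exists_isRetraction fun Z hZ => hd.exists_near_perfectMatching hZ
  exact hΦ.sum_sq_le_pairSum_switchRel hd.le_card f

end Poincare

/-! ### The switch chain -/

section SwitchCount

variable {V : Type*}

/-- The eight symmetries of the square with corners `0`, `1`, `2`, `3`: the rotations `k + i` and
the reflections `k - i`. -/
def squareSymm (b : Bool) (k : Fin 4) : Fin 4 ↪ Fin 4 where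
  toFun i := if b then k + i else k - i
  inj' := by revert b k; decide

lemma squareSymm_injective :
    ∀ b b' k k', squareSymm b k = squareSymm b' k' → b = b' ∧ k = k' := by
  simp only [DFunLike.ext_iff]
  decide

/-- The graph of the 4-cycle through the points of `τ`. -/
def cycleThrough (τ : Fin 4 ↪ V) : SimpleGraph V := fourCycle (τ 0) (τ 1) (τ 2) (τ 3)

lemma fourCycle_reverse (a b c e : V) : fourCycle e c b a = fourCycle a b c e := by
  simp only [fourCycle, SimpleGraph.edge_comm e c, SimpleGraph.edge_comm c b,
    SimpleGraph.edge_comm b a, SimpleGraph.edge_comm a e]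
  ac_rfl

lemma cycleThrough_squareSymm (τ : Fin 4 ↪ V) (b : Bool) (k : Fin 4) :
    cycleThrough ((squareSymm b k).trans τ) = cycleThrough τ := by
  cases b <;> fin_cases k
  · exact (fourCycle_rotate _ _ _ _).symm.trans (fourCycle_reverse _ _ _ _)
  · exact ((fourCycle_rotate _ _ _ _).trans (fourCycle_rotate _ _ _ _)).trans
      (fourCycle_reverse _ _ _ _)
  · exact (fourCycle_rotate _ _ _ _).trans (fourCycle_reverse _ _ _ _)
  · exact fourCycle_reverse _ _ _ _
  · rfl
  · exact fourCycle_rotate _ _ _ _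
  · exact (fourCycle_rotate _ _ _ _).trans (fourCycle_rotate _ _ _ _)
  · exact (fourCycle_rotate _ _ _ _).symm

lemma IsSwitch.exists_cycleThrough {n : ℕ} {G H : SimpleGraph (Fin n)} (h : IsSwitch G H) :
    ∃ τ : Fin 4 ↪ Fin n, H = G ∆ cycleThrough τ := by
  obtain ⟨a, b, c, e, halt, rfl⟩ := isSwitch_iff.1 h
  refine ⟨⟨![a, b, c, e], fun i j hij => ?_⟩, rfl⟩
  have := halt.adj_ab.ne
  have := halt.adj_ce.ne
  have := halt.ne_bc
  have := halt.ne_ea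
  have := halt.ne_ac
  have := halt.ne_be
  fin_cases i <;> fin_cases j <;> simp_all

lemma card_le_of_forall_exists_cycleThrough [Fintype V] (G : SimpleGraph V)
    (s : Finset (SimpleGraph V)) (hs : ∀ H : s, ∃ τ, (H : SimpleGraph V) = G ∆ cycleThrough τ) :
    s.card ≤ 3 * (Fintype.card V).choose 4 := by
  choose τ hτ using hs
  let φ : s × Bool × Fin 4 → (Fin 4 ↪ V) := fun p => (squareSymm p.2.1 p.2.2).trans (τ p.1)
  have hφ : Function.Injective φ := by
    rintro ⟨H, b, k⟩ ⟨H', b', k'⟩ heq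
    have hcycle : cycleThrough (τ H) = cycleThrough (τ H') := by
      rw [← cycleThrough_squareSymm _ b k, ← cycleThrough_squareSymm (τ H') b' k']
      exact congrArg cycleThrough heq
    obtain rfl : H = H' := Subtype.ext <| by rw [hτ H, hcycle, ← hτ H']
    obtain ⟨rfl, rfl⟩ := squareSymm_injective b b' k k' <|
      DFunLike.ext _ _ fun i => (τ H).injective (DFunLike.congr_fun heq i)
    rfl
  have hcard := Fintype.card_le_of_injective φ hφ
  simp only [Fintype.card_embedding_eq, Fintype.card_prod, Fintype.card_bool, Fintype.card_fin,
    Fintype.card_coe, Nat.descFactorial_eq_factorial_mul_choose,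
    show Nat.factorial 4 = 24 from rfl] at hcard
  omega

lemma card_isSwitch_le {n : ℕ} (G : SimpleGraph (Fin n)) (s : Finset (SimpleGraph (Fin n)))
    (hs : ∀ H ∈ s, IsSwitch G H) : s.card ≤ 3 * n.choose 4 := by
  simpa only [Fintype.card_fin] using
    card_le_of_forall_exists_cycleThrough G s fun H => (hs H H.2).exists_cycleThrough

lemma IsSwitch.choose_pos {n : ℕ} {G H : SimpleGraph (Fin n)} (h : IsSwitch G H) :
    0 < n.choose 4 := by
  have hcard := card_isSwitch_le G {H} (by simpa only [Finset.mem_singleton, forall_eq] using h)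
  rw [Finset.card_singleton] at hcard
  omega

end SwitchCount

section Chain

variable {n : ℕ} {d : Fin n → ℕ}

lemma switchProb_nonneg (G H : SimpleGraph (Fin n)) : 0 ≤ switchProb G H := by
  unfold switchProb
  split_ifs <;> positivity

lemma switchProb_comm (G H : SimpleGraph (Fin n)) : switchProb G H = switchProb H G :=
  if_congr ⟨IsSwitch.symm, IsSwitch.symm⟩ rfl rfl

lemma sum_switchProb_le (G : Realization d) : ∑ K : Realization d, switchProb G.1 K.1 ≤ 1 / 2 := by
  unfold switchProb
  rw [← Finset.sum_filter, Finset.sum_const, nsmul_eq_mul]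
  set s : Finset (Realization d) := {K | IsSwitch G.1 K.1}
  have hcard : s.card ≤ 3 * n.choose 4 := by
    rw [← Finset.card_image_of_injective s Subtype.val_injective]
    refine card_isSwitch_le G.1 _ fun H hH => ?_
    obtain ⟨K, hK, rfl⟩ := Finset.mem_image.1 hH
    exact (Finset.mem_filter.1 hK).2
  have hcard' : (s.card : ℝ) ≤ 3 * n.choose 4 := by exact_mod_cast hcard
  refine (mul_le_mul_of_nonneg_right hcard' (by positivity)).trans ?_
  rw [mul_one_div, mul_div_mul_comm]
  linarith [div_self_le_one (n.choose 4 : ℝ)]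

/-- The action of the transition matrix of the switch chain on functions. -/
def chainStep (f : Realization d → ℝ) : Realization d → ℝ := (switchMatrix d).mulVec f

lemma chainStep_apply (f : Realization d → ℝ) (G : Realization d) :
    chainStep f G = f G + ∑ H, switchProb G.1 H.1 * (f H - f G) := by
  have hoff : ∑ H ∈ Finset.univ.erase G, switchMatrix d G H * f H =
      ∑ H ∈ Finset.univ.erase G, switchProb G.1 H.1 * f H :=
    Finset.sum_congr rfl fun H hH => by
      simp only [switchMatrix, if_neg (Finset.ne_of_mem_erase hH).symm]
  have hdiag : switchMatrix d G G = 1 - ∑ K ∈ Finset.univ.erase G, switchProb G.1 K.1 :=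
    if_pos rfl
  rw [chainStep, Matrix.mulVec, dotProduct, ← Finset.add_sum_erase _ _ (Finset.mem_univ G), hoff,
    hdiag,
    ← Finset.add_sum_erase _ _ (Finset.mem_univ G), sub_self, mul_zero, zero_add]
  simp only [mul_sub, Finset.sum_sub_distrib, ← Finset.sum_mul]
  ring

lemma switchMatrix_comm (G H : Realization d) : switchMatrix d G H = switchMatrix d H G := by
  by_cases h : G = H
  · rw [h]
  · simp only [switchMatrix, if_neg h, if_neg (Ne.symm h), switchProb_comm]

/-- Twice the Dirichlet form of the switch chain with respect to the counting measure. -/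
def switchEnergy (f : Realization d → ℝ) : ℝ :=
  ∑ G : Realization d, ∑ H : Realization d, switchProb G.1 H.1 * (f G - f H) ^ 2

lemma switchEnergy_nonneg (f : Realization d → ℝ) : 0 ≤ switchEnergy f :=
  Finset.sum_nonneg fun _ _ => Finset.sum_nonneg fun _ _ =>
    mul_nonneg (switchProb_nonneg _ _) (sq_nonneg _)

lemma sum_switchProb_mul_comm (F : Realization d → Realization d → ℝ) :
    ∑ G, ∑ H, switchProb G.1 H.1 * F G H = ∑ G, ∑ H, switchProb G.1 H.1 * F H G := by
  rw [Finset.sum_comm]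
  simp only [switchProb_comm]

lemma sum_chainStep (f : Realization d → ℝ) : ∑ G, chainStep f G = ∑ G, f G := by
  have hantisymm := sum_switchProb_mul_comm fun G H => f H - f G
  simp only [chainStep_apply, Finset.sum_add_distrib, mul_sub, Finset.sum_sub_distrib]
    at hantisymm ⊢
  linarith

lemma chainStep_sq_le (f : Realization d → ℝ) (G : Realization d) :
    chainStep f G ^ 2 ≤ f G ^ 2 + 2 * ∑ H, switchProb G.1 H.1 * (f G * (f H - f G)) +
      (∑ H, switchProb G.1 H.1 * (f G - f H) ^ 2) / 2 := by
  have hcauchy : (∑ H : Realization d, switchProb G.1 H.1 * (f H - f G)) ^ 2 ≤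
      (∑ H : Realization d, switchProb G.1 H.1) *
        ∑ H : Realization d, switchProb G.1 H.1 * (f G - f H) ^ 2 :=
    Finset.sum_sq_le_sum_mul_sum_of_sq_le_mul _ (fun H _ => switchProb_nonneg _ _)
      (fun H _ => mul_nonneg (switchProb_nonneg _ _) (sq_nonneg _)) fun H _ => le_of_eq (by ring)
  have hnonneg : 0 ≤ ∑ H : Realization d, switchProb G.1 H.1 * (f G - f H) ^ 2 :=
    Finset.sum_nonneg fun H _ => mul_nonneg (switchProb_nonneg _ _) (sq_nonneg _)
  have hhalf := mul_le_mul_of_nonneg_right (sum_switchProb_le G) hnonneg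
  have hcross : ∑ H : Realization d, switchProb G.1 H.1 * (f G * (f H - f G)) =
      f G * ∑ H : Realization d, switchProb G.1 H.1 * (f H - f G) := by
    simp only [Finset.mul_sum, mul_left_comm]
  rw [chainStep_apply, add_sq, hcross]
  linarith

lemma two_mul_sum_switchProb_mul (f : Realization d → ℝ) :
    2 * ∑ G : Realization d, ∑ H : Realization d, switchProb G.1 H.1 * (f G * (f H - f G)) =
      -switchEnergy f := by
  rw [two_mul]
  nth_rw 2 [sum_switchProb_mul_comm]
  simp only [switchEnergy, ← Finset.sum_add_distrib, ← Finset.sum_neg_distrib, ← mul_add]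
  exact Finset.sum_congr rfl fun G _ => Finset.sum_congr rfl fun H _ => by ring

lemma sum_sq_chainStep_le (f : Realization d → ℝ) :
    ∑ G, chainStep f G ^ 2 ≤ ∑ G, f G ^ 2 - switchEnergy f / 2 := by
  refine (Finset.sum_le_sum fun G _ => chainStep_sq_le f G).trans (le_of_eq ?_)
  rw [Finset.sum_add_distrib, Finset.sum_add_distrib, ← Finset.mul_sum, two_mul_sum_switchProb_mul,
    ← Finset.sum_div, ← switchEnergy]
  ring

lemma pairSum_switchRel_le (f : Realization d → ℝ) :
    pairSum switchRel f ≤ 6 * (n : ℝ) ^ 4 * switchEnergy f := by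
  simp only [pairSum, switchEnergy, Finset.mul_sum]
  refine Finset.sum_le_sum fun G _ => Finset.sum_le_sum fun H _ => ?_
  unfold switchRel switchProb
  split_ifs with hswitch
  · have hpos : (0 : ℝ) < n.choose 4 := by exact_mod_cast hswitch.choose_pos
    have hle : (n.choose 4 : ℝ) ≤ (n : ℝ) ^ 4 := by exact_mod_cast Nat.choose_le_pow n 4
    rw [← mul_assoc, mul_one_div]
    refine le_mul_of_one_le_left (sq_nonneg _) ?_
    rw [one_le_div (by positivity)]
    linarith
  · rw [zero_mul, mul_zero]

end Chain

section Mixing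

variable {n : ℕ} {d : Fin n → ℕ} {c₁ c₂ m : ℕ}

/-- A polynomial bound, in the number of vertices, for the relaxation time of the switch chain. -/
def relaxBound {R : Type*} [CommSemiring R] (x : R) : R := 6 * x ^ 4 * poincareBound x + 1

lemma map_relaxBound {R S : Type*} [CommSemiring R] [CommSemiring S] (φ : R →+* S) (x : R) :
    φ (relaxBound x) = relaxBound (φ x) := by
  simp only [relaxBound, map_mul, map_add, map_pow, map_ofNat, map_one, map_poincareBound]

lemma one_le_relaxBound (n : ℕ) : 1 ≤ relaxBound (n : ℝ) :=
  le_add_of_nonneg_left (mul_nonneg (by positivity) (poincareBound_nonneg n))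

lemma one_sub_inv_relaxBound_nonneg (n : ℕ) : 0 ≤ 1 - (relaxBound (n : ℝ))⁻¹ :=
  sub_nonneg.2 (inv_le_one_of_one_le₀ (one_le_relaxBound n))

lemma sum_sum_sub_sq {Ω : Type*} [Fintype Ω] (f : Ω → ℝ) (hf : ∑ x, f x = 0) :
    ∑ x, ∑ y, (f x - f y) ^ 2 = 2 * Fintype.card Ω * ∑ x, f x ^ 2 := by
  simp only [sub_sq, Finset.sum_add_distrib, Finset.sum_sub_distrib, ← Finset.mul_sum, hf,
    mul_zero, Finset.sum_const, Finset.card_univ, nsmul_eq_mul]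
  ring

lemma CornerBound.sum_sq_le_switchEnergy (hd : CornerBound d c₁ c₂ m) (f : Realization d → ℝ)
    (hf : ∑ G, f G = 0) :
    2 * ∑ G, f G ^ 2 ≤ (relaxBound (n : ℝ) - 1) * switchEnergy f := by
  rcases isEmpty_or_nonempty (Realization d) with h | h
  · simp [switchEnergy]
  have hcard : (0 : ℝ) < numRealizations d := Nat.cast_pos.2 Fintype.card_pos
  have hpoincare := hd.sum_sq_le_pairSum_switchRel f
  rw [sum_sum_sub_sq f hf, ← numRealizations] at hpoincare
  refine le_of_mul_le_mul_left ?_ hcard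
  calc (numRealizations d : ℝ) * (2 * ∑ G, f G ^ 2)
      = 2 * numRealizations d * ∑ G, f G ^ 2 := by ring
    _ ≤ poincareBound (n : ℝ) * numRealizations d * pairSum switchRel f := hpoincare
    _ ≤ poincareBound (n : ℝ) * numRealizations d * (6 * (n : ℝ) ^ 4 * switchEnergy f) :=
        mul_le_mul_of_nonneg_left (pairSum_switchRel_le f)
          (mul_nonneg (poincareBound_nonneg n) hcard.le)
    _ = numRealizations d * ((relaxBound (n : ℝ) - 1) * switchEnergy f) := by
        rw [relaxBound]
        ring

lemma CornerBound.sum_sq_chainStep_le (hd : CornerBound d c₁ c₂ m) (f : Realization d → ℝ)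
    (hf : ∑ G, f G = 0) :
    ∑ G, chainStep f G ^ 2 ≤ (1 - (relaxBound (n : ℝ))⁻¹) * ∑ G, f G ^ 2 := by
  have hpos := zero_lt_one.trans_le (one_le_relaxBound n)
  have hcontract : (relaxBound (n : ℝ))⁻¹ * ∑ G, f G ^ 2 ≤ switchEnergy f / 2 := by
    rw [inv_mul_le_iff₀ hpos]
    linarith [hd.sum_sq_le_switchEnergy f hf, switchEnergy_nonneg f]
  linarith [FullyGraphic.sum_sq_chainStep_le f]

/-- The difference of the distribution of the switch chain after `t` steps, started from `G`, and
the uniform distribution. -/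
def deviation (d : Fin n → ℕ) (t : ℕ) (G H : Realization d) : ℝ :=
  (switchMatrix d ^ t) G H - 1 / (numRealizations d : ℝ)

lemma chainStep_sub_const (f : Realization d → ℝ) (c : ℝ) (G : Realization d) :
    chainStep (fun H => f H - c) G = chainStep f G - c := by
  simp only [chainStep_apply, sub_sub_sub_cancel_right]
  ring

lemma switchMatrix_pow_succ_apply (t : ℕ) (G H : Realization d) :
    (switchMatrix d ^ (t + 1)) G H = chainStep ((switchMatrix d ^ t) G) H := by
  rw [pow_succ, Matrix.mul_apply, chainStep, Matrix.mulVec, dotProduct]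
  exact Finset.sum_congr rfl fun K _ => by rw [switchMatrix_comm H K, mul_comm]

lemma deviation_succ (t : ℕ) (G : Realization d) :
    deviation d (t + 1) G = chainStep (deviation d t G) := by
  funext H
  rw [deviation, switchMatrix_pow_succ_apply, ← chainStep_sub_const]
  rfl

lemma sum_deviation (t : ℕ) (G : Realization d) : ∑ H, deviation d t G H = 0 := by
  induction t with
  | zero =>
    have hcard : (numRealizations d : ℝ) ≠ 0 := Nat.cast_ne_zero.2 (Fintype.card_pos_iff.2 ⟨G⟩).ne'
    simp only [deviation, pow_zero, Matrix.one_apply, Finset.sum_sub_distrib, Finset.sum_ite_eq,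
      Finset.mem_univ, if_true, Finset.sum_const, nsmul_eq_mul, Finset.card_univ]
    rw [← numRealizations, mul_one_div_cancel hcard, sub_self]
  | succ t ih => rw [deviation_succ, sum_chainStep, ih]

lemma sum_sq_deviation_zero_le (G : Realization d) : ∑ H, deviation d 0 G H ^ 2 ≤ 1 := by
  have hsq : ∀ H, deviation d 0 G H ^ 2 =
      (if G = H then deviation d 0 G H else 0) - 1 / numRealizations d * deviation d 0 G H := by
    intro H
    rw [deviation, pow_zero, Matrix.one_apply]
    split_ifs <;> ring
  simp only [hsq, Finset.sum_sub_distrib, ← Finset.mul_sum, sum_deviation, Finset.sum_ite_eq,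
    Finset.mem_univ, if_true, mul_zero, sub_zero]
  rw [deviation, pow_zero, Matrix.one_apply_eq]
  exact sub_le_self _ (by positivity)

lemma CornerBound.sum_sq_deviation_le (hd : CornerBound d c₁ c₂ m) (t : ℕ) (G : Realization d) :
    ∑ H, deviation d t G H ^ 2 ≤ (1 - (relaxBound (n : ℝ))⁻¹) ^ t := by
  induction t with
  | zero => simpa only [pow_zero] using sum_sq_deviation_zero_le G
  | succ t ih =>
    rw [deviation_succ, pow_succ']
    exact (hd.sum_sq_chainStep_le _ (sum_deviation t G)).trans
      (mul_le_mul_of_nonneg_left ih (one_sub_inv_relaxBound_nonneg n))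

lemma numRealizations_le_exp (d : Fin n → ℕ) :
    (numRealizations d : ℝ) ≤ Real.exp ((n : ℝ) ^ 2) := by
  have hcard : numRealizations d ≤ 2 ^ (n * n) := by
    simpa only [numRealizations, Fintype.card_fun, Fintype.card_prop, Fintype.card_prod,
      Fintype.card_fin] using
      Fintype.card_le_of_injective (fun G : Realization d => adjFun G.1)
        fun G H h => Subtype.ext (adjFun_injective h)
  calc (numRealizations d : ℝ) ≤ 2 ^ (n * n) := by exact_mod_cast hcard
    _ ≤ Real.exp 1 ^ (n * n) := by
        gcongr
        linarith [Real.add_one_le_exp (1 : ℝ)]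
    _ = Real.exp ((n : ℝ) ^ 2) := by
        rw [← Real.exp_nat_mul, mul_one, Nat.cast_mul, sq]

lemma one_sub_inv_relaxBound_pow_le (n t : ℕ) :
    (1 - (relaxBound (n : ℝ))⁻¹) ^ t ≤ Real.exp (-(t / relaxBound (n : ℝ))) := by
  refine (pow_le_pow_left₀ (one_sub_inv_relaxBound_nonneg n)
    (Real.one_sub_le_exp_neg _) t).trans (le_of_eq ?_)
  rw [← Real.exp_nat_mul, mul_neg, div_eq_mul_inv]

lemma CornerBound.distToUniform_sq_le (hd : CornerBound d c₁ c₂ m) (t : ℕ) (G : Realization d) :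
    distToUniform d t G ^ 2 ≤ Real.exp ((n : ℝ) ^ 2 - t / relaxBound (n : ℝ)) := by
  have hcauchy : (∑ H, |deviation d t G H|) ^ 2 ≤
      numRealizations d * ∑ H, deviation d t G H ^ 2 := by
    simpa only [numRealizations, sq_abs, Finset.card_univ] using
      sq_sum_le_card_mul_sum_sq (s := Finset.univ) (f := fun H => |deviation d t G H|)
  have hdecay := (hd.sum_sq_deviation_le t G).trans (one_sub_inv_relaxBound_pow_le n t)
  have hdist : distToUniform d t G = 1 / 2 * ∑ H, |deviation d t G H| := rfl
  calc distToUniform d t G ^ 2 ≤ (∑ H, |deviation d t G H|) ^ 2 := by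
        rw [hdist, mul_pow]
        linarith [sq_nonneg (∑ H, |deviation d t G H|)]
    _ ≤ numRealizations d * ∑ H, deviation d t G H ^ 2 := hcauchy
    _ ≤ Real.exp ((n : ℝ) ^ 2) * Real.exp (-(t / relaxBound (n : ℝ))) :=
        mul_le_mul (numRealizations_le_exp d) hdecay (Finset.sum_nonneg fun _ _ => sq_nonneg _)
          (Real.exp_pos _).le
    _ = Real.exp ((n : ℝ) ^ 2 - t / relaxBound (n : ℝ)) := by rw [sub_eq_add_neg, Real.exp_add]

lemma CornerBound.mixesWithin (hd : CornerBound d c₁ c₂ m) {ε : ℝ} (hε : 0 < ε) {t : ℕ}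
    (ht : relaxBound (n : ℝ) * ((n : ℝ) ^ 2 + 2 * Real.log (1 / ε)) ≤ t) : MixesWithin d ε t := by
  intro s hts G
  have hpos := zero_lt_one.trans_le (one_le_relaxBound n)
  have hts' : (t : ℝ) ≤ s := Nat.cast_le.2 hts
  have hexp : (n : ℝ) ^ 2 - s / relaxBound (n : ℝ) ≤ 2 * Real.log ε := by
    have hs := (le_div_iff₀' hpos).2 (ht.trans hts')
    rw [one_div, Real.log_inv] at hs
    linarith
  refine le_of_sq_le_sq ((hd.distToUniform_sq_le s G).trans ?_) hε.le
  calc Real.exp ((n : ℝ) ^ 2 - s / relaxBound (n : ℝ)) ≤ Real.exp (2 * Real.log ε) :=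
        Real.exp_le_exp.2 hexp
    _ = ε ^ 2 := by
        rw [two_mul, Real.exp_add, Real.exp_log hε, sq]

theorem isRapidlyMixing_maxFullyGraphicRegion : IsRapidlyMixing maxFullyGraphicRegion := by
  refine ⟨relaxBound (MvPolynomial.X 0) * (MvPolynomial.X 0 ^ 2 + 2 * MvPolynomial.X 1) + 1, ?_⟩
  intro s hs _ ε hε hε1
  obtain ⟨c₁, c₂, m, hd⟩ := exists_cornerBound_of_mem hs
  have hlog : 0 ≤ Real.log (1 / ε) := Real.log_nonneg ((one_le_div hε).2 hε1.le)
  have hpos := zero_lt_one.trans_le (one_le_relaxBound s.1)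
  refine ⟨⌈relaxBound (s.1 : ℝ) * ((s.1 : ℝ) ^ 2 + 2 * Real.log (1 / ε))⌉₊, ?_,
    hd.mixesWithin hε (Nat.le_ceil _)⟩
  simp only [map_add, map_mul, map_relaxBound, map_pow, map_one, map_ofNat, MvPolynomial.eval_X,
    Matrix.cons_val_zero, Matrix.cons_val_one]
  exact (Nat.ceil_lt_add_one (by positivity)).le

end Mixing

end

end FullyGraphic

theorem corollary1p4 :
    FullyGraphic.IsStable (3 * Polynomial.X ^ 13) FullyGraphic.maxFullyGraphicRegion ∧
      FullyGraphic.IsPStable FullyGraphic.maxFullyGraphicRegion ∧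
      FullyGraphic.IsRapidlyMixing FullyGraphic.maxFullyGraphicRegion :=
  ⟨FullyGraphic.isStable_maxFullyGraphicRegion,
    ⟨FullyGraphic.infinite_maxFullyGraphicRegion, _, FullyGraphic.isStable_maxFullyGraphicRegion⟩,
    FullyGraphic.isRapidlyMixing_maxFullyGraphicRegion⟩
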